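/- Let $N\ge1$ and $p>1$ be fixed, and put $p_F:=1+\frac2N$. For $\alpha\in(0,1)$ and a nonnegative Radon measure $\mu$ on $\mathbf R^N$ consider the Cauchy problem $$\partial_t^\alpha u-\Delta u=u^p\ \text{ in }(0,T)\times\mathbf R^N,\qquad u(0)=\mu, \tag{1}$$ where $\partial_t^\alpha$ is the Caputo derivative. With $G(t,x)=(4\pi t)^{-N/2}e^{-|x|^2/(4t)}$, $[e^{t\Delta}\mu](x)=\int_{\mathbf R^N} G(t,x-y)\,d\mu(y)$ (a function $\phi\ge0$ being identified with the measure $\phi\,dx$) and the probability density $$h_\alpha(\theta)=\sum_{n=0}^\infty\frac{(-\theta)^n}{n!\,\Gamma(1-\alpha-\alpha n)}\quad(\theta>0,\ 1/\Gamma:=0\text{ at the poles of }\Gamma),$$ put $P_\alpha(t)=\int_0^\infty h_\alpha(\theta)e^{t^\alpha\theta\Delta}\,d\theta$ and $S_\alpha(t)=\int_0^\infty\theta h_\alpha(\theta)e^{t^\alpha\theta\Delta}\,d\theta$. For $0<T<\infty$, a nonnegative measurable function $u$ on $(0,T]\times\mathbf R^N$ is a solution of (1) in $[0,T]\times\mathbf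 R^N$ if $$\infty>u(t,x)=[P_\alpha(t)\mu](x)+\alpha\int_0^t(t-s)^{\alpha-1}[S_\alpha(t-s)u(s)^p](x)\,ds$$ for almost all $t\in(0,T]$ and $x\in\mathbf R^N$. Problem (1) possesses a local-in-time solution if it has a solution in $[0,T]\times\mathbf R^N$ for some $T>0$. The minimal solution in $[0,T]\times\mathbf R^N$ is a solution that is almost everywhere $\le$ every solution in $[0,T]\times\mathbf R^N$, and the life span $T_\alpha[\mu]\in[0,\infty]$ is the supremum of all $T>0$ such that the minimal solution in $[0,T]\times\mathbf R^N$ exists. Let $\mu=\kappa\delta_N$, where $\kappa>0$ and $\delta_N$ is the Dirac measure at the origin of $\mathbf R^N$. Then: (i) If $p<p_F$, then for every $\alpha\in(0,1)$ and every $\kappa>0$ problem (1) possesses a local-in-time solution. Furthermore $$T_\alpha[\kappa\delta_N]\simeq\kappa^{-\frac{2(p-1)}{\alpha(2-N(p-1))}},$$ that is, there are $0<c(\alpha)<C(\alpha)$, $\alpha\in(0,1)$, independent of $\kappa$, with $$c(\alpha)\,\kappa^{-\frac{2(p-1)}{\alpha(2-N(p-1))}}\le T_\alpha[\kappa\delta_N]\le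 C(\alpha)\,\kappa^{-\frac{2(p-1)}{\alpha(2-N(p-1))}}\quad\text{for all }\kappa>0,\ \alpha\in(0,1),$$ such that $\limsup_{\alpha\to1-0}c(\alpha)\in(0,\infty)$ and $\limsup_{\alpha\to1-0}C(\alpha)\in(0,\infty)$. (ii) If $p=p_F$, then for every $\alpha\in(0,1)$ there exists $\kappa(\alpha)>0$ such that problem (1) possesses a local-in-time solution if $0<\kappa<\kappa(\alpha)$, and possesses no local-in-time solution if $\kappa>\kappa(\alpha)$. (iii) If $p>p_F$, then for every $\alpha\in(0,1)$ and every $\kappa>0$ problem (1) possesses no local-in-time solution. -/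

import Mathlib

open MeasureTheory Set Filter Topology
open scoped ENNReal

noncomputable section

namespace TimeFractionalFujita

/-- The space `ℝ^N` with its Euclidean norm. -/
abbrev Space (N : ℕ) : Type := EuclideanSpace ℝ (Fin N)

/-- The Fujita exponent `p_F = 1 + 2 / N`. -/
def fujitaExponent (N : ℕ) : ℝ := 1 + 2 / (N : ℝ)

/-- The Gauss kernel `G(t, x) = (4 π t)^{-N/2} exp(-|x|² / (4 t))`. -/
def heatKernel (N : ℕ) (t : ℝ) (x : Space N) : ℝ :=
  1 / (4 * Real.pi * t) ^ ((N : ℝ) / 2) * Real.exp (-‖x‖ ^ 2 / (4 * t))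

/-- `(e^{tΔ} μ)(x) = ∫ G(t, x - y) dμ(y)`, with values in `[0, ∞]`, for a nonnegative measure `μ`. -/
def heatFlow {N : ℕ} (t : ℝ) (μ : Measure (Space N)) (x : Space N) : ℝ≥0∞ :=
  ∫⁻ y, ENNReal.ofReal (heatKernel N t (x - y)) ∂μ

/-- The probability density `h_α` on `(0, ∞)` of the subordination formula, that is the
Wright-type (Mainardi) function `h_α(θ) = ∑_{n ≥ 0} (-θ)^n / (n! Γ(1 - α - α n))`.
It is the density with `∫_0^∞ h_α(θ) e^{zθ} dθ = E_{α,1}(z)`, the Mittag-Leffler function.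
As `Real.Gamma` vanishes at the poles of `Γ`, the terms with `1 - α - α n ∈ {0, -1, -2, …}` are `0`,
in agreement with `1 / Γ = 0` there. -/
def wrightDensity (α θ : ℝ) : ℝ :=
  ∑' n : ℕ, (-θ) ^ n / ((n.factorial : ℝ) * Real.Gamma (1 - α - α * n))

/-- `P_α(t) μ = ∫_0^∞ h_α(θ) e^{t^α θ Δ} μ dθ`. -/
def solutionOpP {N : ℕ} (α t : ℝ) (μ : Measure (Space N)) (x : Space N) : ℝ≥0∞ :=
  ∫⁻ θ in Ioi (0 : ℝ), ENNReal.ofReal (wrightDensity α θ) * heatFlow (t ^ α * θ) μ x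

/-- `S_α(t) μ = ∫_0^∞ θ h_α(θ) e^{t^α θ Δ} μ dθ`. -/
def solutionOpS {N : ℕ} (α t : ℝ) (μ : Measure (Space N)) (x : Space N) : ℝ≥0∞ :=
  ∫⁻ θ in Ioi (0 : ℝ), ENNReal.ofReal (θ * wrightDensity α θ) * heatFlow (t ^ α * θ) μ x

/-- The right-hand side of the integral equation,
`[P_α(t) μ](x) + α ∫_0^t (t - s)^{α-1} [S_α(t - s) u(s)^p](x) ds`;
the function `u(s)^p` is identified with the measure `u(s)^p dx`. -/
def duhamel {N : ℕ} (α p : ℝ) (μ : Measure (Space N)) (u : ℝ → Space N → ℝ≥0∞)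
    (t : ℝ) (x : Space N) : ℝ≥0∞ :=
  solutionOpP α t μ x +
    ENNReal.ofReal α * ∫⁻ s in Ioo 0 t, ENNReal.ofReal ((t - s) ^ (α - 1)) *
      solutionOpS α (t - s) (volume.withDensity fun y => u s y ^ p) x

/-- `u` is a (nonnegative, Lebesgue measurable) solution in `[0, T] × ℝ^N` of
`∂_t^α u - Δ u = u^p`, `u(0) = μ`: the integral equation holds, with finite values, at almost every
point of `(0, T] × ℝ^N`. Only the values of `u` on `(0, T] × ℝ^N` matter. -/
structure IsSolution {N : ℕ} (α p : ℝ) (μ : Measure (Space N)) (T : ℝ)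
    (u : ℝ → Space N → ℝ≥0∞) : Prop where
  aemeasurable : AEMeasurable (fun z : ℝ × Space N => u z.1 z.2)
    (volume.restrict (Ioc 0 T ×ˢ univ))
  eq_duhamel : ∀ᵐ z : ℝ × Space N ∂(volume.restrict (Ioc 0 T ×ˢ univ)),
    u z.1 z.2 < ∞ ∧ u z.1 z.2 = duhamel α p μ u z.1 z.2

/-- The problem possesses a local-in-time solution. -/
def LocallySolvable {N : ℕ} (α p : ℝ) (μ : Measure (Space N)) : Prop :=
  ∃ T : ℝ, 0 < T ∧ ∃ u : ℝ → Space N → ℝ≥0∞, IsSolution α p μ T u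

/-- The minimal solution in `[0, T] × ℝ^N`: a solution that lies below every solution there. -/
def IsMinimalSolution {N : ℕ} (α p : ℝ) (μ : Measure (Space N)) (T : ℝ)
    (u : ℝ → Space N → ℝ≥0∞) : Prop :=
  IsSolution α p μ T u ∧ ∀ v : ℝ → Space N → ℝ≥0∞, IsSolution α p μ T v →
    ∀ᵐ z : ℝ × Space N ∂(volume.restrict (Ioc 0 T ×ˢ univ)), u z.1 z.2 ≤ v z.1 z.2

/-- The life span `T_α[μ] ∈ [0, ∞]`: the supremum of the `T > 0` such that the minimal solution exists
in `[0, T] × ℝ^N`. -/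
def lifespan {N : ℕ} (α p : ℝ) (μ : Measure (Space N)) : ℝ≥0∞ :=
  ⨆ (T : ℝ) (_ : 0 < T ∧ ∃ u : ℝ → Space N → ℝ≥0∞, IsMinimalSolution α p μ T u), ENNReal.ofReal T

/-- The measure `κ δ_N`. -/
def diracMass (N : ℕ) (κ : ℝ) : Measure (Space N) :=
  ENNReal.ofReal κ • Measure.dirac 0

/-- `A ≃ B` for `[0, ∞]`-valued `A` and real `B`, both depending on `α ∈ (0, 1)` and `κ > 0`:
there are `0 < c(α) < C(α)` with `c(α) B ≤ A ≤ C(α) B` for all `κ > 0`, and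
`limsup_{α → 1-0} c(α)` and `limsup_{α → 1-0} C(α)` lie in `(0, ∞)`. -/
def Equivalent (A : ℝ → ℝ → ℝ≥0∞) (B : ℝ → ℝ → ℝ) : Prop :=
  ∃ c C : ℝ → ℝ,
    (∀ α ∈ Ioo (0 : ℝ) 1, 0 < c α ∧ c α < C α ∧ ∀ κ : ℝ, 0 < κ →
      ENNReal.ofReal (c α * B α κ) ≤ A α κ ∧ A α κ ≤ ENNReal.ofReal (C α * B α κ)) ∧
    limsup (fun α => ENNReal.ofReal (c α)) (𝓝[<] 1) ∈ Ioo 0 ∞ ∧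
    limsup (fun α => ENNReal.ofReal (C α)) (𝓝[<] 1) ∈ Ioo 0 ∞

end TimeFractionalFujita

end

/-! Write γ for `decayExponent N p` = N(p - 1)/(2p). Then p < p_F, p = p_F, p > p_F mean γp < 1, γp
= 1, γp > 1, and everything is governed by the scale-invariant quantity κ^(p-1) T^(α(1-γp)). If γp ≤
1 and this quantity is at most `smallMassConst`, a minimal solution on [0, T] exists
(`isMinimalSolution_of_small`). For every p > 1, a solution on [0, T] forces it below `massConst N p
/ α` (`IsSolution.mass_rpow_lt`). In the subcritical case the exponent of T is positive, and solving
for T gives the life span. In the critical case T drops out, and the threshold is the supremum of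
the solvable masses. In the supercritical case the exponent is negative, and T → 0 violates the
necessary condition.

Sufficiency: the Picard iterates from 0 increase, and their limit is minimal as soon as it is finite
almost everywhere. The operators `P_α(t)` and `S_α(t)` map measures to L^p with norm of order
t^(-αγ), so the bound ‖u(s)‖_p ≤ M s^(-αγ) is reproduced up to the factor ∫ (t-s)^(α(1-γ)-1)
s^(-αγp) ds. This integral is finite even for γp = 1, because α < 1; this is why small Dirac masses
are admissible at p = p_F.

Necessity: test the equation against a Gaussian of width comparable with T^α. Jensen's inequality
turns it into (A + b ∫_0^t I)^p ≤ I(t) for the weighted mass I of u^p, and such an I is infinite on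
(T/2, T] if A is too large for T. An infinite weighted mass makes the solution infinite everywhere
at later times.

Both halves need facts on `h_α`. Positivity comes from a discrete approximation: 1 - (1-z)^α has
nonnegative coefficients, hence so do its powers, and their coefficients, rescaled, converge to αθ
h_α(θ). Moments come from the Mellin transform (`mellin_wrightSeries`), computed through an integral
along a rotated ray. Three moments show that a fixed interval carries mass bounded below uniformly
in α; this uniformity and the continuity of the other constants at α = 1 give the finite limsups. -/

/-! ### Power series of `(1 - z) ^ r` -/

namespace TimeFractionalFujita

/-- The coefficient of `z ^ j` in `(1 - z) ^ r`. -/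
noncomputable def oneSubPowCoeff (r : ℝ) (j : ℕ) : ℝ := (∏ i ∈ Finset.range j, ((i : ℝ) - r)) / j.factorial

/-- The power series of `(1 - z) ^ r`. -/
noncomputable def oneSubPow (r : ℝ) : PowerSeries ℝ := PowerSeries.mk (oneSubPowCoeff r)

lemma oneSubPowCoeff_eq_choose (r : ℝ) (j : ℕ) :
    oneSubPowCoeff r j = (-1) ^ j * Ring.choose r j := by
  rw [Ring.choose_eq_smul, ← Polynomial.eval₂_smulOneHom_eq_smeval, ← Polynomial.eval_map,
    descPochhammer_map, descPochhammer_eval_eq_prod_range, oneSubPowCoeff, smul_eq_mul]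
  have : ∏ i ∈ Finset.range j, ((i : ℝ) - r) = (-1) ^ j * ∏ i ∈ Finset.range j, (r - i) := by
    have h : (-1 : ℝ) ^ j = ∏ _i ∈ Finset.range j, (-1 : ℝ) := by simp
    rw [h, ← Finset.prod_mul_distrib]
    exact Finset.prod_congr rfl fun i _ => by ring
  rw [this]
  ring

/-- Substituting -z for z gives the binomial series, whose exponents add. -/
lemma oneSubPow_add (r s : ℝ) : oneSubPow (r + s) = oneSubPow r * oneSubPow s := by
  have key : ∀ r, oneSubPow r = PowerSeries.rescale (-1) (PowerSeries.binomialSeries ℝ r) := by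
    intro r
    ext j
    simp [oneSubPow, PowerSeries.coeff_rescale, PowerSeries.binomialSeries_coeff,
      oneSubPowCoeff_eq_choose]
  rw [key, key, key, PowerSeries.binomialSeries_add, map_mul]

lemma oneSubPow_nat_mul (r : ℝ) (k : ℕ) : oneSubPow (r * k) = oneSubPow r ^ k := by
  induction k with
  | zero =>
    ext j
    cases j with
    | zero => simp [oneSubPow, oneSubPowCoeff]
    | succ j => simp [oneSubPow, oneSubPowCoeff, Finset.prod_range_succ', PowerSeries.coeff_one]
  | succ k ih => rw [pow_succ, ← ih, ← oneSubPow_add]; push_cast; ring_nf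

lemma oneSubPowCoeff_nonpos {α : ℝ} (h0 : 0 < α) (h1 : α < 1) (j : ℕ) :
    oneSubPowCoeff α (j + 1) ≤ 0 := by
  unfold oneSubPowCoeff
  apply div_nonpos_of_nonpos_of_nonneg _ (by positivity)
  rw [Finset.prod_range_succ']
  apply mul_nonpos_of_nonneg_of_nonpos
  · exact Finset.prod_nonneg fun i _ => by push_cast; linarith [(Nat.cast_nonneg i : (0 : ℝ) ≤ i)]
  · simpa using h0.le

lemma coeff_pow_nonneg {f : PowerSeries ℝ} (hf : ∀ j, 0 ≤ PowerSeries.coeff j f) (n : ℕ) :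
    ∀ j, 0 ≤ PowerSeries.coeff j (f ^ n) := by
  induction n with
  | zero =>
    intro j
    rw [pow_zero, PowerSeries.coeff_one]
    split_ifs <;> norm_num
  | succ n ih =>
    intro j
    rw [pow_succ, PowerSeries.coeff_mul]
    exact Finset.sum_nonneg fun x _ => mul_nonneg (ih _) (hf _)

/-- The coefficients of `(1 - (1 - z) ^ α) ^ n` are nonnegative. -/
lemma sum_choose_mul_oneSubPowCoeff_nonneg {α : ℝ} (h0 : 0 < α) (h1 : α < 1) (n j : ℕ) :
    0 ≤ ∑ k ∈ Finset.range (n + 1), (-1) ^ k * (n.choose k : ℝ) * oneSubPowCoeff (α * k) j := by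
  have h : 0 ≤ PowerSeries.coeff j ((1 - oneSubPow α) ^ n) := by
    apply coeff_pow_nonneg
    intro i
    cases i with
    | zero => simp [oneSubPow, oneSubPowCoeff]
    | succ i =>
      rw [map_sub, PowerSeries.coeff_one]
      simpa [oneSubPow] using oneSubPowCoeff_nonpos h0 h1 i
  have e : (1 - oneSubPow α) ^ n =
      ∑ k ∈ Finset.range (n + 1), PowerSeries.C ((-1) ^ k * (n.choose k : ℝ)) * oneSubPow (α * k) := by
    rw [sub_eq_neg_add, add_pow]
    refine Finset.sum_congr rfl fun k _ => ?_
    rw [oneSubPow_nat_mul, neg_pow, map_mul, map_pow, map_neg, map_one, map_natCast]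
    ring
  rw [e, map_sum] at h
  simpa only [oneSubPow, PowerSeries.coeff_C_mul, PowerSeries.coeff_mk] using h

/-- Log-convexity of Γ at s + α = (1 - α)s + α(s + 1), together with Γ(s + 1) = sΓ(s). -/
lemma Gamma_add_le {s α : ℝ} (hs : 0 < s) (h0 : 0 < α) (h1 : α < 1) :
    Real.Gamma (s + α) ≤ Real.Gamma s * s ^ α := by
  have h := Real.Gamma_mul_add_mul_le_rpow_Gamma_mul_rpow_Gamma hs (by linarith : 0 < s + 1)
    (by linarith : 0 < 1 - α) h0 (by ring)
  have e : (1 - α) * s + α * (s + 1) = s + α := by ring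
  have hG := Real.Gamma_pos_of_pos hs
  rw [e, Real.Gamma_add_one hs.ne', Real.mul_rpow hs.le hG.le, mul_comm (s ^ α), ← mul_assoc,
    ← Real.rpow_add hG] at h
  simpa using h

/-- By `Gamma_add_le` the ratio of consecutive terms is O(k^(α-1)), which tends to 0 since α < 1. -/
lemma summable_pow_mul_Gamma {α a : ℝ} (h0 : 0 < α) (h1 : α < 1) (ha : 0 < a) {x : ℝ}
    (hx : 0 ≤ x) : Summable fun k : ℕ => x ^ k / k.factorial * Real.Gamma (a + α * k) := by
  apply summable_of_ratio_norm_eventually_le (r := 1 / 2) (by norm_num)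
  have lim : Tendsto (fun k : ℕ => x * (a + 1) ^ α * ((k : ℝ) + 1) ^ (-(1 - α))) atTop (𝓝 0) := by
    have := (tendsto_rpow_neg_atTop (by linarith : 0 < 1 - α)).comp
      (tendsto_atTop_add_const_right atTop (1 : ℝ) tendsto_natCast_atTop_atTop)
    simpa using this.const_mul (x * (a + 1) ^ α)
  filter_upwards [lim.eventually (gt_mem_nhds (by norm_num : (0 : ℝ) < 1 / 2))] with k hk
  have hs : 0 < a + α * k := by positivity
  have hG := Real.Gamma_pos_of_pos hs
  have hG' := Real.Gamma_pos_of_pos (by positivity : 0 < a + α * ((k + 1 : ℕ) : ℝ))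
  rw [Real.norm_of_nonneg (by positivity), Real.norm_of_nonneg (by positivity)]
  have h2 : Real.Gamma (a + α * ((k + 1 : ℕ) : ℝ)) ≤
      Real.Gamma (a + α * k) * ((a + 1) * (k + 1)) ^ α := by
    have e : a + α * ((k + 1 : ℕ) : ℝ) = a + α * k + α := by push_cast; ring
    rw [e]
    refine (Gamma_add_le hs h0 h1).trans ?_
    gcongr
    nlinarith [(Nat.cast_nonneg k : (0 : ℝ) ≤ k)]
  have hk1 : (0 : ℝ) < k + 1 := by positivity
  have e2 : (k + 1 : ℝ) ^ (-(1 - α)) = (k + 1 : ℝ) ^ α / (k + 1) := by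
    rw [neg_sub, Real.rpow_sub_one hk1.ne']
  rw [e2] at hk
  calc x ^ (k + 1) / (k + 1).factorial * Real.Gamma (a + α * ((k + 1 : ℕ) : ℝ))
      ≤ x ^ (k + 1) / (k + 1).factorial * (Real.Gamma (a + α * k) * ((a + 1) * (k + 1)) ^ α) := by
        gcongr
    _ = x * (a + 1) ^ α * ((k + 1 : ℝ) ^ α / (k + 1)) *
        (x ^ k / k.factorial * Real.Gamma (a + α * k)) := by
        rw [Real.mul_rpow (by positivity) (by positivity), Nat.factorial_succ]
        push_cast
        field_simp
        ring
    _ ≤ _ := by gcongr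

end TimeFractionalFujita

/-! ### Bounds for finite products -/

namespace TimeFractionalFujita

/-- Induction on M; Bernoulli's inequality (1 + 1/(M+1))^f ≤ 1 + f/(M+1) controls each new factor.
-/
lemma prod_one_sub_div_le {f : ℝ} (h0 : 0 ≤ f) (h1 : f ≤ 1) (M : ℕ) :
    ∏ i ∈ Finset.range M, (((i + 1 : ℕ) : ℝ) - f) ≤ M.factorial * ((M : ℝ) + 1) ^ (-f) := by
  induction M with
  | zero => simp
  | succ M ih =>
    rw [Finset.prod_range_succ, Nat.factorial_succ]
    have hM : (0 : ℝ) < M + 1 := by positivity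
    have hM2 : (0 : ℝ) < M + 2 := by positivity
    have key : ((M + 1 : ℕ) : ℝ) - f ≤ (M + 1) * ((M + 2 : ℝ) / (M + 1)) ^ (-f) := by
      have hb : ((M + 2 : ℝ) / (M + 1)) ^ f ≤ 1 + f / (M + 1) := by
        have := rpow_one_add_le_one_add_mul_self (s := 1 / ((M : ℝ) + 1))
          (by linarith [(by positivity : (0 : ℝ) ≤ 1 / (M + 1))]) h0 h1
        convert! this using 2 <;> field_simp
        ring
      rw [Real.rpow_neg (by positivity), ← div_eq_mul_inv, le_div_iff₀ (by positivity)]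
      have h3 : (0 : ℝ) ≤ ((M + 1 : ℕ) : ℝ) - f := by push_cast; linarith [(Nat.cast_nonneg M : (0 : ℝ) ≤ M)]
      calc _ ≤ (((M + 1 : ℕ) : ℝ) - f) * (1 + f / (M + 1)) := by gcongr
        _ = (M + 1) - f ^ 2 / (M + 1) := by push_cast; field_simp; ring
        _ ≤ _ := by linarith [(by positivity : 0 ≤ f ^ 2 / ((M : ℝ) + 1))]
    calc _ ≤ (M.factorial * ((M : ℝ) + 1) ^ (-f)) * ((M + 1) * ((M + 2 : ℝ) / (M + 1)) ^ (-f)) := by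
          refine mul_le_mul ih key ?_ (by positivity)
          push_cast; linarith [(Nat.cast_nonneg M : (0 : ℝ) ≤ M)]
      _ = _ := by
          rw [Real.div_rpow hM2.le hM.le]
          have : ((M : ℝ) + 1) ^ (-f) ≠ 0 := (Real.rpow_pos_of_pos hM _).ne'
          push_cast
          field_simp
          norm_num [add_assoc]

lemma pow_mul_factorial_le (K M : ℕ) (h : K ≤ M) :
    ((K + M : ℕ) : ℝ) ^ K * M.factorial ≤ 2 ^ K * (K + M).factorial := by
  have h1 := Nat.factorial_mul_pow_le_factorial (m := M) (n := K)
  rw [add_comm M K] at h1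
  have h2 : (K + M) ^ K ≤ 2 ^ K * (M + 1) ^ K := by
    rw [← mul_pow]
    exact Nat.pow_le_pow_left (by omega) _
  have : (K + M) ^ K * M.factorial ≤ 2 ^ K * (K + M).factorial := by
    calc _ ≤ 2 ^ K * (M + 1) ^ K * M.factorial := by gcongr
      _ = 2 ^ K * (M.factorial * (M + 1) ^ K) := by ring
      _ ≤ _ := by gcongr
  exact_mod_cast this

/-- A bound uniform in m for the sequence in Euler's limit formula for 1/Γ(-r), needed to dominate
the series. Split r into its floor K and fractional part f: the first K + 1 factors contribute at
most (K+1)!, the others are covered by `prod_one_sub_div_le`, and 2r ≤ m lets m^K be compared with a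
ratio of factorials. -/
lemma abs_prod_sub_mul_rpow_le {r : ℝ} (hr : 0 ≤ r) {m : ℕ} (hm : 2 * r ≤ m) :
    |∏ i ∈ Finset.range (m + 1), ((i : ℝ) - r)| * (m : ℝ) ^ r / m.factorial ≤
      (⌊r⌋₊ + 1).factorial * 2 ^ (⌊r⌋₊ + 1) := by
  set K := ⌊r⌋₊ with hK
  have hKr : (K : ℝ) ≤ r := Nat.floor_le hr
  have hrK : r < K + 1 := Nat.lt_floor_add_one r
  have h2K : 2 * K ≤ m := by
    have : (2 * K : ℝ) ≤ m := by linarith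
    exact_mod_cast this
  obtain ⟨M, rfl⟩ : ∃ M, m = K + M := ⟨m - K, by omega⟩
  have hKM : K ≤ M := by omega
  set f := r - K with hf
  have hf0 : 0 ≤ f := by linarith
  have hf1 : f ≤ 1 := by linarith
  rw [Finset.abs_prod, show K + M + 1 = (K + 1) + M by ring, Finset.prod_range_add]
  have hA : ∏ i ∈ Finset.range (K + 1), |(i : ℝ) - r| ≤ (K + 1).factorial := by
    have e : (((K + 1).factorial : ℕ) : ℝ) = ∏ i ∈ Finset.range (K + 1), ((K + 1 : ℝ) - i) := by
      rw [← Finset.prod_range_reflect, ← Finset.prod_range_add_one_eq_factorial, Nat.cast_prod]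
      refine Finset.prod_congr rfl fun i hi => ?_
      have : i ≤ K := by simpa [Nat.lt_succ_iff] using hi
      push_cast [show K + 1 - 1 - i = K - i by omega, Nat.cast_sub this]
      ring
    rw [e]
    refine Finset.prod_le_prod (fun i _ => abs_nonneg _) fun i hi => ?_
    have : (i : ℝ) ≤ K := by exact_mod_cast (by simpa [Nat.lt_succ_iff] using hi : i ≤ K)
    rw [abs_of_nonpos (by linarith)]
    linarith
  have hB : ∏ i ∈ Finset.range M, |((K + 1 + i : ℕ) : ℝ) - r| ≤
      M.factorial * ((M : ℝ) + 1) ^ (-f) := by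
    refine le_trans (le_of_eq ?_) (prod_one_sub_div_le hf0 hf1 M)
    refine Finset.prod_congr rfl fun i _ => ?_
    have hi : (0 : ℝ) ≤ i := Nat.cast_nonneg i
    rw [abs_of_nonneg (by push_cast; linarith)]
    push_cast
    rw [hf]; ring
  have hC : ((K + M : ℕ) : ℝ) ^ r ≤ ((K + M : ℕ) : ℝ) ^ K * (2 * ((M : ℝ) + 1) ^ f) := by
    rcases Nat.eq_zero_or_pos (K + M) with h0 | h0
    · have hK0 : K = 0 := by omega
      have hM0 : M = 0 := by omega
      simp only [hK0, hM0, add_zero, Nat.cast_zero, pow_zero, one_mul, zero_add, Real.one_rpow,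
        mul_one]
      exact (Real.zero_rpow_le_one r).trans (by norm_num)
    · have hpos : (0 : ℝ) < ((K + M : ℕ) : ℝ) := by exact_mod_cast h0
      rw [show r = (K : ℝ) + f by rw [hf]; ring, Real.rpow_add hpos, Real.rpow_natCast]
      gcongr
      have hc : ((K + M : ℕ) : ℝ) ≤ 2 * (M + 1) := by
        have : (K : ℝ) ≤ M := by exact_mod_cast hKM
        push_cast; linarith
      calc ((K + M : ℕ) : ℝ) ^ f ≤ (2 * (M + 1)) ^ f := by gcongr
        _ = 2 ^ f * (M + 1 : ℝ) ^ f := Real.mul_rpow (by norm_num) (by positivity)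
        _ ≤ 2 ^ (1 : ℝ) * (M + 1 : ℝ) ^ f := by gcongr; norm_num
        _ = _ := by rw [Real.rpow_one]
  have hD := pow_mul_factorial_le K M hKM
  have hM1 : (0 : ℝ) < M + 1 := by positivity
  rw [div_le_iff₀ (by positivity)]
  calc _ ≤ ((K + 1).factorial * (M.factorial * ((M : ℝ) + 1) ^ (-f))) *
        (((K + M : ℕ) : ℝ) ^ K * (2 * ((M : ℝ) + 1) ^ f)) := by
        gcongr
    _ = (K + 1).factorial * 2 * (((K + M : ℕ) : ℝ) ^ K * M.factorial) := by
        rw [Real.rpow_neg hM1.le]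
        have := (Real.rpow_pos_of_pos hM1 f).ne'
        field_simp
    _ ≤ (K + 1).factorial * 2 * (2 ^ K * (K + M).factorial) := by gcongr
    _ = _ := by ring

end TimeFractionalFujita

/-! ### Positivity of the Wright function -/

namespace TimeFractionalFujita

/-- Euler's product for Γ, inverted. For natural r the product eventually contains a zero factor,
and the limit agrees because `Real.Gamma` is 0 at the poles. -/
lemma tendsto_prod_sub_mul_rpow (r : ℝ) :
    Tendsto (fun m : ℕ => (∏ i ∈ Finset.range (m + 1), ((i : ℝ) - r)) * (m : ℝ) ^ r / m.factorial)
      atTop (𝓝 (Real.Gamma (-r))⁻¹) := by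
  by_cases hr : ∃ k : ℕ, r = k
  · obtain ⟨k, rfl⟩ := hr
    rw [Real.Gamma_neg_nat_eq_zero, inv_zero]
    refine tendsto_const_nhds.congr' ?_
    filter_upwards [eventually_ge_atTop k] with m hm
    rw [Finset.prod_eq_zero (i := k) (by simp; omega) (by simp)]
    simp
  · push Not at hr
    have h0 : Real.Gamma (-r) ≠ 0 := by
      apply Real.Gamma_ne_zero
      intro m h
      exact hr m (by linarith)
    refine ((Real.GammaSeq_tendsto_Gamma (-r)).inv₀ h0).congr' ?_
    filter_upwards [eventually_gt_atTop 0] with m hm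
    have hm' : (0 : ℝ) < m := by exact_mod_cast hm
    rw [Real.GammaSeq, Real.rpow_neg hm'.le, inv_div]
    have e : ∏ j ∈ Finset.range (m + 1), (-r + (j : ℝ)) = ∏ j ∈ Finset.range (m + 1), ((j : ℝ) - r) :=
      Finset.prod_congr rfl fun _ _ => by ring
    rw [e]
    have := (Real.rpow_pos_of_pos hm' r).ne'
    field_simp

lemma tendsto_floor_mul_div {θ : ℝ} (hθ : 0 < θ) {α : ℝ} (h0 : 0 < α) :
    Tendsto (fun m : ℕ => (⌊θ * (m : ℝ) ^ α⌋₊ : ℝ) / (m : ℝ) ^ α) atTop (𝓝 θ) := by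
  have h := (tendsto_nat_floor_mul_div_atTop hθ.le).comp
    ((tendsto_rpow_atTop h0).comp tendsto_natCast_atTop_atTop)
  exact h

lemma tendsto_choose_div_rpow {θ : ℝ} (hθ : 0 < θ) {α : ℝ} (h0 : 0 < α) (k : ℕ) :
    Tendsto (fun m : ℕ => ((⌊θ * (m : ℝ) ^ α⌋₊).choose k : ℝ) / (m : ℝ) ^ (α * k)) atTop
      (𝓝 (θ ^ k / k.factorial)) := by
  have hn : Tendsto (fun m : ℕ => ⌊θ * (m : ℝ) ^ α⌋₊) atTop atTop :=
    tendsto_nat_floor_atTop.comp (((tendsto_rpow_atTop h0).comp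
      tendsto_natCast_atTop_atTop).const_mul_atTop hθ)
  have hc : ∀ n : ℕ, (n.choose k : ℝ) = (∏ i ∈ Finset.range k, ((n : ℝ) - i)) / k.factorial := by
    intro n
    rw [← descPochhammer_eval_eq_prod_range, Nat.cast_choose_eq_descPochhammer_div]
  have key : Tendsto (fun m : ℕ => ∏ i ∈ Finset.range k,
      (((⌊θ * (m : ℝ) ^ α⌋₊ : ℝ) - i) / (m : ℝ) ^ α)) atTop (𝓝 (∏ i ∈ Finset.range k, θ)) := by
    refine tendsto_finsetProd _ fun i _ => ?_
    have h2 : Tendsto (fun m : ℕ => (i : ℝ) / (m : ℝ) ^ α) atTop (𝓝 0) :=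
      ((tendsto_rpow_atTop h0).comp tendsto_natCast_atTop_atTop).const_div_atTop _
    simpa [sub_div] using (tendsto_floor_mul_div hθ h0).sub h2
  rw [Finset.prod_const, Finset.card_range] at key
  refine (key.div_const (k.factorial : ℝ)).congr fun m => ?_
  rw [hc, Finset.prod_div_distrib, Finset.prod_const, Finset.card_range,
    Real.rpow_mul_natCast (Nat.cast_nonneg m)]
  ring

lemma summable_majorant {α θ : ℝ} (h0 : 0 < α) (h1 : α < 1) (hθ : 0 ≤ θ) :
    Summable fun k : ℕ =>
      θ ^ k / k.factorial * ((⌊α * k⌋₊ + 1).factorial * (2 : ℝ) ^ (⌊α * k⌋₊ + 1)) := by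
  have h := (summable_pow_mul_Gamma h0 h1 (a := 3) (by norm_num)
    (x := 2 * θ) (by positivity)).mul_left 2
  refine Summable.of_nonneg_of_le (fun k => by positivity) (fun k => ?_) h
  have hk : (⌊α * k⌋₊ : ℝ) ≤ α * k := Nat.floor_le (by positivity)
  have hk' : ⌊α * k⌋₊ ≤ k := by
    have : (⌊α * k⌋₊ : ℝ) ≤ k := hk.trans (by nlinarith [(Nat.cast_nonneg k : (0 : ℝ) ≤ k)])
    exact_mod_cast this
  have hG : ((⌊α * k⌋₊ + 1).factorial : ℝ) ≤ Real.Gamma (3 + α * k) := by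
    rw [← Real.Gamma_nat_eq_factorial]
    apply Real.Gamma_strictMonoOn_Ici.monotoneOn
    · simp only [mem_Ici]; push_cast; linarith [(Nat.cast_nonneg ⌊α * k⌋₊ : (0 : ℝ) ≤ ⌊α * k⌋₊)]
    · simp only [mem_Ici]; linarith [(by positivity : 0 ≤ α * k)]
    · push_cast; linarith
  calc _ ≤ θ ^ k / k.factorial * (Real.Gamma (3 + α * k) * (2 : ℝ) ^ (k + 1)) := by
        gcongr
        norm_num
    _ = _ := by rw [mul_pow]; ring

/-- `∑ (-θ) ^ k / (k! Γ (1 - a - α k))`, the Wright function. -/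
noncomputable def wrightSeries (α a θ : ℝ) : ℝ :=
  ∑' k : ℕ, (-θ) ^ k / ((k.factorial : ℝ) * Real.Gamma (1 - a - α * k))

/-- A local limit argument: with n = ⌊θ m^α⌋, m + 1 times the coefficient of z^(m+1) in (1 -
(1-z)^α)^n is nonnegative, and as m → ∞ it converges to the series term by term. Dominated
convergence passes to the sum. The parameter is a = 1 because Euler's limit produces 1/Γ(-αk). -/
lemma wrightSeries_one_nonneg {α θ : ℝ} (h0 : 0 < α) (h1 : α < 1) (hθ : 0 < θ) :
    0 ≤ wrightSeries α 1 θ := by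
  set n : ℕ → ℕ := fun m => ⌊θ * (m : ℝ) ^ α⌋₊ with hn
  set F : ℕ → ℕ → ℝ := fun m k => (-1) ^ k * ((n m).choose k : ℝ) *
    (∏ i ∈ Finset.range (m + 1), ((i : ℝ) - α * k)) / m.factorial with hF
  have hlim : ∀ k, Tendsto (fun m => F m k) atTop
      (𝓝 ((-θ) ^ k / ((k.factorial : ℝ) * Real.Gamma (1 - 1 - α * k)))) := by
    intro k
    have h := ((tendsto_choose_div_rpow hθ h0 k).mul
      (tendsto_prod_sub_mul_rpow (α * k))).const_mul ((-1) ^ k)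
    have e : (-1) ^ k * (θ ^ k / k.factorial * (Real.Gamma (-(α * k)))⁻¹) =
        (-θ) ^ k / ((k.factorial : ℝ) * Real.Gamma (1 - 1 - α * k)) := by
      rw [neg_pow θ, sub_self, zero_sub]
      field_simp
    rw [← e]
    refine h.congr' ?_
    filter_upwards [eventually_gt_atTop 0] with m hm
    have hm' : (0 : ℝ) < m := by exact_mod_cast hm
    have := (Real.rpow_pos_of_pos hm' (α * k)).ne'
    simp only [hF, hn]
    field_simp
  have hbound : ∀ᶠ m : ℕ in atTop, ∀ k, ‖F m k‖ ≤
      θ ^ k / k.factorial * ((⌊α * k⌋₊ + 1).factorial * (2 : ℝ) ^ (⌊α * k⌋₊ + 1)) := by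
    have hlim0 : Tendsto (fun m : ℕ => 2 * α * θ * (m : ℝ) ^ (-(1 - α))) atTop (𝓝 0) := by
      have := (tendsto_rpow_neg_atTop (by linarith : 0 < 1 - α)).comp
        (tendsto_natCast_atTop_atTop (R := ℝ))
      simpa using this.const_mul (2 * α * θ)
    filter_upwards [hlim0.eventually (gt_mem_nhds (zero_lt_one' ℝ)), eventually_gt_atTop 0]
      with m hm hm0 k
    have hm' : (0 : ℝ) < m := by exact_mod_cast hm0
    rcases lt_or_ge (n m) k with hk | hk
    · simp only [hF, Nat.choose_eq_zero_of_lt hk]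
      simp only [Nat.cast_zero, mul_zero, zero_mul, zero_div, norm_zero]
      positivity
    · have hnm : ((n m : ℕ) : ℝ) ≤ θ * (m : ℝ) ^ α := Nat.floor_le (by positivity)
      have hkm : (k : ℝ) ≤ θ * (m : ℝ) ^ α := le_trans (by exact_mod_cast hk) hnm
      -- Only k ≤ n ≤ θ m^α matters, and m^α = o(m), so the hypothesis of the uniform product bound
      -- holds for all these k at once.
      have h2 : 2 * (α * k) ≤ m := by
        rw [neg_sub, Real.rpow_sub_one hm'.ne', ← mul_div_assoc, div_lt_one hm'] at hm
        calc 2 * (α * k) ≤ 2 * (α * (θ * (m : ℝ) ^ α)) := by gcongr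
          _ ≤ m := by linarith
      have hb := abs_prod_sub_mul_rpow_le (by positivity : 0 ≤ α * k) h2
      have hch : ((n m).choose k : ℝ) ≤ θ ^ k / k.factorial * (m : ℝ) ^ (α * k) := by
        refine (Nat.choose_le_pow_div k (n m)).trans ?_
        rw [Real.rpow_mul_natCast hm'.le, div_mul_eq_mul_div, ← mul_pow]
        gcongr
      simp only [hF]
      rw [norm_div, norm_mul, norm_mul, norm_pow, norm_neg, norm_one, one_pow, one_mul,
        Real.norm_natCast, Real.norm_natCast, Real.norm_eq_abs]
      calc _ ≤ (θ ^ k / k.factorial * (m : ℝ) ^ (α * k)) *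
            |∏ i ∈ Finset.range (m + 1), ((i : ℝ) - α * k)| / m.factorial := by gcongr
        _ = θ ^ k / k.factorial * (|∏ i ∈ Finset.range (m + 1), ((i : ℝ) - α * k)| *
            (m : ℝ) ^ (α * k) / m.factorial) := by ring
        _ ≤ _ := by gcongr
  have hT := tendsto_tsum_of_dominated_convergence (summable_majorant h0 h1 hθ.le) hlim hbound
  refine ge_of_tendsto' hT fun m => ?_
  have hs : ∑' k, F m k = ∑ k ∈ Finset.range (n m + 1), F m k := by
    apply tsum_eq_sum
    intro k hk
    have : n m < k := by
      have := Finset.mem_range.not.mp hk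
      omega
    simp [hF, Nat.choose_eq_zero_of_lt this]
  rw [hs]
  -- The factor m + 1 turns the denominator (m+1)! of the coefficient into the m! of `F`.
  have h := mul_nonneg (by positivity : (0 : ℝ) ≤ m + 1)
    (sum_choose_mul_oneSubPowCoeff_nonneg h0 h1 (n m) (m + 1))
  rw [Finset.mul_sum] at h
  refine h.trans_eq (Finset.sum_congr rfl fun k _ => ?_)
  rw [oneSubPowCoeff, Nat.factorial_succ]
  simp only [hF]
  push_cast
  field_simp

/-- Euler's reflection formula. Where the sine vanishes, 1 - x is a pole and both sides are 0 by the
convention for `Real.Gamma`. -/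
lemma inv_Gamma_one_sub (x : ℝ) (hx : 0 < x) :
    (Real.Gamma (1 - x))⁻¹ = Real.Gamma x * Real.sin (Real.pi * x) / Real.pi := by
  have h := Real.Gamma_mul_Gamma_one_sub x
  have hG := (Real.Gamma_pos_of_pos hx).ne'
  by_cases hs : Real.sin (Real.pi * x) = 0
  · rw [hs, div_zero, mul_eq_zero, or_iff_right hG] at h
    simp [h, hs]
  · have h1 : Real.Gamma (1 - x) ≠ 0 := by
      intro h0
      rw [h0, mul_zero] at h
      exact (div_ne_zero Real.pi_ne_zero hs) h.symm
    have := Real.pi_ne_zero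
    rw [eq_div_iff hs] at h
    rw [inv_eq_one_div, div_eq_div_iff h1 this]
    linarith

lemma wrightSeries_eq_tsum_sin {α a : ℝ} (h0 : 0 < α) (ha : 0 < a) (θ : ℝ) :
    wrightSeries α a θ = ∑' k : ℕ, (-θ) ^ k / k.factorial *
      (Real.Gamma (a + α * k) * Real.sin (Real.pi * (a + α * k)) / Real.pi) := by
  refine tsum_congr fun k => ?_
  rw [← inv_Gamma_one_sub _ (by positivity), sub_sub]
  field_simp

lemma summable_wrightSeries {α a : ℝ} (h0 : 0 < α) (h1 : α < 1) (ha : 0 < a) (θ : ℝ) :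
    Summable fun k : ℕ => (-θ) ^ k / ((k.factorial : ℝ) * Real.Gamma (1 - a - α * k)) := by
  refine Summable.of_norm_bounded (summable_pow_mul_Gamma h0 h1 ha (abs_nonneg θ)) fun k => ?_
  have hG := Real.Gamma_pos_of_pos (by positivity : 0 < a + α * (k : ℝ))
  rw [div_mul_eq_div_div, div_eq_mul_inv _ (Real.Gamma _), sub_sub,
    inv_Gamma_one_sub _ (by positivity), norm_mul, norm_div, norm_pow, norm_neg, Real.norm_natCast,
    Real.norm_eq_abs, norm_div, norm_mul, Real.norm_of_nonneg hG.le,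
    Real.norm_of_nonneg Real.pi_pos.le]
  gcongr
  rw [div_le_iff₀ Real.pi_pos]
  gcongr
  exact (Real.abs_sin_le_one _).trans (by linarith [Real.pi_gt_three])

lemma wrightDensity_eq (α θ : ℝ) : wrightDensity α θ = wrightSeries α α θ := rfl

lemma wrightSeries_one_eq {α : ℝ} (h0 : 0 < α) (h1 : α < 1) (θ : ℝ) :
    wrightSeries α 1 θ = α * θ * wrightDensity α θ := by
  rw [wrightSeries, (summable_wrightSeries h0 h1 one_pos θ).tsum_eq_zero_add, wrightDensity,
    ← tsum_mul_left]
  -- The term k = 0 vanishes since `Real.Gamma 0 = 0`; the index shift then leaves a multiple of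
  -- `h_α`.
  simp only [sub_self, Nat.cast_zero, mul_zero, Real.Gamma_zero, div_zero, zero_add]
  refine tsum_congr fun k => ?_
  have hk : α * ((k + 1 : ℕ) : ℝ) ≠ 0 := by positivity
  have e : Real.Gamma (1 - α - α * k) =
      -(α * ((k + 1 : ℕ) : ℝ)) * Real.Gamma (0 - α * ((k + 1 : ℕ) : ℝ)) := by
    rw [show 1 - α - α * k = 0 - α * ((k + 1 : ℕ) : ℝ) + 1 by push_cast; ring,
      Real.Gamma_add_one (by simpa using hk)]
    ring
  rw [e, Nat.factorial_succ]
  rcases eq_or_ne (Real.Gamma (0 - α * ((k + 1 : ℕ) : ℝ))) 0 with hz | hz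
  · rw [hz]
    simp
  · push_cast at hk hz ⊢
    field_simp
    ring

lemma wrightDensity_nonneg {α θ : ℝ} (h0 : 0 < α) (h1 : α < 1) (hθ : 0 < θ) :
    0 ≤ wrightDensity α θ := by
  have h := wrightSeries_one_nonneg h0 h1 hθ
  rw [wrightSeries_one_eq h0 h1] at h
  exact nonneg_of_mul_nonneg_right h (by positivity)

lemma measurable_wrightDensity {α : ℝ} (h0 : 0 < α) (h1 : α < 1) :
    Measurable (wrightDensity α) := by
  refine measurable_of_tendsto_metrizable (f := fun (n : ℕ) θ => ∑ k ∈ Finset.range n,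
    (-θ) ^ k / ((k.factorial : ℝ) * Real.Gamma (1 - α - α * k))) (fun n => by fun_prop) ?_
  rw [tendsto_pi_nhds]
  exact fun θ => (summable_wrightSeries h0 h1 h0 θ).hasSum.tendsto_sum_nat

end TimeFractionalFujita

/-! ### Complex Gamma integrals -/

namespace TimeFractionalFujita

lemma integrableOn_rpow_mul_exp_neg_mul {a b : ℝ} (ha : 0 < a) (hb : 0 < b) :
    IntegrableOn (fun r : ℝ => r ^ (a - 1) * Real.exp (-(b * r))) (Ioi 0) := by
  have h := integrableOn_rpow_mul_exp_neg_mul_rpow (s := a - 1) (p := 1) (b := b) (by linarith)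
    one_pos hb
  simpa using h

/-- Both sides are analytic in the half-plane Re c > 0 and agree for real c, so the identity theorem
applies. Analyticity of the left side is that of the complex moment generating function of r^(a-1)
dr. -/
lemma integral_rpow_mul_cexp_neg_mul {a : ℝ} (ha : 0 < a) {c : ℂ} (hc : 0 < c.re) :
    ∫ r in Ioi (0 : ℝ), ((r ^ (a - 1) : ℝ) : ℂ) * Complex.exp (-(c * r)) =
      c ^ (-(a : ℂ)) * Real.Gamma a := by
  set μ : Measure ℝ := (volume.restrict (Ioi 0)).withDensity fun r => ENNReal.ofReal (r ^ (a - 1))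
    with hμ
  have hmeas : Measurable fun r : ℝ => ENNReal.ofReal (r ^ (a - 1)) := by fun_prop
  have hset : Iio 0 ⊆ ProbabilityTheory.integrableExpSet id μ := by
    intro t ht
    rw [ProbabilityTheory.integrableExpSet, mem_ofPred_eq, hμ,
      integrable_withDensity_iff_integrable_smul' hmeas (by simp)]
    refine (integrableOn_rpow_mul_exp_neg_mul ha (neg_pos.2 ht)).congr_fun (fun r hr => ?_)
      measurableSet_Ioi
    simp [ENNReal.toReal_ofReal (Real.rpow_nonneg (le_of_lt hr) _)]
  have hmgf : ∀ z : ℂ, ProbabilityTheory.complexMGF id μ z =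
      ∫ r in Ioi (0 : ℝ), ((r ^ (a - 1) : ℝ) : ℂ) * Complex.exp (z * r) := by
    intro z
    rw [ProbabilityTheory.complexMGF, hμ,
      integral_withDensity_eq_integral_toReal_smul hmeas (by simp)]
    refine setIntegral_congr_fun measurableSet_Ioi fun r hr => ?_
    simp [ENNReal.toReal_ofReal (Real.rpow_nonneg (le_of_lt hr) _)]
  have hU : {z : ℂ | z.re < 0} ⊆ {z | z.re ∈ interior (ProbabilityTheory.integrableExpSet id μ)} :=
    fun z hz => interior_mono hset (by rwa [interior_Iio])
  have hA : AnalyticOnNhd ℂ (ProbabilityTheory.complexMGF id μ) {z : ℂ | z.re < 0} :=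
    ProbabilityTheory.analyticOnNhd_complexMGF.mono hU
  have hB : AnalyticOnNhd ℂ (fun z : ℂ => (-z) ^ (-(a : ℂ)) * (Real.Gamma a : ℂ))
      {z : ℂ | z.re < 0} := by
    refine DifferentiableOn.analyticOnNhd (fun z hz => ?_)
      (isOpen_lt Complex.continuous_re continuous_const)
    refine DifferentiableAt.differentiableWithinAt ?_
    refine DifferentiableAt.mul_const ?_ _
    refine DifferentiableAt.cpow differentiableAt_id.neg (by fun_prop) ?_
    exact Or.inl (by simpa using hz)
  have hconn : IsPreconnected {z : ℂ | z.re < 0} :=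
    (convex_halfSpace_re_lt 0).isPreconnected
  -- Real points accumulating at -1, where the identity is the real Gamma integral.
  have hseq : Tendsto (fun n : ℕ => (((-1 - 1 / ((n : ℝ) + 1)) : ℝ) : ℂ)) atTop (𝓝[≠] (-1)) := by
    rw [tendsto_nhdsWithin_iff]
    constructor
    · have h1 : Tendsto (fun n : ℕ => -1 - 1 / ((n : ℝ) + 1)) atTop (𝓝 (-1)) := by
        simpa using tendsto_one_div_add_atTop_nhds_zero_nat.const_sub (-1 : ℝ)
      have h2 := (Complex.continuous_ofReal.tendsto _).comp h1
      rw [Complex.ofReal_neg, Complex.ofReal_one] at h2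
      exact h2
    · refine Eventually.of_forall fun n => ?_
      have : (0 : ℝ) < 1 / ((n : ℝ) + 1) := by positivity
      rw [mem_compl_singleton_iff]
      intro h
      have h2 := congrArg Complex.re h
      rw [Complex.ofReal_re] at h2
      norm_num at h2
      linarith
  have hfreq : ∃ᶠ z in 𝓝[≠] (-1 : ℂ), ProbabilityTheory.complexMGF id μ z =
      (-z) ^ (-(a : ℂ)) * (Real.Gamma a : ℂ) := by
    refine hseq.frequently (Frequently.of_forall fun n => ?_)
    set t : ℝ := 1 + 1 / ((n : ℝ) + 1) with ht
    have ht0 : 0 < t := by positivity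
    rw [hmgf, show (-1 - 1 / ((n : ℝ) + 1)) = -t by rw [ht]; ring]
    have h := Complex.integral_cpow_mul_exp_neg_mul_Ioi (a := a) (by simpa using ha) ht0
    rw [Complex.ofReal_neg, neg_neg, Complex.cpow_neg, ← Complex.Gamma_ofReal]
    rw [one_div, Complex.inv_cpow _ _ (by
      rw [Complex.arg_ofReal_of_nonneg ht0.le]; exact Real.pi_pos.ne)] at h
    rw [← h]
    refine setIntegral_congr_fun measurableSet_Ioi fun r hr => ?_
    have hr' : (0 : ℝ) ≤ r := le_of_lt hr
    simp only [Complex.ofReal_cpow hr']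
    push_cast
    ring_nf
  have key := hA.eqOn_of_preconnected_of_frequently_eq hB hconn
    (show (-1 : ℂ) ∈ {z : ℂ | z.re < 0} by simp) hfreq
  have h := key (show -c ∈ {z : ℂ | z.re < 0} by simpa using hc)
  rw [hmgf] at h
  simpa using h

lemma integral_rpow_mul_cexp_polar {a ρ φ : ℝ} (ha : 0 < a) (hρ : 0 < ρ)
    (hφ : |φ| < Real.pi / 2) :
    ∫ r in Ioi (0 : ℝ), ((r ^ (a - 1) : ℝ) : ℂ) *
        Complex.exp (-(ρ * Complex.exp (φ * Complex.I) * r)) =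
      (ρ ^ (-a) : ℝ) * Real.Gamma a * Complex.exp (-(a * φ) * Complex.I) := by
  obtain ⟨h1, h2⟩ := abs_lt.1 hφ
  have hcos : 0 < Real.cos φ := Real.cos_pos_of_mem_Ioo ⟨by linarith, h2⟩
  rw [integral_rpow_mul_cexp_neg_mul ha]
  · rw [Complex.cpow_def_of_ne_zero (mul_ne_zero (by exact_mod_cast hρ.ne') (Complex.exp_ne_zero _)),
      Complex.log_ofReal_mul hρ (Complex.exp_ne_zero _), Complex.log_exp (by simp; linarith)
      (by simp; linarith), Real.rpow_def_of_pos hρ, add_mul, Complex.exp_add]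
    push_cast
    ring_nf
  · rw [Complex.re_ofReal_mul, Complex.exp_ofReal_mul_I_re]
    positivity

lemma norm_cexp_polar (ρ φ r : ℝ) :
    ‖Complex.exp (-(ρ * Complex.exp (φ * Complex.I) * r))‖ = Real.exp (-(ρ * Real.cos φ * r)) := by
  rw [Complex.norm_exp, Complex.neg_re, Complex.re_mul_ofReal, Complex.re_ofReal_mul,
    Complex.exp_ofReal_mul_I_re]

lemma integrableOn_rpow_mul_cexp_polar {a ρ φ : ℝ} (ha : 0 < a) (hρ : 0 < ρ)
    (hφ : |φ| < Real.pi / 2) :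
    IntegrableOn (fun r : ℝ => ((r ^ (a - 1) : ℝ) : ℂ) *
        Complex.exp (-(ρ * Complex.exp (φ * Complex.I) * r))) (Ioi 0) := by
  obtain ⟨h1, h2⟩ := abs_lt.1 hφ
  have hcos : 0 < Real.cos φ := Real.cos_pos_of_mem_Ioo ⟨by linarith, h2⟩
  refine (integrableOn_rpow_mul_exp_neg_mul ha (mul_pos hρ hcos)).mono'
    (Measurable.aestronglyMeasurable (by fun_prop)) ?_
  refine (ae_restrict_iff' measurableSet_Ioi).2 (Eventually.of_forall fun r hr => ?_)
  rw [norm_mul, norm_cexp_polar, Complex.norm_real, Real.norm_of_nonneg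
    (Real.rpow_nonneg (le_of_lt hr) _)]

end TimeFractionalFujita

/-! ### Mellin transform of the Wright function -/

namespace TimeFractionalFujita

/-- The integrand of the integral representation of `wrightSeries` along the ray of angle
`π / (1 + α)`. -/
noncomputable def wrightIntegrand (α a θ r : ℝ) : ℂ :=
  Complex.exp (a * (Real.pi / (1 + α)) * Complex.I) *
    (((r ^ (a - 1) : ℝ) : ℂ) *
      Complex.exp (-((1 : ℝ) * Complex.exp (((Real.pi / (1 + α) - Real.pi : ℝ) : ℂ) * Complex.I) * r))) *
    Complex.exp (-(((r ^ α : ℝ) : ℂ) *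
      Complex.exp (((α * (Real.pi / (1 + α)) : ℝ) : ℂ) * Complex.I) * θ))

/-- The angle π/(1+α) is chosen so that this angle and that of `angle_mul` both have modulus
πα/(1+α), which is below π/2 exactly because α < 1. Hence both exponentials of `wrightIntegrand`
decay. -/
lemma angle_sub_pi {α : ℝ} (h0 : 0 < α) (h1 : α < 1) :
    |Real.pi / (1 + α) - Real.pi| < Real.pi / 2 := by
  have hpi := Real.pi_pos
  have e : Real.pi / (1 + α) - Real.pi = -(Real.pi * α / (1 + α)) := by field_simp; ring
  rw [e, abs_neg, abs_of_pos (by positivity), div_lt_div_iff₀ (by positivity) (by norm_num)]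
  nlinarith

lemma angle_mul {α : ℝ} (h0 : 0 < α) (h1 : α < 1) :
    |α * (Real.pi / (1 + α))| < Real.pi / 2 := by
  have hpi := Real.pi_pos
  rw [abs_of_pos (by positivity), ← mul_div_assoc, div_lt_div_iff₀ (by positivity) (by norm_num)]
  nlinarith

lemma cos_pos_of_abs_lt {φ : ℝ} (h : |φ| < Real.pi / 2) : 0 < Real.cos φ :=
  Real.cos_pos_of_mem_Ioo (abs_lt.1 h)

/-- Expand the exponential containing θ and integrate term by term. The rotated Gamma integral gives
Γ(a+αk) e^(iπ(a+αk)), whose imaginary part is the coefficient supplied by the reflection formula. -/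
lemma wrightSeries_eq_integral {α a : ℝ} (h0 : 0 < α) (h1 : α < 1) (ha : 0 < a) (θ : ℝ) :
    wrightSeries α a θ = (∫ r in Ioi (0 : ℝ), wrightIntegrand α a θ r).im / Real.pi := by
  set ω := Real.pi / (1 + α) with hω
  set φ := ω - Real.pi with hφ
  have hφ' : |φ| < Real.pi / 2 := angle_sub_pi h0 h1
  have hcos := cos_pos_of_abs_lt hφ'
  set T : ℕ → ℝ → ℂ := fun k r => ((-θ) ^ k / k.factorial : ℝ) *
    Complex.exp ((a + α * k) * ω * Complex.I) * (((r ^ (a + α * k - 1) : ℝ) : ℂ) *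
      Complex.exp (-((1 : ℝ) * Complex.exp ((φ : ℂ) * Complex.I) * r))) with hT
  have hint : ∀ k, IntegrableOn (T k) (Ioi 0) := fun k =>
    (integrableOn_rpow_mul_cexp_polar (by positivity) one_pos hφ').const_mul _
  have hnorm : ∀ k, ∫ r in Ioi (0 : ℝ), ‖T k r‖ =
      |θ| ^ k / k.factorial * ((1 / Real.cos φ) ^ (a + α * k) * Real.Gamma (a + α * k)) := by
    intro k
    rw [← Real.integral_rpow_mul_exp_neg_mul_Ioi (by positivity) hcos, ← integral_const_mul]
    refine setIntegral_congr_fun measurableSet_Ioi fun r hr => ?_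
    simp only [hT]
    have e1 : ‖Complex.exp ((a + α * k) * ω * Complex.I)‖ = 1 := by
      exact_mod_cast Complex.norm_exp_ofReal_mul_I ((a + α * k) * ω)
    rw [norm_mul, norm_mul, norm_mul, e1, norm_cexp_polar, Complex.norm_real, Complex.norm_real,
      Real.norm_of_nonneg (Real.rpow_nonneg (le_of_lt hr) _), norm_div, norm_pow, norm_neg,
      Real.norm_natCast, Real.norm_eq_abs, mul_one, one_mul]
  have hsum : Summable fun k => ∫ r in Ioi (0 : ℝ), ‖T k r‖ := by
    have h := (summable_pow_mul_Gamma h0 h1 ha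
      (x := |θ| * (1 / Real.cos φ) ^ α) (by positivity)).mul_left ((1 / Real.cos φ) ^ a)
    refine h.congr fun k => ?_
    rw [hnorm, Real.rpow_add (by positivity), Real.rpow_mul_natCast (by positivity), mul_pow]
    ring
  have hS := hasSum_integral_of_summable_integral_norm hint hsum
  have hval : ∀ k, ∫ r in Ioi (0 : ℝ), T k r = ((-θ) ^ k / k.factorial : ℝ) *
      (Real.Gamma (a + α * k) * Complex.exp (((Real.pi * (a + α * k) : ℝ) : ℂ) * Complex.I)) := by
    intro k
    rw [hT, integral_const_mul, integral_rpow_mul_cexp_polar (by positivity) one_pos hφ',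
      Real.one_rpow]
    have : Complex.exp (((Real.pi * (a + α * k) : ℝ) : ℂ) * Complex.I) =
        Complex.exp ((a + α * k) * ω * Complex.I) *
          Complex.exp (-(((a + α * k : ℝ) : ℂ) * φ) * Complex.I) := by
      rw [← Complex.exp_add, hφ]
      push_cast
      ring_nf
    rw [this]
    push_cast
    ring
  have hE : ∀ r ∈ Ioi (0 : ℝ), ∑' k, T k r = wrightIntegrand α a θ r := by
    intro r hr
    have hr' : (0 : ℝ) < r := hr
    have hexp : ∀ w : ℂ, Complex.exp w = ∑' n : ℕ, w ^ n / n.factorial := fun w => by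
      rw [Complex.exp_eq_exp_ℂ, NormedSpace.exp_eq_tsum_div]
    rw [wrightIntegrand, hexp (-(((r ^ α : ℝ) : ℂ) * _ * _)), ← tsum_mul_left]
    refine tsum_congr fun k => ?_
    simp only [hT]
    rw [show a + α * k - 1 = (a - 1) + α * k by ring, Real.rpow_add hr',
      Real.rpow_mul_natCast hr'.le, neg_pow θ,
      neg_pow (((r ^ α : ℝ) : ℂ) * _ * _), mul_pow, mul_pow, ← Complex.exp_nat_mul,
      show (a + α * k : ℂ) * ω * Complex.I = a * ω * Complex.I +
        k * (((α * ω : ℝ) : ℂ) * Complex.I) by push_cast; ring, Complex.exp_add]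
    rw [hφ, hω]
    push_cast
    ring
  rw [setIntegral_congr_fun measurableSet_Ioi hE] at hS
  have him := (Complex.hasSum_im hS).div_const Real.pi
  rw [wrightSeries_eq_tsum_sin h0 ha, ← him.tsum_eq]
  refine tsum_congr fun k => ?_
  rw [hval, Complex.im_ofReal_mul, Complex.im_ofReal_mul, Complex.exp_ofReal_mul_I_im]
  ring

lemma measurable_wrightIntegrand (α a : ℝ) :
    Measurable fun z : ℝ × ℝ => wrightIntegrand α a z.1 z.2 := by
  unfold wrightIntegrand
  fun_prop

lemma norm_wrightIntegrand (α a θ : ℝ) {r : ℝ} (hr : 0 < r) :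
    ‖wrightIntegrand α a θ r‖ = r ^ (a - 1) *
      Real.exp (-(Real.cos (Real.pi / (1 + α) - Real.pi) * r)) *
      Real.exp (-(r ^ α * Real.cos (α * (Real.pi / (1 + α))) * θ)) := by
  have e1 : ‖Complex.exp (a * (Real.pi / (1 + α)) * Complex.I)‖ = 1 := by
    exact_mod_cast Complex.norm_exp_ofReal_mul_I (a * (Real.pi / (1 + α)))
  rw [wrightIntegrand, norm_mul, norm_mul, norm_mul, e1, norm_cexp_polar, norm_cexp_polar,
    Complex.norm_real, Real.norm_of_nonneg (Real.rpow_nonneg hr.le _), one_mul, one_mul]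

/-- The Mellin transform of the Wright function. -/
lemma mellin_wrightSeries {α a z : ℝ} (h0 : 0 < α) (h1 : α < 1) (hz : 0 < z) (hza : α * z < a) :
    IntegrableOn (fun θ => θ ^ (z - 1) * wrightSeries α a θ) (Ioi 0) ∧
    ∫ θ in Ioi (0 : ℝ), θ ^ (z - 1) * wrightSeries α a θ =
      Real.Gamma z / Real.Gamma (1 - (a - α * z)) := by
  have ha : 0 < a := lt_trans (by positivity) hza
  set ω := Real.pi / (1 + α) with hω
  set φ := ω - Real.pi with hφ
  have hφ' : |φ| < Real.pi / 2 := angle_sub_pi h0 h1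
  have hψ' : |α * ω| < Real.pi / 2 := angle_mul h0 h1
  have hcos := cos_pos_of_abs_lt hφ'
  have hcos2 := cos_pos_of_abs_lt hψ'
  set f : ℝ × ℝ → ℂ := fun x => ((x.1 ^ (z - 1) : ℝ) : ℂ) * wrightIntegrand α a x.1 x.2 with hf
  have hfm : Measurable f := by
    have := measurable_wrightIntegrand α a
    fun_prop
  have hsplit : ∀ θ r : ℝ, f (θ, r) = Complex.exp (a * ω * Complex.I) *
      (((r ^ (a - 1) : ℝ) : ℂ) * Complex.exp (-((1 : ℝ) * Complex.exp ((φ : ℂ) * Complex.I) * r))) *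
      (((θ ^ (z - 1) : ℝ) : ℂ) * Complex.exp (-(((r ^ α : ℝ) : ℂ) *
        Complex.exp (((α * ω : ℝ) : ℂ) * Complex.I) * θ))) := by
    intro θ r
    simp only [hf, wrightIntegrand, hφ, hω]
    push_cast
    ring
  -- The absolute θ-integral is explicit, which gives the integrability for Fubini; αz < a is what
  -- makes r^(a-αz-1) integrable at 0.
  have hnorm : ∀ r ∈ Ioi (0 : ℝ), ∫ θ in Ioi (0 : ℝ), ‖f (θ, r)‖ =
      (Real.cos (α * ω)) ^ (-z) * Real.Gamma z *
        (r ^ (a - α * z - 1) * Real.exp (-(Real.cos φ * r))) := by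
    intro r hr
    have hr' : (0 : ℝ) < r := hr
    have hI := Real.integral_rpow_mul_exp_neg_mul_Ioi hz
      (mul_pos (Real.rpow_pos_of_pos hr' α) hcos2)
    have : ∫ θ in Ioi (0 : ℝ), ‖f (θ, r)‖ = ∫ θ in Ioi (0 : ℝ), r ^ (a - 1) *
        Real.exp (-(Real.cos φ * r)) *
        (θ ^ (z - 1) * Real.exp (-(r ^ α * Real.cos (α * ω) * θ))) := by
      refine setIntegral_congr_fun measurableSet_Ioi fun θ hθ => ?_
      simp only [hf]
      rw [norm_mul, norm_wrightIntegrand _ _ _ hr', Complex.norm_real,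
        Real.norm_of_nonneg (Real.rpow_nonneg (le_of_lt hθ) _)]
      ring
    rw [this, integral_const_mul, hI, one_div, Real.inv_rpow (by positivity),
      ← Real.rpow_neg (by positivity), Real.mul_rpow (by positivity) hcos2.le, ← Real.rpow_mul hr'.le,
      show a - α * z - 1 = (a - 1) + α * -z by ring, Real.rpow_add hr']
    ring
  have hint : Integrable f ((volume.restrict (Ioi 0)).prod (volume.restrict (Ioi 0))) := by
    rw [integrable_prod_iff' hfm.aestronglyMeasurable]
    constructor
    · refine (ae_restrict_iff' measurableSet_Ioi).2 (Eventually.of_forall fun r hr => ?_)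
      simp only [hsplit]
      exact (integrableOn_rpow_mul_cexp_polar hz (Real.rpow_pos_of_pos hr α) hψ').const_mul _
    · refine IntegrableOn.congr_fun ?_ (fun r hr => (hnorm r hr).symm) measurableSet_Ioi
      exact (integrableOn_rpow_mul_exp_neg_mul (by linarith) hcos).const_mul _
  have hW : ∀ θ : ℝ, θ ^ (z - 1) * wrightSeries α a θ =
      (∫ r in Ioi (0 : ℝ), f (θ, r)).im / Real.pi := by
    intro θ
    simp only [hf]
    rw [integral_const_mul, Complex.im_ofReal_mul, wrightSeries_eq_integral h0 h1 ha]
    ring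
  have hint1 := hint.integral_prod_left
  constructor
  · simp only [hW]
    exact hint1.im.div_const _
  · simp only [hW]
    have e1 : ∫ θ in Ioi (0 : ℝ), (∫ r in Ioi (0 : ℝ), f (θ, r)).im =
        (∫ θ in Ioi (0 : ℝ), ∫ r in Ioi (0 : ℝ), f (θ, r)).im := integral_im hint1
    rw [integral_div, e1, integral_integral_swap hint]
    have e2 : ∀ r ∈ Ioi (0 : ℝ), ∫ θ in Ioi (0 : ℝ), f (θ, r) =
        Real.Gamma z * Complex.exp (a * ω * Complex.I) * Complex.exp (-(z * (α * ω : ℝ)) * Complex.I) *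
        (((r ^ (a - α * z - 1) : ℝ) : ℂ) *
          Complex.exp (-((1 : ℝ) * Complex.exp ((φ : ℂ) * Complex.I) * r))) := by
      intro r hr
      have hr' : (0 : ℝ) < r := hr
      simp only [hsplit]
      rw [integral_const_mul, integral_rpow_mul_cexp_polar hz (Real.rpow_pos_of_pos hr α) hψ',
        ← Real.rpow_mul hr'.le, show a - α * z - 1 = (a - 1) + α * -z by ring, Real.rpow_add hr']
      push_cast
      ring
    rw [setIntegral_congr_fun measurableSet_Ioi e2, integral_const_mul,
      integral_rpow_mul_cexp_polar (by linarith) one_pos hφ', Real.one_rpow]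
    have e3 : Real.Gamma z * Complex.exp (a * ω * Complex.I) *
        Complex.exp (-(z * (α * ω : ℝ)) * Complex.I) * (((1 : ℝ) : ℂ) * Real.Gamma (a - α * z) *
          Complex.exp (-(((a - α * z : ℝ) : ℂ) * φ) * Complex.I)) =
        ((Real.Gamma z * Real.Gamma (a - α * z) : ℝ) : ℂ) *
          Complex.exp (((Real.pi * (a - α * z) : ℝ) : ℂ) * Complex.I) := by
      have : Complex.exp (((Real.pi * (a - α * z) : ℝ) : ℂ) * Complex.I) =
          Complex.exp (a * ω * Complex.I) * Complex.exp (-(z * (α * ω : ℝ)) * Complex.I) *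
          Complex.exp (-(((a - α * z : ℝ) : ℂ) * φ) * Complex.I) := by
        rw [← Complex.exp_add, ← Complex.exp_add, hφ]
        push_cast
        ring_nf
      rw [this]
      push_cast
      ring
    rw [e3, Complex.im_ofReal_mul, Complex.exp_ofReal_mul_I_im, div_eq_mul_inv (Real.Gamma z),
      inv_Gamma_one_sub _ (by linarith)]
    ring

end TimeFractionalFujita

/-! ### Moments of the Wright density -/

namespace TimeFractionalFujita

/-- Convexity of Γ on [x, 2], evaluated at 1, where Γ(1) = Γ(2) = 1. -/
lemma one_le_Gamma {x : ℝ} (h0 : 0 < x) (h1 : x ≤ 1) : 1 ≤ Real.Gamma x := by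
  have hconv := Real.convexOn_Gamma.2
  have h := hconv (mem_Ioi.2 h0) (mem_Ioi.2 (two_pos (α := ℝ)))
    (a := 1 / (2 - x)) (b := (1 - x) / (2 - x)) (by apply div_nonneg <;> linarith)
    (by apply div_nonneg <;> linarith) (by rw [← add_div, div_eq_one_iff_eq] <;> linarith)
  have h2 : (0 : ℝ) < 2 - x := by linarith
  have e : (1 / (2 - x)) • x + ((1 - x) / (2 - x)) • (2 : ℝ) = 1 := by
    simp only [smul_eq_mul]
    field_simp
    ring
  rw [e, Real.Gamma_one, Real.Gamma_two, smul_eq_mul, smul_eq_mul, mul_one, div_mul_eq_mul_div,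
    one_mul, ← add_div, le_div_iff₀ h2] at h
  linarith

lemma Gamma_le_one {x : ℝ} (h1 : 1 ≤ x) (h2 : x ≤ 2) : Real.Gamma x ≤ 1 := by
  have hconv := Real.convexOn_Gamma.2
  have h := hconv (mem_Ioi.2 (one_pos (α := ℝ))) (mem_Ioi.2 (two_pos (α := ℝ)))
    (a := 2 - x) (b := x - 1) (by linarith) (by linarith) (by ring)
  simp only [smul_eq_mul, Real.Gamma_one, Real.Gamma_two] at h
  rw [show (2 - x) * 1 + (x - 1) * 2 = x by ring] at h
  linarith

/-- Log-convexity at the midpoint 2 of x and 4 - x gives 1 ≤ Γ(x)Γ(4-x), and Γ(4-x) ≤ Γ(3) = 2. -/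
lemma half_le_Gamma {x : ℝ} (h1 : 1 ≤ x) (h2 : x ≤ 2) : 1 / 2 ≤ Real.Gamma x := by
  have h := Real.Gamma_mul_add_mul_le_rpow_Gamma_mul_rpow_Gamma (s := x) (t := 4 - x)
    (a := 1 / 2) (b := 1 / 2) (by linarith) (by linarith) (by norm_num) (by norm_num) (by norm_num)
  have hx := Real.Gamma_pos_of_pos (by linarith : 0 < x)
  have h4 : Real.Gamma (4 - x) ≤ 2 := by
    have h3 : Real.Gamma 3 = 2 := by
      rw [show (3 : ℝ) = 2 + 1 by norm_num, Real.Gamma_add_one (by norm_num), Real.Gamma_two, mul_one]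
    rw [← h3]
    exact Real.Gamma_strictMonoOn_Ici.monotoneOn (by simp only [mem_Ici]; linarith)
      (by simp only [mem_Ici]; norm_num) (by linarith)
  rw [show 1 / 2 * x + 1 / 2 * (4 - x) = 2 by ring, Real.Gamma_two,
    ← Real.mul_rpow hx.le (Real.Gamma_nonneg_of_nonneg (by linarith))] at h
  have h5 : 1 ≤ Real.Gamma x * Real.Gamma (4 - x) := by
    by_contra hc
    push Not at hc
    exact absurd h (not_le.2 (Real.rpow_lt_one
      (mul_nonneg hx.le (Real.Gamma_nonneg_of_nonneg (by linarith))) hc (by norm_num)))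
  nlinarith

variable {α : ℝ}

/-- The exact value is Γ(1-γ)/Γ(1-αγ); dropping the denominator, which is at least 1, makes the
bound independent of α. -/
lemma lintegral_rpow_neg_mul_wrightDensity_le (h0 : 0 < α) (h1 : α < 1) {γ : ℝ} (hγ0 : 0 < γ)
    (hγ1 : γ < 1) :
    ∫⁻ θ in Ioi (0 : ℝ), ENNReal.ofReal (θ ^ (-γ) * wrightDensity α θ) ≤
      ENNReal.ofReal (Real.Gamma (1 - γ)) := by
  obtain ⟨hi, he⟩ := mellin_wrightSeries (a := α) (z := 1 - γ) h0 h1 (by linarith) (by nlinarith)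
  simp only [sub_sub_cancel_left, ← wrightDensity_eq] at hi he
  rw [← ofReal_integral_eq_lintegral_ofReal hi, he]
  · refine ENNReal.ofReal_le_ofReal ?_
    apply div_le_self (Real.Gamma_pos_of_pos (by linarith)).le
    exact one_le_Gamma (by nlinarith) (by nlinarith)
  · refine (ae_restrict_iff' measurableSet_Ioi).2 (Eventually.of_forall fun θ hθ => ?_)
    exact mul_nonneg (Real.rpow_nonneg (le_of_lt hθ) _) (wrightDensity_nonneg h0 h1 hθ)

lemma lintegral_rpow_mul_wrightDensity (h0 : 0 < α) (h1 : α < 1) {z : ℝ} (hz0 : 0 < z)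
    (hz1 : z ≤ 1) :
    ∫⁻ θ in Ioi (0 : ℝ), ENNReal.ofReal (θ ^ z * wrightDensity α θ) =
      ENNReal.ofReal (Real.Gamma (1 + z) / Real.Gamma (1 + α * z)) := by
  obtain ⟨hi, he⟩ := mellin_wrightSeries (a := 1) (z := z) h0 h1 hz0 (by nlinarith)
  have e : ∀ θ ∈ Ioi (0 : ℝ), θ ^ (z - 1) * wrightSeries α 1 θ =
      α * (θ ^ z * wrightDensity α θ) := by
    intro θ hθ
    have hθ' : (0 : ℝ) < θ := hθ
    rw [wrightSeries_one_eq h0 h1, Real.rpow_sub_one hθ'.ne']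
    field_simp
  have hi' := (hi.congr_fun e measurableSet_Ioi).const_mul α⁻¹
  rw [setIntegral_congr_fun measurableSet_Ioi e, integral_const_mul, sub_sub_cancel] at he
  simp only [← mul_assoc, inv_mul_cancel₀ h0.ne', one_mul] at hi'
  rw [← ofReal_integral_eq_lintegral_ofReal hi']
  · congr 1
    rw [add_comm 1 z, Real.Gamma_add_one hz0.ne', add_comm 1 (α * z),
      Real.Gamma_add_one (by positivity)]
    have := (Real.Gamma_pos_of_pos (by positivity : 0 < α * z)).ne'
    field_simp at he ⊢
    linarith
  · refine (ae_restrict_iff' measurableSet_Ioi).2 (Eventually.of_forall fun θ hθ => ?_)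
    exact mul_nonneg (Real.rpow_nonneg (le_of_lt hθ) _) (wrightDensity_nonneg h0 h1 hθ)

lemma lintegral_id_mul_wrightDensity_le (h0 : 0 < α) (h1 : α < 1) :
    ∫⁻ θ in Ioi (0 : ℝ), ENNReal.ofReal (θ * wrightDensity α θ) ≤ ENNReal.ofReal 2 := by
  have h := lintegral_rpow_mul_wrightDensity h0 h1 one_pos le_rfl
  simp only [Real.rpow_one, mul_one] at h
  rw [h, one_add_one_eq_two, Real.Gamma_two]
  refine ENNReal.ofReal_le_ofReal ?_
  have := half_le_Gamma (x := 1 + α) (by linarith) (by linarith)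
  rw [div_le_iff₀ (by linarith)]
  linarith

lemma lintegral_rpow_one_sub_mul_wrightDensity_le (h0 : 0 < α) (h1 : α < 1) {γ : ℝ} (hγ0 : 0 < γ)
    (hγ1 : γ < 1) :
    ∫⁻ θ in Ioi (0 : ℝ), ENNReal.ofReal (θ ^ (-γ) * (θ * wrightDensity α θ)) ≤ ENNReal.ofReal 2 := by
  have h := lintegral_rpow_mul_wrightDensity h0 h1 (z := 1 - γ) (by linarith) (by linarith)
  have e : ∫⁻ θ in Ioi (0 : ℝ), ENNReal.ofReal (θ ^ (-γ) * (θ * wrightDensity α θ)) =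
      ∫⁻ θ in Ioi (0 : ℝ), ENNReal.ofReal (θ ^ (1 - γ) * wrightDensity α θ) := by
    refine setLIntegral_congr_fun measurableSet_Ioi fun θ hθ => ?_
    have hθ' : (0 : ℝ) < θ := hθ
    rw [show 1 - γ = -γ + 1 by ring, Real.rpow_add_one hθ'.ne', mul_assoc]
  rw [e, h]
  refine ENNReal.ofReal_le_ofReal ?_
  have h2 := Gamma_le_one (x := 1 + (1 - γ)) (by linarith) (by linarith)
  have h3 := half_le_Gamma (x := 1 + α * (1 - γ)) (by nlinarith) (by nlinarith)
  rw [div_le_iff₀ (by linarith)]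
  linarith

/-- A fixed compact interval carries a definite part of the mass of `wrightDensity α`, uniformly
in `α`. -/
lemma le_lintegral_wrightDensity_Icc (h0 : 0 < α) (h1 : α < 1) :
    ENNReal.ofReal (1 / 64) ≤
      ∫⁻ θ in Icc (1 / 256 : ℝ) 64, ENNReal.ofReal (wrightDensity α θ) := by
  have hm := measurable_wrightDensity h0 h1
  set X := ∫⁻ θ in Icc (1 / 256 : ℝ) 64, ENNReal.ofReal (wrightDensity α θ) with hX
  have hXi : ∫⁻ θ in Ioi (0 : ℝ), (Icc (1 / 256 : ℝ) 64).indicator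
      (fun θ => ENNReal.ofReal (wrightDensity α θ)) θ = X := by
    rw [lintegral_indicator measurableSet_Icc, Measure.restrict_restrict measurableSet_Icc,
      inter_eq_left.2 fun θ hθ => mem_Ioi.2 (by linarith [hθ.1])]
  have hlow : ENNReal.ofReal (1 / 2) ≤
      ∫⁻ θ in Ioi (0 : ℝ), ENNReal.ofReal (θ ^ (1 / 2 : ℝ) * wrightDensity α θ) := by
    rw [lintegral_rpow_mul_wrightDensity h0 h1 (by norm_num) (by norm_num)]
    refine ENNReal.ofReal_le_ofReal ?_
    have h2 := Gamma_le_one (x := 1 + α * (1 / 2)) (by linarith) (by linarith)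
    have h3 := half_le_Gamma (x := 1 + 1 / 2) (by norm_num) (by norm_num)
    rw [le_div_iff₀ (Real.Gamma_pos_of_pos (by linarith))]
    linarith
  have h1' := lintegral_id_mul_wrightDensity_le h0 h1
  have h2' : ∫⁻ θ in Ioi (0 : ℝ), ENNReal.ofReal (θ ^ (-(1 / 4) : ℝ) * wrightDensity α θ) ≤
      ENNReal.ofReal (4 / 3) := by
    refine (lintegral_rpow_neg_mul_wrightDensity_le h0 h1 (γ := 1 / 4) (by norm_num)
      (by norm_num)).trans (ENNReal.ofReal_le_ofReal ?_)
    have h := Real.Gamma_add_one (s := 1 - 1 / 4) (by norm_num)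
    have h2 := Gamma_le_one (x := 1 - 1 / 4 + 1) (by norm_num) (by norm_num)
    linarith
  -- The moment of order 1/2 is bounded below. Its part on θ < 1/256 is controlled by the moment of
  -- order -1/4, since θ^(3/4) ≤ 1/64 there, and its part on θ > 64 by the first moment, since √θ ≤
  -- θ/8 there.
  have hpt : ∀ θ ∈ Ioi (0 : ℝ), ENNReal.ofReal (θ ^ (1 / 2 : ℝ) * wrightDensity α θ) ≤
      ENNReal.ofReal (1 / 64) * ENNReal.ofReal (θ ^ (-(1 / 4) : ℝ) * wrightDensity α θ) +
      (ENNReal.ofReal (1 / 8) * ENNReal.ofReal (θ * wrightDensity α θ) +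
      ENNReal.ofReal 8 * (Icc (1 / 256 : ℝ) 64).indicator
        (fun θ => ENNReal.ofReal (wrightDensity α θ)) θ) := by
    intro θ hθ
    have hθ' : (0 : ℝ) < θ := hθ
    have hw := wrightDensity_nonneg h0 h1 hθ'
    rcases lt_or_ge θ (1 / 256) with hc | hc
    · refine le_trans ?_ (le_add_of_nonneg_right (by positivity))
      rw [← ENNReal.ofReal_mul (by norm_num), ← mul_assoc]
      refine ENNReal.ofReal_le_ofReal ?_
      gcongr
      rw [show (1 / 2 : ℝ) = 3 / 4 + -(1 / 4) by norm_num, Real.rpow_add hθ']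
      gcongr
      calc θ ^ (3 / 4 : ℝ) ≤ (1 / 256) ^ (3 / 4 : ℝ) := by gcongr
        _ = 1 / 64 := by
          rw [show (1 / 256 : ℝ) = (1 / 4) ^ (4 : ℝ) by norm_num, ← Real.rpow_mul (by norm_num)]
          norm_num
    · refine le_trans ?_ (le_add_of_nonneg_left (by positivity))
      rcases le_or_gt θ 64 with hd | hd
      · refine le_trans ?_ (le_add_of_nonneg_left (by positivity))
        rw [indicator_of_mem (mem_Icc.2 ⟨hc, hd⟩), ← ENNReal.ofReal_mul (by norm_num)]
        refine ENNReal.ofReal_le_ofReal ?_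
        gcongr
        rw [← Real.sqrt_eq_rpow]
        exact Real.sqrt_le_iff.2 ⟨by norm_num, by linarith⟩
      · refine le_trans ?_ (le_add_of_nonneg_right (by positivity))
        rw [← ENNReal.ofReal_mul (by norm_num), ← mul_assoc]
        refine ENNReal.ofReal_le_ofReal ?_
        gcongr
        rw [← Real.sqrt_eq_rpow]
        exact Real.sqrt_le_iff.2 ⟨by linarith, by nlinarith⟩
  have hfin := hlow.trans (setLIntegral_mono' measurableSet_Ioi hpt)
  rw [lintegral_add_left (by fun_prop), lintegral_add_left (by fun_prop),
    lintegral_const_mul _ (by fun_prop), lintegral_const_mul _ (by fun_prop),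
    lintegral_const_mul _ ((by fun_prop : Measurable fun θ =>
      ENNReal.ofReal (wrightDensity α θ)).indicator measurableSet_Icc), hXi] at hfin
  have hfin2 : ENNReal.ofReal (1 / 2) ≤ ENNReal.ofReal (1 / 64) * ENNReal.ofReal (4 / 3) +
      (ENNReal.ofReal (1 / 8) * ENNReal.ofReal 2 + ENNReal.ofReal 8 * X) := by
    refine hfin.trans ?_
    gcongr
  by_contra hlt
  push Not at hlt
  -- Contradiction: 1/48 + 1/4 + 1/8 < 1/2.
  have hfin3 : ENNReal.ofReal (1 / 2) ≤ ENNReal.ofReal (1 / 64) * ENNReal.ofReal (4 / 3) +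
      (ENNReal.ofReal (1 / 8) * ENNReal.ofReal 2 + ENNReal.ofReal 8 * ENNReal.ofReal (1 / 64)) := by
    refine hfin2.trans ?_
    gcongr
  rw [← ENNReal.ofReal_mul (by norm_num), ← ENNReal.ofReal_mul (by norm_num),
    ← ENNReal.ofReal_mul (by norm_num), ← ENNReal.ofReal_add (by norm_num) (by norm_num),
    ← ENNReal.ofReal_add (by norm_num) (by norm_num), ENNReal.ofReal_le_ofReal_iff (by norm_num)]
    at hfin3
  norm_num at hfin3

end TimeFractionalFujita

/-! ### The heat kernel -/

namespace TimeFractionalFujita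

variable {N : ℕ}

@[fun_prop]
lemma measurable_heatKernel : Measurable fun z : ℝ × Space N => heatKernel N z.1 z.2 := by
  unfold heatKernel
  fun_prop

@[fun_prop]
lemma Measurable.heatKernel {β : Type*} [MeasurableSpace β] {f : β → ℝ} {g : β → Space N}
    (hf : Measurable f) (hg : Measurable g) : Measurable fun b => heatKernel N (f b) (g b) :=
  measurable_heatKernel.comp (hf.prodMk hg)

lemma heatKernel_pos {t : ℝ} (ht : 0 < t) (x : Space N) : 0 < heatKernel N t x := by
  have := Real.pi_pos
  unfold heatKernel
  positivity

lemma integral_heatKernel_sub {t : ℝ} (ht : 0 < t) (y : Space N) :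
    ∫ x, heatKernel N t (x - y) = 1 := by
  have hpi := Real.pi_pos
  have hG := GaussianFourier.integral_rexp_neg_mul_sq_norm (V := Space N) (b := 1 / (4 * t))
    (by positivity)
  rw [finrank_euclideanSpace_fin] at hG
  rw [integral_sub_right_eq_self (fun x => heatKernel N t x) y]
  unfold heatKernel
  have e : ∀ x : Space N, Real.exp (-‖x‖ ^ 2 / (4 * t)) = Real.exp (-(1 / (4 * t)) * ‖x‖ ^ 2) :=
    fun x => by congr 1; ring
  simp only [e]
  rw [integral_const_mul, hG, show Real.pi / (1 / (4 * t)) = 4 * Real.pi * t by field_simp]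
  have : (4 * Real.pi * t) ^ ((N : ℝ) / 2) ≠ 0 := by positivity
  field_simp

lemma lintegral_heatKernel_sub {t : ℝ} (ht : 0 < t) (y : Space N) :
    ∫⁻ x, ENNReal.ofReal (heatKernel N t (x - y)) = 1 := by
  have h := integral_heatKernel_sub ht y
  rw [← ofReal_integral_eq_lintegral_ofReal
    (by_contra fun hc => by rw [integral_undef hc] at h; exact zero_ne_one h)
    (Eventually.of_forall fun x => (heatKernel_pos ht _).le), h, ENNReal.ofReal_one]

lemma lintegral_heatKernel {t : ℝ} (ht : 0 < t) :
    ∫⁻ x : Space N, ENNReal.ofReal (heatKernel N t x) = 1 := by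
  simpa using lintegral_heatKernel_sub ht (0 : Space N)

lemma heatKernel_le {t : ℝ} (ht : 0 < t) (x : Space N) :
    heatKernel N t x ≤ t ^ (-((N : ℝ) / 2)) := by
  have hpi := Real.pi_gt_three
  rw [heatKernel, Real.rpow_neg ht.le, ← one_div, ← mul_one (1 / t ^ ((N : ℝ) / 2))]
  gcongr
  · nlinarith
  · rw [Real.exp_le_one_iff]
    apply div_nonpos_of_nonpos_of_nonneg _ (by positivity)
    have : 0 ≤ ‖x‖ ^ 2 := by positivity
    linarith

/-- The `L^p` norm of the heat kernel is at most `t ^ (-N (p - 1) / (2 p))`. -/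
lemma lintegral_heatKernel_sub_rpow_le {t p : ℝ} (ht : 0 < t) (hp : 1 < p) (y : Space N) :
    ∫⁻ x, ENNReal.ofReal (heatKernel N t (x - y)) ^ p ≤
      ENNReal.ofReal (t ^ (-((N : ℝ) * (p - 1) / (2 * p)))) ^ p := by
  have hpt : ∀ x, ENNReal.ofReal (heatKernel N t (x - y)) ^ p ≤
      ENNReal.ofReal (t ^ (-((N : ℝ) * (p - 1) / 2))) * ENNReal.ofReal (heatKernel N t (x - y)) := by
    intro x
    have hG := heatKernel_pos ht (x - y)
    rw [ENNReal.ofReal_rpow_of_nonneg hG.le (by linarith), ← ENNReal.ofReal_mul (by positivity)]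
    refine ENNReal.ofReal_le_ofReal ?_
    calc heatKernel N t (x - y) ^ p
        = heatKernel N t (x - y) ^ (p - 1) * heatKernel N t (x - y) := by
          rw [← Real.rpow_add_one hG.ne', sub_add_cancel]
      _ ≤ (t ^ (-((N : ℝ) / 2))) ^ (p - 1) * heatKernel N t (x - y) := by
          gcongr
          exact heatKernel_le ht _
      _ = _ := by
          rw [← Real.rpow_mul ht.le]
          ring_nf
  refine (lintegral_mono hpt).trans ?_
  rw [lintegral_const_mul _ (by fun_prop), lintegral_heatKernel_sub ht, mul_one,
    ENNReal.ofReal_rpow_of_nonneg (by positivity) (by linarith), ← Real.rpow_mul ht.le]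
  apply le_of_eq
  congr 2
  field_simp

/-- The semigroup property of the heat kernel. -/
lemma lintegral_heatKernel_mul_heatKernel_sub {ρ σ : ℝ} (hρ : 0 < ρ) (hσ : 0 < σ) (y : Space N) :
    ∫⁻ x, ENNReal.ofReal (heatKernel N ρ x) * ENNReal.ofReal (heatKernel N σ (x - y)) =
      ENNReal.ofReal (heatKernel N (ρ + σ) y) := by
  have hpi := Real.pi_pos
  have hs : 0 < ρ + σ := by linarith
  set τ := ρ * σ / (ρ + σ) with hτ
  have hτ0 : 0 < τ := by positivity
  -- Completing the square: a product of Gaussians is a constant times a Gaussian of time ρσ/(ρ+σ),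
  -- centred at the weighted mean of the two centres.
  have key : ∀ x, heatKernel N ρ x * heatKernel N σ (x - y) =
      heatKernel N (ρ + σ) y * heatKernel N τ (x - (ρ / (ρ + σ)) • y) := by
    intro x
    have hx : ‖x - (ρ / (ρ + σ)) • y‖ ^ 2 =
        ‖x‖ ^ 2 - 2 * (ρ / (ρ + σ)) * inner ℝ x y + (ρ / (ρ + σ)) ^ 2 * ‖y‖ ^ 2 := by
      rw [norm_sub_sq_real, inner_smul_right, norm_smul, mul_pow, Real.norm_eq_abs, sq_abs]
      ring
    have hxy : ‖x - y‖ ^ 2 = ‖x‖ ^ 2 - 2 * inner ℝ x y + ‖y‖ ^ 2 := norm_sub_sq_real x y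
    simp only [heatKernel]
    rw [mul_mul_mul_comm, ← Real.exp_add, mul_mul_mul_comm, ← Real.exp_add, div_mul_div_comm,
      div_mul_div_comm, ← Real.mul_rpow (by positivity) (by positivity),
      ← Real.mul_rpow (by positivity) (by positivity)]
    congr 1
    · congr 2
      rw [hτ]
      field_simp
    · congr 1
      rw [hx, hxy, hτ]
      field_simp
      ring
  have : ∀ x, ENNReal.ofReal (heatKernel N ρ x) * ENNReal.ofReal (heatKernel N σ (x - y)) =
      ENNReal.ofReal (heatKernel N (ρ + σ) y) *
        ENNReal.ofReal (heatKernel N τ (x - (ρ / (ρ + σ)) • y)) := by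
    intro x
    rw [← ENNReal.ofReal_mul (heatKernel_pos hρ _).le, key,
      ENNReal.ofReal_mul (heatKernel_pos hs _).le]
  simp only [this]
  rw [lintegral_const_mul _ (by fun_prop), lintegral_heatKernel_sub hτ0, mul_one]

/-- Increasing the time only increases the exponential, so the prefactor is all that is lost. -/
lemma mul_heatKernel_le_heatKernel_add {ρ σ : ℝ} (hρ : 0 < ρ) (hσ : 0 ≤ σ) (y : Space N) :
    (ρ / (ρ + σ)) ^ ((N : ℝ) / 2) * heatKernel N ρ y ≤ heatKernel N (ρ + σ) y := by
  have hpi := Real.pi_pos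
  have hs : 0 < ρ + σ := by linarith
  simp only [heatKernel]
  rw [← mul_assoc]
  have e : (ρ / (ρ + σ)) ^ ((N : ℝ) / 2) * (1 / (4 * Real.pi * ρ) ^ ((N : ℝ) / 2)) =
      1 / (4 * Real.pi * (ρ + σ)) ^ ((N : ℝ) / 2) := by
    rw [Real.div_rpow hρ.le hs.le, Real.mul_rpow (by positivity) hρ.le,
      Real.mul_rpow (by positivity) hs.le]
    have := (Real.rpow_pos_of_pos hρ ((N : ℝ) / 2)).ne'
    field_simp
  rw [e]
  gcongr 1 / _ * Real.exp ?_
  rw [div_le_div_iff₀ (by positivity) (by positivity)]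
  nlinarith [mul_nonneg (sq_nonneg ‖y‖) hσ]

/-- Since ‖x - y‖² ≤ 2‖x‖² + 2‖y‖², doubling the time absorbs the y-part. This bounds a centred
Gaussian mass by the heat flow at an arbitrary point x. -/
lemma heatKernel_le_mul_heatKernel_sub {ρ σ : ℝ} (hρ : 0 < ρ) (hσ : 2 * ρ ≤ σ) (x y : Space N) :
    heatKernel N ρ y ≤
      (σ / ρ) ^ ((N : ℝ) / 2) * Real.exp (‖x‖ ^ 2 / (2 * σ)) * heatKernel N σ (x - y) := by
  have hpi := Real.pi_pos
  have hs : 0 < σ := by linarith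
  simp only [heatKernel]
  rw [mul_mul_mul_comm, ← Real.exp_add]
  have e : (σ / ρ) ^ ((N : ℝ) / 2) * (1 / (4 * Real.pi * σ) ^ ((N : ℝ) / 2)) =
      1 / (4 * Real.pi * ρ) ^ ((N : ℝ) / 2) := by
    rw [Real.div_rpow hs.le hρ.le, Real.mul_rpow (by positivity) hρ.le,
      Real.mul_rpow (by positivity) hs.le]
    have := (Real.rpow_pos_of_pos hs ((N : ℝ) / 2)).ne'
    field_simp
  rw [e]
  gcongr 1 / _ * Real.exp ?_
  have h1 : ‖x - y‖ ^ 2 ≤ 2 * ‖x‖ ^ 2 + 2 * ‖y‖ ^ 2 := by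
    have h := norm_sub_le x y
    nlinarith [sq_nonneg (‖x‖ - ‖y‖), norm_nonneg (x - y), norm_nonneg x, norm_nonneg y]
  have h2 : ‖y‖ ^ 2 / (2 * σ) ≤ ‖y‖ ^ 2 / (4 * ρ) :=
    div_le_div_of_nonneg_left (by positivity) (by positivity) (by linarith)
  have h3 : ‖x - y‖ ^ 2 / (4 * σ) ≤ ‖x‖ ^ 2 / (2 * σ) + ‖y‖ ^ 2 / (2 * σ) := by
    calc _ ≤ (2 * ‖x‖ ^ 2 + 2 * ‖y‖ ^ 2) / (4 * σ) := by gcongr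
      _ = _ := by field_simp; ring
  rw [neg_div, neg_div]
  linarith

lemma lintegral_heatFlow_mul_heatKernel {ρ σ : ℝ} (hρ : 0 < ρ) (hσ : 0 < σ)
    (μ : Measure (Space N)) [SFinite μ] :
    ∫⁻ x, ENNReal.ofReal (heatKernel N ρ x) * heatFlow σ μ x =
      ∫⁻ y, ENNReal.ofReal (heatKernel N (ρ + σ) y) ∂μ := by
  simp only [heatFlow]
  have h1 : ∀ x, ENNReal.ofReal (heatKernel N ρ x) *
      ∫⁻ y, ENNReal.ofReal (heatKernel N σ (x - y)) ∂μ =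
      ∫⁻ y, ENNReal.ofReal (heatKernel N ρ x) * ENNReal.ofReal (heatKernel N σ (x - y)) ∂μ :=
    fun x => (lintegral_const_mul _ (by fun_prop)).symm
  simp only [h1]
  rw [lintegral_lintegral_swap (by fun_prop)]
  exact lintegral_congr fun y => lintegral_heatKernel_mul_heatKernel_sub hρ hσ y

end TimeFractionalFujita

/-! ### Picard iteration and minimal solutions -/

namespace TimeFractionalFujita

variable {N : ℕ} {α p : ℝ}

lemma restrict_Ioc_prod_univ (T : ℝ) :
    (volume : Measure (ℝ × Space N)).restrict (Ioc 0 T ×ˢ univ) =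
      (volume.restrict (Ioc 0 T)).prod volume := by
  rw [Measure.volume_eq_prod, ← Measure.prod_restrict, Measure.restrict_univ]

lemma heatFlow_mono {μ ν : Measure (Space N)} (h : μ ≤ ν) (t : ℝ) (x : Space N) :
    heatFlow t μ x ≤ heatFlow t ν x :=
  lintegral_mono' h le_rfl

lemma solutionOpP_mono {μ ν : Measure (Space N)} (h : μ ≤ ν) (t : ℝ) (x : Space N) :
    solutionOpP α t μ x ≤ solutionOpP α t ν x :=
  lintegral_mono fun θ => by gcongr; exact heatFlow_mono h _ _

lemma solutionOpS_mono {μ ν : Measure (Space N)} (h : μ ≤ ν) (t : ℝ) (x : Space N) :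
    solutionOpS α t μ x ≤ solutionOpS α t ν x :=
  lintegral_mono fun θ => by gcongr; exact heatFlow_mono h _ _

/-- The right-hand side sees u only through integrals over (0, t), so an almost everywhere
comparison yields a pointwise one. Monotonicity of the lower integral needs no measurability of u or
v. -/
lemma duhamel_mono_ae (hp : 0 < p) {μ ν : Measure (Space N)} (hμν : μ ≤ ν) {T : ℝ}
    {u v : ℝ → Space N → ℝ≥0∞}
    (h : ∀ᵐ z : ℝ × Space N ∂(volume.restrict (Ioc 0 T ×ˢ univ)), u z.1 z.2 ≤ v z.1 z.2)
    {t : ℝ} (ht : t ≤ T) (x : Space N) : duhamel α p μ u t x ≤ duhamel α p ν v t x := by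
  rw [restrict_Ioc_prod_univ] at h
  have hsub : Ioo 0 t ⊆ Ioc 0 T := fun s hs => ⟨hs.1, hs.2.le.trans ht⟩
  have h1 := ae_restrict_of_ae_restrict_of_subset hsub (Measure.ae_ae_of_ae_prod h)
  refine add_le_add (solutionOpP_mono hμν t x) ?_
  gcongr ENNReal.ofReal α * ?_
  refine lintegral_mono_ae ?_
  filter_upwards [h1] with s hs
  gcongr
  refine solutionOpS_mono (withDensity_mono ?_) _ _
  filter_upwards [hs] with y hy
  gcongr

lemma heatFlow_withDensity {f : Space N → ℝ≥0∞} (hf : Measurable f) (t : ℝ) (x : Space N) :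
    heatFlow t (volume.withDensity f) x =
      ∫⁻ y, f y * ENNReal.ofReal (heatKernel N t (x - y)) := by
  rw [heatFlow, lintegral_withDensity_eq_lintegral_mul _ hf (by fun_prop)]
  rfl

lemma duhamel_eq {μ : Measure (Space N)} {u : ℝ → Space N → ℝ≥0∞}
    (hu : Measurable fun z : ℝ × Space N => u z.1 z.2) (t : ℝ) (x : Space N) :
    duhamel α p μ u t x = solutionOpP α t μ x + ENNReal.ofReal α * ∫⁻ s in Ioo 0 t,
      ENNReal.ofReal ((t - s) ^ (α - 1)) * ∫⁻ θ in Ioi (0 : ℝ),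
        ENNReal.ofReal (θ * wrightDensity α θ) *
          ∫⁻ y, u s y ^ p * ENNReal.ofReal (heatKernel N ((t - s) ^ α * θ) (x - y)) := by
  unfold duhamel solutionOpS
  congr 2
  refine lintegral_congr fun s => ?_
  congr 1
  refine lintegral_congr fun θ => ?_
  rw [heatFlow_withDensity]
  have : Measurable (u s) := hu.comp measurable_prodMk_left
  fun_prop

lemma measurable_solutionOpP (h0 : 0 < α) (h1 : α < 1) (μ : Measure (Space N)) [SFinite μ] :
    Measurable fun z : ℝ × Space N => solutionOpP α z.1 μ z.2 := by
  have hw := measurable_wrightDensity h0 h1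
  unfold solutionOpP heatFlow
  have hh : Measurable fun q : (ℝ × Space N) × ℝ =>
      ∫⁻ y, ENNReal.ofReal (heatKernel N (q.1.1 ^ α * q.2) (q.1.2 - y)) ∂μ := by
    apply Measurable.lintegral_prod_right' (f := fun q : ((ℝ × Space N) × ℝ) × Space N =>
      ENNReal.ofReal (heatKernel N (q.1.1.1 ^ α * q.1.2) (q.1.1.2 - q.2)))
    fun_prop
  apply Measurable.lintegral_prod_right' (f := fun q : (ℝ × Space N) × ℝ =>
    ENNReal.ofReal (wrightDensity α q.2) *
      ∫⁻ y, ENNReal.ofReal (heatKernel N (q.1.1 ^ α * q.2) (q.1.2 - y)) ∂μ)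
  fun_prop

lemma measurable_duhamel_inner (α p : ℝ) {u : ℝ → Space N → ℝ≥0∞}
    (hu : Measurable fun z : ℝ × Space N => u z.1 z.2) :
    Measurable fun q : ((ℝ × Space N) × ℝ) × ℝ =>
      ∫⁻ y, u q.1.2 y ^ p * ENNReal.ofReal (heatKernel N ((q.1.1.1 - q.1.2) ^ α * q.2)
        (q.1.1.2 - y)) := by
  apply Measurable.lintegral_prod_right' (f := fun q : (((ℝ × Space N) × ℝ) × ℝ) × Space N =>
    u q.1.1.2 q.2 ^ p * ENNReal.ofReal (heatKernel N ((q.1.1.1.1 - q.1.1.2) ^ α * q.1.2)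
        (q.1.1.1.2 - q.2)))
  have : Measurable fun q : (((ℝ × Space N) × ℝ) × ℝ) × Space N => u q.1.1.2 q.2 :=
    hu.comp (by fun_prop : Measurable fun q : (((ℝ × Space N) × ℝ) × ℝ) × Space N => (q.1.1.2, q.2))
  fun_prop

lemma measurable_duhamel_middle (h0 : 0 < α) (h1 : α < 1) {u : ℝ → Space N → ℝ≥0∞}
    (hu : Measurable fun z : ℝ × Space N => u z.1 z.2) :
    Measurable fun q : (ℝ × Space N) × ℝ => ∫⁻ θ in Ioi (0 : ℝ),
        ENNReal.ofReal (θ * wrightDensity α θ) *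
          ∫⁻ y, u q.2 y ^ p * ENNReal.ofReal (heatKernel N ((q.1.1 - q.2) ^ α * θ)
            (q.1.2 - y)) := by
  have hw := measurable_wrightDensity h0 h1
  have hh := measurable_duhamel_inner α p hu
  apply Measurable.lintegral_prod_right' (f := fun q : ((ℝ × Space N) × ℝ) × ℝ =>
    ENNReal.ofReal (q.2 * wrightDensity α q.2) * ∫⁻ y, u q.1.2 y ^ p *
      ENNReal.ofReal (heatKernel N ((q.1.1.1 - q.1.2) ^ α * q.2) (q.1.1.2 - y)))
  fun_prop

lemma measurable_duhamel (h0 : 0 < α) (h1 : α < 1) (μ : Measure (Space N)) [SFinite μ]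
    {u : ℝ → Space N → ℝ≥0∞} (hu : Measurable fun z : ℝ × Space N => u z.1 z.2) :
    Measurable fun z : ℝ × Space N => duhamel α p μ u z.1 z.2 := by
  simp only [duhamel_eq hu]
  refine (measurable_solutionOpP h0 h1 μ).add (Measurable.const_mul ?_ _)
  have hh := measurable_duhamel_middle (p := p) h0 h1 hu
  have hset : MeasurableSet {q : (ℝ × Space N) × ℝ | 0 < q.2 ∧ q.2 < q.1.1} :=
    (measurableSet_lt measurable_const measurable_snd).inter
      (measurableSet_lt measurable_snd (measurable_fst.comp measurable_fst))
  set F : (ℝ × Space N) × ℝ → ℝ≥0∞ := fun q => ENNReal.ofReal ((q.1.1 - q.2) ^ (α - 1)) *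
    ∫⁻ θ in Ioi (0 : ℝ), ENNReal.ofReal (θ * wrightDensity α θ) *
      ∫⁻ y, u q.2 y ^ p * ENNReal.ofReal (heatKernel N ((q.1.1 - q.2) ^ α * θ) (q.1.2 - y)) with hF
  have hFm : Measurable F := by
    rw [hF]
    fun_prop
  have := (hFm.indicator hset).lintegral_prod_right' (ν := volume)
  convert! this using 2 with z
  rw [← lintegral_indicator measurableSet_Ioo]
  rfl

/-- The Picard iterates of the integral equation, starting from `0`. -/
noncomputable def picard (α p : ℝ) (μ : Measure (Space N)) : ℕ → ℝ → Space N → ℝ≥0∞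
  | 0 => fun _ _ => 0
  | n + 1 => duhamel α p μ (picard α p μ n)

/-- The limit of the Picard iterates. -/
noncomputable def picardLimit (α p : ℝ) (μ : Measure (Space N)) (t : ℝ) (x : Space N) : ℝ≥0∞ :=
  ⨆ n, picard α p μ n t x

lemma measurable_picard (h0 : 0 < α) (h1 : α < 1) (μ : Measure (Space N)) [SFinite μ] (n : ℕ) :
    Measurable fun z : ℝ × Space N => picard α p μ n z.1 z.2 := by
  induction n with
  | zero => exact measurable_const
  | succ n ih => exact measurable_duhamel h0 h1 μ ih

lemma measurable_picardLimit (h0 : 0 < α) (h1 : α < 1) (μ : Measure (Space N)) [SFinite μ] :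
    Measurable fun z : ℝ × Space N => picardLimit α p μ z.1 z.2 :=
  Measurable.iSup fun n => measurable_picard h0 h1 μ n

lemma monotone_picard (hp : 0 < p) (μ : Measure (Space N)) : Monotone (picard α p μ) := by
  refine monotone_nat_of_le_succ fun n => ?_
  induction n with
  | zero => exact fun _ _ => zero_le
  | succ n ih =>
    exact fun t x => duhamel_mono_ae hp le_rfl (Eventually.of_forall fun z => ih z.1 z.2) le_rfl x

/-- Monotone convergence in y, θ and s in turn; the power p commutes with suprema as an order
isomorphism of [0, ∞]. -/
lemma duhamel_iSup (h0 : 0 < α) (h1 : α < 1) (hp : 0 < p) (μ : Measure (Space N))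
    {u : ℕ → ℝ → Space N → ℝ≥0∞} (hu : ∀ n, Measurable fun z : ℝ × Space N => u n z.1 z.2)
    (hmono : Monotone u) (t : ℝ) (x : Space N) :
    duhamel α p μ (fun s y => ⨆ n, u n s y) t x = ⨆ n, duhamel α p μ (u n) t x := by
  have hw := measurable_wrightDensity h0 h1
  rw [duhamel_eq (Measurable.iSup hu)]
  simp only [duhamel_eq (hu _)]
  rw [← ENNReal.add_iSup, ← ENNReal.mul_iSup]
  congr 2
  have hA : ∀ s θ, ∫⁻ y, (⨆ n, u n s y) ^ p *
      ENNReal.ofReal (heatKernel N ((t - s) ^ α * θ) (x - y)) =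
      ⨆ n, ∫⁻ y, u n s y ^ p * ENNReal.ofReal (heatKernel N ((t - s) ^ α * θ) (x - y)) := by
    intro s θ
    rw [← lintegral_iSup]
    · refine lintegral_congr fun y => ?_
      rw [← ENNReal.iSup_mul]
      congr 1
      exact (ENNReal.orderIsoRpow p hp).map_iSup _
    · intro n
      have : Measurable (u n s) := (hu n).comp measurable_prodMk_left
      fun_prop
    · intro m n hmn y
      dsimp only
      gcongr
      exact hmono hmn s y
  have hmonoA : ∀ s θ, Monotone fun n => ∫⁻ y, u n s y ^ p *
      ENNReal.ofReal (heatKernel N ((t - s) ^ α * θ) (x - y)) := by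
    intro s θ m n hmn
    refine lintegral_mono fun y => ?_
    gcongr
    exact hmono hmn s y
  have hB : ∀ s, ∫⁻ θ in Ioi (0 : ℝ), ENNReal.ofReal (θ * wrightDensity α θ) *
      ∫⁻ y, (⨆ n, u n s y) ^ p * ENNReal.ofReal (heatKernel N ((t - s) ^ α * θ) (x - y)) =
      ⨆ n, ∫⁻ θ in Ioi (0 : ℝ), ENNReal.ofReal (θ * wrightDensity α θ) *
        ∫⁻ y, u n s y ^ p * ENNReal.ofReal (heatKernel N ((t - s) ^ α * θ) (x - y)) := by
    intro s
    rw [← lintegral_iSup]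
    · refine lintegral_congr fun θ => ?_
      rw [hA, ENNReal.mul_iSup]
    · intro n
      have h := (measurable_duhamel_inner α p (hu n)).comp
        (by fun_prop : Measurable fun θ : ℝ => (((t, x), s), θ))
      simp only [Function.comp_def] at h
      fun_prop
    · intro m n hmn θ
      dsimp only
      gcongr
      exact hmono hmn s _
  rw [← lintegral_iSup]
  · refine lintegral_congr fun s => ?_
    rw [hB, ENNReal.mul_iSup]
  · intro n
    have h := (measurable_duhamel_middle (p := p) h0 h1 (hu n)).comp
      (by fun_prop : Measurable fun s : ℝ => ((t, x), s))
    simp only [Function.comp_def] at h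
    fun_prop
  · intro m n hmn s
    dsimp only
    gcongr
    exact hmono hmn s _

lemma picardLimit_eq_duhamel (h0 : 0 < α) (h1 : α < 1) (hp : 0 < p) (μ : Measure (Space N))
    [SFinite μ] (t : ℝ) (x : Space N) :
    picardLimit α p μ t x = duhamel α p μ (picardLimit α p μ) t x := by
  have h := duhamel_iSup h0 h1 hp μ (fun n => measurable_picard (p := p) h0 h1 μ n)
    (monotone_picard hp μ) t x
  unfold picardLimit at *
  rw [h]
  apply le_antisymm
  · refine iSup_le fun n => ?_
    exact (monotone_picard hp μ (Nat.le_succ n) t x).trans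
      (le_iSup (fun n => duhamel α p μ (picard α p μ n) t x) n)
  · exact iSup_le fun n => le_iSup (fun n => picard α p μ n t x) (n + 1)

/-- Starting from 0, induction keeps every iterate below a supersolution. Allowing ν ≥ μ makes
solutions for larger data supersolutions for smaller data. -/
lemma picardLimit_le_of_supersolution (hp : 0 < p) {μ ν : Measure (Space N)} (hμν : μ ≤ ν) {T : ℝ}
    {v : ℝ → Space N → ℝ≥0∞}
    (h : ∀ᵐ z : ℝ × Space N ∂(volume.restrict (Ioc 0 T ×ˢ univ)),
      duhamel α p ν v z.1 z.2 ≤ v z.1 z.2) :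
    ∀ᵐ z : ℝ × Space N ∂(volume.restrict (Ioc 0 T ×ˢ univ)),
      picardLimit α p μ z.1 z.2 ≤ v z.1 z.2 := by
  have key : ∀ n, ∀ᵐ z : ℝ × Space N ∂(volume.restrict (Ioc 0 T ×ˢ univ)),
      picard α p μ n z.1 z.2 ≤ v z.1 z.2 := by
    intro n
    induction n with
    | zero => exact Eventually.of_forall fun _ => zero_le
    | succ n ih =>
      filter_upwards [h, ae_restrict_mem (measurableSet_Ioc.prod MeasurableSet.univ)] with z hz hzT
      exact (duhamel_mono_ae hp hμν ih hzT.1.2 z.2).trans hz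
  filter_upwards [ae_all_iff.2 key] with z hz
  exact iSup_le hz

lemma isMinimalSolution_picardLimit (h0 : 0 < α) (h1 : α < 1) (hp : 0 < p) (μ : Measure (Space N))
    [SFinite μ] {T : ℝ}
    (h : ∀ᵐ z : ℝ × Space N ∂(volume.restrict (Ioc 0 T ×ˢ univ)),
      picardLimit α p μ z.1 z.2 < ∞) :
    IsMinimalSolution α p μ T (picardLimit α p μ) := by
  refine ⟨⟨(measurable_picardLimit h0 h1 μ).aemeasurable, ?_⟩, fun v hv => ?_⟩
  · filter_upwards [h] with z hz
    exact ⟨hz, picardLimit_eq_duhamel h0 h1 hp μ _ _⟩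
  · refine picardLimit_le_of_supersolution hp le_rfl ?_
    filter_upwards [hv.eq_duhamel] with z hz
    exact hz.2.ge

lemma IsSolution.picardLimit_lt_top (hp : 0 < p) {μ ν : Measure (Space N)} (hμν : μ ≤ ν) {T : ℝ}
    {v : ℝ → Space N → ℝ≥0∞} (hv : IsSolution α p ν T v) :
    ∀ᵐ z : ℝ × Space N ∂(volume.restrict (Ioc 0 T ×ˢ univ)), picardLimit α p μ z.1 z.2 < ∞ := by
  have hle : ∀ᵐ z : ℝ × Space N ∂(volume.restrict (Ioc 0 T ×ˢ univ)),
      duhamel α p ν v z.1 z.2 ≤ v z.1 z.2 := by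
    filter_upwards [hv.eq_duhamel] with z hz
    exact hz.2.ge
  filter_upwards [hv.eq_duhamel, picardLimit_le_of_supersolution hp hμν hle] with z hz hz2
  exact hz2.trans_lt hz.1

end TimeFractionalFujita

/-! ### Integral inequalities and smoothing estimates -/

namespace TimeFractionalFujita

/-- **Minkowski's integral inequality**, with `A z` a bound for the `L^p` norm of `g z`. -/
lemma lintegral_lintegral_rpow_le {Z X : Type*} [MeasurableSpace Z] [MeasurableSpace X]
    {ν : Measure Z} {μ : Measure X} [SFinite ν] [SFinite μ] {p : ℝ} (hp : 1 < p)
    {g : Z → X → ℝ≥0∞} (hg : Measurable (Function.uncurry g)) {A : Z → ℝ≥0∞} (hA : Measurable A)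
    (h : ∀ᵐ z ∂ν, A z ≠ 0 ∧ A z ≠ ∞ ∧ ∫⁻ x, g z x ^ p ∂μ ≤ A z ^ p) :
    ∫⁻ x, (∫⁻ z, g z x ∂ν) ^ p ∂μ ≤ (∫⁻ z, A z ∂ν) ^ p := by
  have hp0 : 0 < p := by linarith
  set q := p.conjExponent with hq
  have hpq : p.HolderConjugate q := Real.HolderConjugate.conjExponent hp
  have hq0 : 0 < q := hpq.symm.pos
  -- Hölder applied to g = (g/w)·w with w^q = A; after Tonelli, A^p w^(-p) = A, so the two factors
  -- recombine to (∫ A)^p.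
  set w : Z → ℝ≥0∞ := fun z => A z ^ (1 / q) with hw
  have hpt : ∀ x, (∫⁻ z, g z x ∂ν) ^ p ≤
      (∫⁻ z, g z x ^ p * (w z)⁻¹ ^ p ∂ν) * (∫⁻ z, A z ∂ν) ^ (p - 1) := by
    intro x
    have hgx : Measurable fun z => g z x := hg.comp (by fun_prop : Measurable fun z => (z, x))
    have h1 : ∫⁻ z, g z x ∂ν = ∫⁻ z, ((fun z => g z x * (w z)⁻¹) * w) z ∂ν := by
      refine lintegral_congr_ae ?_
      filter_upwards [h] with z hz
      have h0 : w z ≠ 0 := by simp [hw, hz.1, hz.2.1]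
      have ht : w z ≠ ∞ := by simp [hw, hz.1, hz.2.1]
      simp only [Pi.mul_apply]
      rw [mul_assoc, ENNReal.inv_mul_cancel h0 ht, mul_one]
    have h2 := ENNReal.lintegral_mul_le_Lp_mul_Lq ν hpq
      (f := fun z => g z x * (w z)⁻¹) (g := w) (by fun_prop) (by fun_prop)
    rw [← h1] at h2
    calc (∫⁻ z, g z x ∂ν) ^ p ≤ ((∫⁻ z, (g z x * (w z)⁻¹) ^ p ∂ν) ^ (1 / p) *
          (∫⁻ z, w z ^ q ∂ν) ^ (1 / q)) ^ p := by gcongr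
      _ = _ := by
          rw [ENNReal.mul_rpow_of_nonneg _ _ hp0.le, ← ENNReal.rpow_mul, ← ENNReal.rpow_mul,
            one_div_mul_cancel hp0.ne', ENNReal.rpow_one]
          congr 1
          · refine lintegral_congr fun z => ?_
            rw [ENNReal.mul_rpow_of_nonneg _ _ hp0.le]
          · congr 1
            · refine lintegral_congr fun z => ?_
              rw [hw, ← ENNReal.rpow_mul, one_div_mul_cancel hq0.ne', ENNReal.rpow_one]
            · rw [hq, Real.conjExponent]
              field_simp
  have hgm : Measurable fun y : X × Z => g y.2 y.1 := hg.comp measurable_swap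
  refine (lintegral_mono hpt).trans ?_
  rw [lintegral_mul_const _ (Measurable.lintegral_prod_right'
    (f := fun y : X × Z => g y.2 y.1 ^ p * (w y.2)⁻¹ ^ p) (by fun_prop)),
    lintegral_lintegral_swap (by
      have : Measurable fun y : X × Z => g y.2 y.1 ^ p * (w y.2)⁻¹ ^ p := by fun_prop
      exact this.aemeasurable)]
  have h3 : ∫⁻ z, ∫⁻ x, g z x ^ p * (w z)⁻¹ ^ p ∂μ ∂ν ≤ ∫⁻ z, A z ∂ν := by
    refine lintegral_mono_ae ?_
    filter_upwards [h] with z hz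
    have hgz : Measurable fun x => g z x := hg.comp (by fun_prop : Measurable fun x => (z, x))
    rw [lintegral_mul_const _ (by fun_prop)]
    refine (mul_le_mul_left hz.2.2 _).trans_eq ?_
    simp only [hw]
    rw [← ENNReal.rpow_neg_one, ← ENNReal.rpow_mul, ← ENNReal.rpow_mul, ← ENNReal.rpow_add _ _ hz.1 hz.2.1]
    have : p + 1 / q * (-1 * p) = 1 := by
      rw [hq, Real.conjExponent]
      have : p - 1 ≠ 0 := by linarith
      field_simp
      ring
    rw [this, ENNReal.rpow_one]
  calc _ ≤ (∫⁻ z, A z ∂ν) * (∫⁻ z, A z ∂ν) ^ (p - 1) := by gcongr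
    _ = _ := by
      nth_rewrite 1 [← ENNReal.rpow_one (∫⁻ z, A z ∂ν)]
      rw [← ENNReal.rpow_add_of_nonneg _ _ (by norm_num) (by linarith)]
      ring_nf

lemma lintegral_add_rpow_le {X : Type*} [MeasurableSpace X] {μ : Measure X} {p : ℝ} (hp : 1 < p)
    {f g : X → ℝ≥0∞} (hf : Measurable f) (hg : Measurable g) {A B : ℝ≥0∞}
    (hA : ∫⁻ x, f x ^ p ∂μ ≤ A ^ p) (hB : ∫⁻ x, g x ^ p ∂μ ≤ B ^ p) :
    ∫⁻ x, (f x + g x) ^ p ∂μ ≤ (A + B) ^ p := by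
  have hp0 : 0 < p := by linarith
  have h := ENNReal.lintegral_Lp_add_le hf.aemeasurable hg.aemeasurable (μ := μ) hp.le
  have key : ∀ {a b : ℝ≥0∞}, a ≤ b ^ p → a ^ (1 / p) ≤ b := by
    intro a b hab
    rw [one_div]
    exact (ENNReal.rpow_inv_le_iff hp0).2 hab
  have h2 := h.trans (add_le_add (key hA) (key hB))
  rw [one_div, ENNReal.rpow_inv_le_iff hp0] at h2
  exact h2

variable {N : ℕ} {α p : ℝ}

/-- The decay exponent `N (p - 1) / (2 p)` of the `L^p` norm of the heat kernel. -/
noncomputable def decayExponent (N : ℕ) (p : ℝ) : ℝ := (N : ℝ) * (p - 1) / (2 * p)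

lemma lintegral_heatFlow_rpow_le (hp : 1 < p) {σ : ℝ} (hσ : 0 < σ) (μ : Measure (Space N))
    [SFinite μ] : ∫⁻ x, heatFlow σ μ x ^ p ≤
      (ENNReal.ofReal (σ ^ (-decayExponent N p)) * μ univ) ^ p := by
  have h := lintegral_lintegral_rpow_le (ν := μ) (μ := volume) hp
    (g := fun y x : Space N => ENNReal.ofReal (heatKernel N σ (x - y)))
    (A := fun _ => ENNReal.ofReal (σ ^ (-decayExponent N p))) (by unfold Function.uncurry; fun_prop)
    measurable_const (Eventually.of_forall fun y => ⟨by simp; positivity, by simp,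
      lintegral_heatKernel_sub_rpow_le hσ hp y⟩)
  rwa [lintegral_const] at h

lemma measurable_heatFlow {β : Type*} [MeasurableSpace β] {f : β → ℝ} {g : β → Space N}
    (μ : Measure (Space N)) [SFinite μ] (hf : Measurable f) (hg : Measurable g) :
    Measurable fun b => heatFlow (f b) μ (g b) := by
  unfold heatFlow
  apply Measurable.lintegral_prod_right' (f := fun q : β × Space N =>
    ENNReal.ofReal (heatKernel N (f q.1) (g q.1 - q.2)))
  fun_prop

/-- L^1 to L^p smoothing, for `P_α` with weight `h_α` and for `S_α` with weight θ h_α: Minkowski in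
θ reduces it to the moment of order -γ. The bound m replaces the exact mass so that it can be taken
nonzero and finite. -/
lemma lintegral_mixture_rpow_le (hp : 1 < p) {t : ℝ} (ht : 0 < t) (μ : Measure (Space N))
    [SFinite μ] {m : ℝ≥0∞} (hm0 : m ≠ 0) (hm : m ≠ ∞) (hμ : μ univ ≤ m) {w : ℝ → ℝ}
    (hw : Measurable w) {C : ℝ}
    (hC : ∫⁻ θ in Ioi (0 : ℝ), ENNReal.ofReal (θ ^ (-decayExponent N p) * w θ) ≤ ENNReal.ofReal C) :
    ∫⁻ x, (∫⁻ θ in Ioi (0 : ℝ), ENNReal.ofReal (w θ) * heatFlow (t ^ α * θ) μ x) ^ p ≤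
      (ENNReal.ofReal (t ^ (-(α * decayExponent N p)) * C) * m) ^ p := by
  set γ := decayExponent N p with hγ
  have hwm : Measurable fun θ => ENNReal.ofReal (w θ) := by fun_prop
  obtain ⟨ν, hν⟩ : ∃ ν : Measure ℝ, ν =
    (volume.restrict (Ioi 0)).withDensity fun θ => ENNReal.ofReal (w θ) := ⟨_, rfl⟩
  have hνs : SFinite ν := by rw [hν]; infer_instance
  have hhf : Measurable fun z : ℝ × Space N => heatFlow (t ^ α * z.1) μ z.2 :=
    measurable_heatFlow μ (by fun_prop) (by fun_prop)
  have hAm : Measurable fun θ : ℝ => ENNReal.ofReal ((t ^ α * θ) ^ (-γ)) * m := by fun_prop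
  have h := lintegral_lintegral_rpow_le (ν := ν) (μ := volume) hp
    (g := fun θ x => heatFlow (t ^ α * θ) μ x)
    (A := fun θ => ENNReal.ofReal ((t ^ α * θ) ^ (-γ)) * m) hhf hAm (by
      rw [hν]
      refine (withDensity_absolutelyContinuous _ _).ae_le ?_
      refine (ae_restrict_iff' measurableSet_Ioi).2 (Eventually.of_forall fun θ hθ => ?_)
      have hθ' : (0 : ℝ) < θ := hθ
      have hpos : 0 < (t ^ α * θ) ^ (-γ) := by positivity
      refine ⟨mul_ne_zero (by simpa using hpos) hm0, ENNReal.mul_ne_top (by simp) hm, ?_⟩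
      refine (lintegral_heatFlow_rpow_le hp (by positivity) μ).trans ?_
      gcongr)
  have e : ∀ x, ∫⁻ θ, heatFlow (t ^ α * θ) μ x ∂ν =
      ∫⁻ θ in Ioi (0 : ℝ), ENNReal.ofReal (w θ) * heatFlow (t ^ α * θ) μ x := by
    intro x
    rw [hν, lintegral_withDensity_eq_lintegral_mul _ hwm
      (measurable_heatFlow μ (by fun_prop) (by fun_prop))]
    simp only [Pi.mul_apply]
  simp only [e] at h
  refine h.trans ?_
  gcongr
  rw [hν, lintegral_withDensity_eq_lintegral_mul _ hwm hAm]
  calc _ = ∫⁻ θ in Ioi (0 : ℝ), ENNReal.ofReal (t ^ (-(α * γ))) * m *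
        ENNReal.ofReal (θ ^ (-γ) * w θ) := by
        refine setLIntegral_congr_fun measurableSet_Ioi fun θ hθ => ?_
        have hθ' : (0 : ℝ) < θ := hθ
        simp only [Pi.mul_apply]
        rw [Real.mul_rpow (by positivity) hθ'.le, ← Real.rpow_mul ht.le, mul_neg,
          ENNReal.ofReal_mul (by positivity), ENNReal.ofReal_mul (by positivity)]
        ring
    _ = ENNReal.ofReal (t ^ (-(α * γ))) * m *
        ∫⁻ θ in Ioi (0 : ℝ), ENNReal.ofReal (θ ^ (-γ) * w θ) := lintegral_const_mul _ (by fun_prop)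
    _ ≤ ENNReal.ofReal (t ^ (-(α * γ))) * m * ENNReal.ofReal C := by gcongr
    _ = _ := by rw [ENNReal.ofReal_mul (by positivity)]; ring

lemma lintegral_Ioo_rpow {t r : ℝ} (ht : 0 < t) (hr : -1 < r) :
    ∫⁻ s in Ioo 0 t, ENNReal.ofReal (s ^ r) = ENNReal.ofReal (t ^ (r + 1) / (r + 1)) := by
  have hi : IntegrableOn (fun s : ℝ => s ^ r) (Ioo 0 t) :=
    (intervalIntegral.integrableOn_Ioo_rpow_iff ht).2 hr
  rw [← ofReal_integral_eq_lintegral_ofReal hi]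
  · rw [← integral_Ioc_eq_integral_Ioo, ← intervalIntegral.integral_of_le ht.le,
      integral_rpow (Or.inl hr), Real.zero_rpow (by linarith), sub_zero]
  · exact (ae_restrict_iff' measurableSet_Ioo).2
      (Eventually.of_forall fun s hs => Real.rpow_nonneg hs.1.le _)

lemma lintegral_Ioo_sub_rpow {t r : ℝ} (ht : 0 < t) (hr : -1 < r) :
    ∫⁻ s in Ioo 0 t, ENNReal.ofReal ((t - s) ^ r) = ENNReal.ofReal (t ^ (r + 1) / (r + 1)) := by
  rw [← lintegral_Ioo_rpow ht hr, ← lintegral_indicator measurableSet_Ioo,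
    ← lintegral_indicator measurableSet_Ioo, ← lintegral_sub_left_eq_self _ t]
  refine lintegral_congr fun s => ?_
  by_cases hs : s ∈ Ioo 0 t
  · rw [indicator_of_mem hs, indicator_of_mem (mem_Ioo.2 ⟨by linarith [hs.2], by linarith [hs.1]⟩), sub_sub_cancel]
  · rw [indicator_of_notMem hs, indicator_of_notMem]
    exact fun h => hs ⟨by linarith [h.2], by linarith [h.1]⟩

/-- A Beta integral, split at t/2 so that one factor is bounded on each half. -/
lemma lintegral_beta_le {t a b : ℝ} (ht : 0 < t) (ha : 0 < a) (ha1 : a ≤ 1) (hb0 : 0 ≤ b)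
    (hb : b < 1) :
    ∫⁻ s in Ioo 0 t, ENNReal.ofReal ((t - s) ^ (a - 1) * s ^ (-b)) ≤
      ENNReal.ofReal (t ^ (a - b) * (2 * (1 / (1 - b) + 1 / a))) := by
  have hpt : ∀ s ∈ Ioo 0 t, ENNReal.ofReal ((t - s) ^ (a - 1) * s ^ (-b)) ≤
      ENNReal.ofReal ((t / 2) ^ (a - 1)) * ENNReal.ofReal (s ^ (-b)) +
      ENNReal.ofReal ((t / 2) ^ (-b)) * ENNReal.ofReal ((t - s) ^ (a - 1)) := by
    rintro s ⟨hs0, hst⟩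
    rw [← ENNReal.ofReal_mul (by positivity), ← ENNReal.ofReal_mul (by positivity)]
    rcases le_total s (t / 2) with h | h
    · refine le_trans (ENNReal.ofReal_le_ofReal ?_) (le_add_of_nonneg_right zero_le)
      gcongr ?_ * _
      exact Real.rpow_le_rpow_of_nonpos (by positivity) (by linarith) (by linarith)
    · refine le_trans (ENNReal.ofReal_le_ofReal ?_) (le_add_of_nonneg_left zero_le)
      rw [mul_comm]
      have : 0 ≤ (t - s) ^ (a - 1) := Real.rpow_nonneg (by linarith) _
      gcongr ?_ * _
      exact Real.rpow_le_rpow_of_nonpos (by positivity) h (by linarith)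
  refine (setLIntegral_mono' measurableSet_Ioo hpt).trans ?_
  rw [lintegral_add_left (by fun_prop), lintegral_const_mul _ (by fun_prop),
    lintegral_const_mul _ (by fun_prop), lintegral_Ioo_rpow ht (by linarith),
    lintegral_Ioo_sub_rpow ht (by linarith), ← ENNReal.ofReal_mul (by positivity),
    ← ENNReal.ofReal_mul (by positivity), ← ENNReal.ofReal_add
      (mul_nonneg (by positivity) (div_nonneg (by positivity) (by linarith)))
      (mul_nonneg (by positivity) (div_nonneg (by positivity) (by linarith)))]
  refine ENNReal.ofReal_le_ofReal ?_
  have hb1 : 0 < 1 - b := by linarith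
  have e1 : (t / 2) ^ (a - 1) * t ^ (-b + 1) = 2 ^ (1 - a) * t ^ (a - b) := by
    have h : t ^ (a - b) = t ^ (a - 1) * t ^ (-b + 1) := by rw [← Real.rpow_add ht]; ring_nf
    rw [Real.div_rpow ht.le (by norm_num), show 1 - a = -(a - 1) by ring, Real.rpow_neg (by norm_num), h]
    ring
  have e2 : (t / 2) ^ (-b) * t ^ (a - 1 + 1) = 2 ^ b * t ^ (a - b) := by
    have h : t ^ (a - b) = t ^ (a - 1 + 1) * t ^ (-b) := by rw [← Real.rpow_add ht]; ring_nf
    rw [Real.div_rpow ht.le (by norm_num), Real.rpow_neg (by norm_num : (0 : ℝ) ≤ 2), div_inv_eq_mul, h]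
    ring
  have h2a : (2 : ℝ) ^ (1 - a) ≤ 2 := by
    conv_rhs => rw [← Real.rpow_one 2]
    exact Real.rpow_le_rpow_of_exponent_le (by norm_num) (by linarith)
  have h2b : (2 : ℝ) ^ b ≤ 2 := by
    conv_rhs => rw [← Real.rpow_one 2]
    exact Real.rpow_le_rpow_of_exponent_le (by norm_num) (by linarith)
  rw [← mul_div_assoc, ← mul_div_assoc, e1, e2, show -b + 1 = 1 - b by ring,
    show a - 1 + 1 = a by ring]
  calc _ ≤ 2 * t ^ (a - b) / (1 - b) + 2 * t ^ (a - b) / a := by gcongr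
    _ = _ := by ring

end TimeFractionalFujita

/-! ### Existence for small mass -/

namespace TimeFractionalFujita

variable {N : ℕ} {α p : ℝ}

lemma decayExponent_pos (hN : 1 ≤ N) (hp : 1 < p) : 0 < decayExponent N p := by
  have : (1 : ℝ) ≤ N := by exact_mod_cast hN
  unfold decayExponent
  have : 0 < p - 1 := by linarith
  positivity

lemma decayExponent_mul (hp : 1 < p) : decayExponent N p * p = N * (p - 1) / 2 := by
  unfold decayExponent
  field_simp

lemma decayExponent_lt_one (hp : 1 < p) (h : decayExponent N p * p ≤ 1) :
    decayExponent N p < 1 := by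
  by_contra hc
  push Not at hc
  nlinarith

lemma solutionOpS_withDensity {f : Space N → ℝ≥0∞} (hf : Measurable f) (t : ℝ) (x : Space N) :
    solutionOpS α t (volume.withDensity f) x = ∫⁻ θ in Ioi (0 : ℝ),
      ENNReal.ofReal (θ * wrightDensity α θ) *
        ∫⁻ y, f y * ENNReal.ofReal (heatKernel N (t ^ α * θ) (x - y)) := by
  simp only [solutionOpS, heatFlow_withDensity hf]

lemma measurable_solutionOpS_withDensity (h0 : 0 < α) (h1 : α < 1) {u : ℝ → Space N → ℝ≥0∞}
    (hu : Measurable fun z : ℝ × Space N => u z.1 z.2) (t : ℝ) :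
    Measurable fun z : ℝ × Space N =>
      solutionOpS α (t - z.1) (volume.withDensity fun y => u z.1 y ^ p) z.2 := by
  have e : ∀ s x, solutionOpS α (t - s) (volume.withDensity fun y => u s y ^ p) x =
      ∫⁻ θ in Ioi (0 : ℝ), ENNReal.ofReal (θ * wrightDensity α θ) *
        ∫⁻ y, u s y ^ p * ENNReal.ofReal (heatKernel N ((t - s) ^ α * θ) (x - y)) := by
    intro s x
    have : Measurable (u s) := hu.comp measurable_prodMk_left
    exact solutionOpS_withDensity (by fun_prop) _ _
  simp only [e]
  have h := (measurable_duhamel_middle (p := p) h0 h1 hu).comp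
    (by fun_prop : Measurable fun z : ℝ × Space N => ((t, z.2), z.1))
  simp only [Function.comp_def] at h
  exact h

/-- The total mass of u(s)^p dx is ‖u(s)‖_p^p, at most M^p s^(-αγp), and `S_α(t-s)` smooths it into
L^p at the cost (t-s)^(-αγ). Minkowski in s leaves a Beta integral, convergent since αγp < 1 even
when γp = 1. -/
lemma lintegral_duhamel_rpow_le (h0 : 0 < α) (h1 : α < 1) (hN : 1 ≤ N) (hp : 1 < p)
    (hγ : decayExponent N p * p ≤ 1) {t M : ℝ} (ht : 0 < t) (hM : 0 < M)
    {u : ℝ → Space N → ℝ≥0∞} (hu : Measurable fun z : ℝ × Space N => u z.1 z.2)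
    (h : ∀ s ∈ Ioo 0 t, ∫⁻ x, u s x ^ p ≤ ENNReal.ofReal (M * s ^ (-(α * decayExponent N p))) ^ p) :
    ∫⁻ x, (∫⁻ s in Ioo 0 t, ENNReal.ofReal ((t - s) ^ (α - 1)) *
      solutionOpS α (t - s) (volume.withDensity fun y => u s y ^ p) x) ^ p ≤
      ENNReal.ofReal (2 * M ^ p * (t ^ (α * (1 - decayExponent N p) - α * (decayExponent N p * p)) *
        (2 * (1 / (1 - α * (decayExponent N p * p)) + 1 / (α * (1 - decayExponent N p)))))) ^ p := by
  set γ := decayExponent N p with hγd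
  have hγ0 : 0 < γ := decayExponent_pos hN hp
  have hγ1 : γ < 1 := decayExponent_lt_one hp hγ
  have hp0 : 0 < p := by linarith
  have hwm := measurable_wrightDensity h0 h1
  have hS : ∀ s ∈ Ioo 0 t, ∫⁻ x, solutionOpS α (t - s) (volume.withDensity fun y => u s y ^ p) x ^ p ≤
      (ENNReal.ofReal ((t - s) ^ (-(α * γ)) * 2) * ENNReal.ofReal (M ^ p * s ^ (-(α * (γ * p))))) ^ p := by
    intro s hs
    have hs0 : 0 < s := hs.1
    refine lintegral_mixture_rpow_le (w := fun θ => θ * wrightDensity α θ) hp (sub_pos.2 hs.2) _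
      ?_ (by simp) ?_ (by fun_prop)
      (lintegral_rpow_one_sub_mul_wrightDensity_le h0 h1 hγ0 hγ1)
    · have : 0 < M ^ p * s ^ (-(α * (γ * p))) := by positivity
      simpa using this
    · rw [withDensity_apply _ MeasurableSet.univ, Measure.restrict_univ]
      refine (h s hs).trans_eq ?_
      rw [ENNReal.ofReal_rpow_of_nonneg (by positivity) hp0.le, Real.mul_rpow hM.le (by positivity),
        ← Real.rpow_mul hs0.le]
      ring_nf
  refine (lintegral_lintegral_rpow_le (ν := volume.restrict (Ioo 0 t)) (μ := volume) hp
    (g := fun s x => ENNReal.ofReal ((t - s) ^ (α - 1)) *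
      solutionOpS α (t - s) (volume.withDensity fun y => u s y ^ p) x)
    (A := fun s => ENNReal.ofReal ((t - s) ^ (α - 1)) * (ENNReal.ofReal ((t - s) ^ (-(α * γ)) * 2) *
      ENNReal.ofReal (M ^ p * s ^ (-(α * (γ * p)))))) ?_ (by fun_prop) ?_).trans ?_
  · have := measurable_solutionOpS_withDensity (p := p) h0 h1 hu t
    unfold Function.uncurry
    fun_prop
  · refine (ae_restrict_iff' measurableSet_Ioo).2 (Eventually.of_forall fun s hs => ?_)
    have hs0 : 0 < s := hs.1
    have hts : 0 < t - s := sub_pos.2 hs.2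
    refine ⟨?_, by finiteness, ?_⟩
    · have h1 : 0 < (t - s) ^ (α - 1) := by positivity
      have h2 : 0 < (t - s) ^ (-(α * γ)) * 2 := by positivity
      have h3 : 0 < M ^ p * s ^ (-(α * (γ * p))) := by positivity
      exact mul_ne_zero (ENNReal.ofReal_pos.2 h1).ne'
        (mul_ne_zero (ENNReal.ofReal_pos.2 h2).ne' (ENNReal.ofReal_pos.2 h3).ne')
    · have hSm := (measurable_solutionOpS_withDensity (p := p) h0 h1 hu t).comp
        (measurable_prodMk_left (x := s))
      simp only [Function.comp_def] at hSm
      simp only [ENNReal.mul_rpow_of_nonneg _ _ hp0.le]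
      rw [lintegral_const_mul _ (by fun_prop), ← ENNReal.mul_rpow_of_nonneg _ _ hp0.le]
      gcongr
      exact hS s hs
  · gcongr
    have e : ∀ s ∈ Ioo 0 t, ENNReal.ofReal ((t - s) ^ (α - 1)) *
        (ENNReal.ofReal ((t - s) ^ (-(α * γ)) * 2) * ENNReal.ofReal (M ^ p * s ^ (-(α * (γ * p))))) =
        ENNReal.ofReal (2 * M ^ p) *
          ENNReal.ofReal ((t - s) ^ (α * (1 - γ) - 1) * s ^ (-(α * (γ * p)))) := by
      intro s hs
      have hs0 : 0 < s := hs.1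
      have hts : 0 < t - s := sub_pos.2 hs.2
      rw [← ENNReal.ofReal_mul (by positivity), ← ENNReal.ofReal_mul (by positivity),
        ← ENNReal.ofReal_mul (by positivity), show α * (1 - γ) - 1 = (α - 1) + -(α * γ) by ring,
        Real.rpow_add hts]
      congr 1
      ring
    rw [setLIntegral_congr_fun measurableSet_Ioo e, lintegral_const_mul _ (by fun_prop)]
    exact (mul_le_mul' le_rfl (lintegral_beta_le ht (mul_pos h0 (by linarith)) (by nlinarith)
      (by positivity) (by nlinarith))).trans (ENNReal.ofReal_mul (by positivity)).ge

/-- If `κ ^ (p - 1) T ^ (α (1 - N (p - 1) / 2))` is small, the Picard iterates stay bounded in a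
weighted `L^p` norm. -/
lemma lintegral_picard_rpow_le (h0 : 0 < α) (h1 : α < 1) (hN : 1 ≤ N) (hp : 1 < p)
    (hγ : decayExponent N p * p ≤ 1) {κ T Γ : ℝ} (hκ : 0 < κ)
    (hΓ : Γ = Real.Gamma (1 - decayExponent N p))
    (hsmall : 2 * (2 * κ * Γ) ^ p * (T ^ (α * (1 - decayExponent N p * p)) *
        (2 * (1 / (1 - α * (decayExponent N p * p)) + 1 / (α * (1 - decayExponent N p))))) ≤ κ * Γ)
    (n : ℕ) {t : ℝ} (ht : t ∈ Ioc 0 T) :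
    ∫⁻ x, picard α p (diracMass N κ) n t x ^ p ≤
      ENNReal.ofReal (2 * κ * Γ * t ^ (-(α * decayExponent N p))) ^ p := by
  set γ := decayExponent N p with hγd
  have hγ0 : 0 < γ := decayExponent_pos hN hp
  have hγ1 : γ < 1 := decayExponent_lt_one hp hγ
  have hp0 : 0 < p := by linarith
  have hΓ0 : 0 < Γ := by rw [hΓ]; exact Real.Gamma_pos_of_pos (by linarith)
  have hfin : SFinite (diracMass N κ) := by unfold diracMass; infer_instance
  induction n generalizing t with
  | zero => simp [picard, hp0]
  | succ n ih =>
    have ht0 : 0 < t := ht.1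
    have hu := measurable_picard (p := p) h0 h1 (diracMass N κ) n
    have hP : ∫⁻ x, solutionOpP α t (diracMass N κ) x ^ p ≤
        ENNReal.ofReal (κ * Γ * t ^ (-(α * γ))) ^ p := by
      have h := lintegral_mixture_rpow_le (α := α) hp ht0 (diracMass N κ) (m := ENNReal.ofReal κ)
        (by simpa using hκ) (by simp) (by simp [diracMass]) (measurable_wrightDensity h0 h1)
        (lintegral_rpow_neg_mul_wrightDensity_le h0 h1 hγ0 hγ1)
      refine h.trans_eq ?_
      rw [← ENNReal.ofReal_mul (mul_nonneg (by positivity) (hΓ ▸ hΓ0.le)), ← hΓ]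
      congr 2
      ring
    have hD := lintegral_duhamel_rpow_le h0 h1 hN hp hγ ht0 (by positivity : 0 < 2 * κ * Γ) hu
      (fun s hs => ih ⟨hs.1, hs.2.le.trans ht.2⟩)
    set D : Space N → ℝ≥0∞ := fun x => ∫⁻ s in Ioo 0 t, ENNReal.ofReal ((t - s) ^ (α - 1)) *
      solutionOpS α (t - s) (volume.withDensity fun y => picard α p (diracMass N κ) n s y ^ p) x with hDd
    have hPm := (measurable_solutionOpP h0 h1 (diracMass N κ)).comp (measurable_prodMk_left (x := t))
    simp only [Function.comp_def] at hPm
    have hDm : Measurable D := by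
      have := measurable_solutionOpS_withDensity (p := p) h0 h1 hu t
      apply Measurable.lintegral_prod_left' (f := fun z : ℝ × Space N =>
        ENNReal.ofReal ((t - z.1) ^ (α - 1)) * solutionOpS α (t - z.1)
          (volume.withDensity fun y => picard α p (diracMass N κ) n z.1 y ^ p) z.2)
      fun_prop
    have hsum := lintegral_add_rpow_le hp hPm hDm hP hD
    calc ∫⁻ x, picard α p (diracMass N κ) (n + 1) t x ^ p
        ≤ ∫⁻ x, (solutionOpP α t (diracMass N κ) x + D x) ^ p := by
          refine lintegral_mono fun x => ?_
          simp only [picard, duhamel]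
          gcongr
          -- The prefactor α of the Duhamel term is at most 1 and is dropped.
          refine mul_le_of_le_one_left zero_le ?_
          exact ENNReal.ofReal_le_one.2 h1.le
      _ ≤ _ := hsum
      _ ≤ _ := by
          have hb : α * (γ * p) < 1 := by nlinarith
          have hK : 0 ≤ 2 * (1 / (1 - α * (γ * p)) + 1 / (α * (1 - γ))) := by
            have : 0 < 1 - α * (γ * p) := by linarith
            have : 0 < α * (1 - γ) := mul_pos h0 (by linarith)
            positivity
          set K := 2 * (1 / (1 - α * (γ * p)) + 1 / (α * (1 - γ))) with hKd
          rw [← ENNReal.ofReal_add (by positivity) (by positivity)]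
          gcongr
          -- The Duhamel term has the decay t^(-αγ) of the free part times a power of t that is
          -- largest at T, so smallness at T closes the induction with the factor 2.
          have e : t ^ (α * (1 - γ) - α * (γ * p)) = t ^ (α * (1 - γ * p)) * t ^ (-(α * γ)) := by
            rw [← Real.rpow_add ht0]
            ring_nf
          have hle : t ^ (α * (1 - γ * p)) ≤ T ^ (α * (1 - γ * p)) :=
            Real.rpow_le_rpow ht0.le ht.2 (mul_nonneg h0.le (by linarith))
          rw [e]
          calc _ = κ * Γ * t ^ (-(α * γ)) +
                (2 * (2 * κ * Γ) ^ p * (t ^ (α * (1 - γ * p)) * K)) * t ^ (-(α * γ)) := by ring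
            _ ≤ κ * Γ * t ^ (-(α * γ)) +
                (2 * (2 * κ * Γ) ^ p * (T ^ (α * (1 - γ * p)) * K)) * t ^ (-(α * γ)) := by gcongr
            _ ≤ κ * Γ * t ^ (-(α * γ)) + κ * Γ * t ^ (-(α * γ)) := by gcongr
            _ = _ := by ring

/-- Monotone convergence carries the L^p bound to the limit at each fixed time, and a function with
finite L^p norm is finite almost everywhere. -/
lemma picardLimit_lt_top_of_small (h0 : 0 < α) (h1 : α < 1) (hN : 1 ≤ N) (hp : 1 < p)
    (hγ : decayExponent N p * p ≤ 1) {κ T Γ : ℝ} (hκ : 0 < κ)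
    (hΓ : Γ = Real.Gamma (1 - decayExponent N p))
    (hsmall : 2 * (2 * κ * Γ) ^ p * (T ^ (α * (1 - decayExponent N p * p)) *
        (2 * (1 / (1 - α * (decayExponent N p * p)) + 1 / (α * (1 - decayExponent N p))))) ≤ κ * Γ) :
    ∀ᵐ z : ℝ × Space N ∂(volume.restrict (Ioc 0 T ×ˢ univ)),
      picardLimit α p (diracMass N κ) z.1 z.2 < ∞ := by
  have hp0 : 0 < p := by linarith
  have hfin : SFinite (diracMass N κ) := by unfold diracMass; infer_instance
  have hm := measurable_picardLimit (p := p) h0 h1 (diracMass N κ)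
  rw [restrict_Ioc_prod_univ, Measure.ae_prod_iff_ae_ae (measurableSet_lt hm measurable_const)]
  refine (ae_restrict_iff' measurableSet_Ioc).2 (Eventually.of_forall fun t ht => ?_)
  have hmt : Measurable fun x => picardLimit α p (diracMass N κ) t x :=
    hm.comp (measurable_prodMk_left (x := t))
  have hle : ∫⁻ x, picardLimit α p (diracMass N κ) t x ^ p ≤
      ENNReal.ofReal (2 * κ * Γ * t ^ (-(α * decayExponent N p))) ^ p := by
    have e : ∀ x, picardLimit α p (diracMass N κ) t x ^ p =
        ⨆ n, picard α p (diracMass N κ) n t x ^ p :=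
      fun x => (ENNReal.orderIsoRpow p hp0).map_iSup _
    simp only [e]
    rw [lintegral_iSup]
    · exact iSup_le fun n => lintegral_picard_rpow_le h0 h1 hN hp hγ hκ hΓ hsmall n ht
    · intro n
      have : Measurable fun x => picard α p (diracMass N κ) n t x :=
        (measurable_picard h0 h1 (diracMass N κ) n).comp (measurable_prodMk_left (x := t))
      fun_prop
    · intro m n hmn x
      dsimp only
      gcongr
      exact monotone_picard hp0 _ hmn t x
  have hne : ∫⁻ x, picardLimit α p (diracMass N κ) t x ^ p ≠ ∞ := by
    refine ne_top_of_le_ne_top ?_ hle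
    finiteness
  filter_upwards [ae_lt_top (by fun_prop) hne] with x hx
  exact (ENNReal.rpow_lt_top_iff_of_pos hp0).1 hx

end TimeFractionalFujita

/-! ### Blow-up of weighted masses -/

namespace TimeFractionalFujita

/-- A discrete Gronwall-type blow-up argument by doubling. -/
lemma ae_eq_top_of_superlinear {p A b T : ℝ} (hp : 1 < p) (hA : 0 < A) (hb : 0 < b)
    {I : ℝ → ℝ≥0∞}
    (h : ∀ t ∈ Ioc 0 T, (ENNReal.ofReal A + ENNReal.ofReal b * ∫⁻ s in Ioo 0 t, I s) ^ p ≤ I t)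
    (hS : 2 * A ^ (1 - p) / b * (1 - 2 ^ (1 - p))⁻¹ ≤ T / 2) :
    ∀ t ∈ Ioc (T / 2) T, I t = ∞ := by
  have hp0 : 0 < p := by linarith
  set r : ℝ := 2 ^ (1 - p) with hr
  have hr0 : 0 < r := by positivity
  have hr1 : r < 1 := Real.rpow_lt_one_of_one_lt_of_neg (by norm_num) (by linarith)
  set d : ℝ := 2 * A ^ (1 - p) / b with hd
  have hd0 : 0 < d := by positivity
  -- Doubling times: past τ_n, I is at least (2^n A)^p. The step d r^n is just long enough for b
  -- times the integral of this bound to reach 2^(n+1) A, and since r < 1 the steps sum to at most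
  -- T/2.
  set τ : ℕ → ℝ := fun n => ∑ k ∈ Finset.range n, d * r ^ k with hτ
  have hτ0 : ∀ n, 0 ≤ τ n := fun n => Finset.sum_nonneg fun k _ => by positivity
  have hτs : ∀ n, τ (n + 1) = τ n + d * r ^ n := fun n => Finset.sum_range_succ _ _
  have hτT : ∀ n, τ n ≤ T / 2 := by
    intro n
    refine le_trans ?_ hS
    have hg := (hasSum_geometric_of_lt_one hr0.le hr1).mul_left d
    exact sum_le_hasSum _ (fun k _ => by positivity) hg
  have key : ∀ n, ∀ t ∈ Ioc 0 T, τ n < t → ENNReal.ofReal (2 ^ n * A) ^ p ≤ I t := by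
    intro n
    induction n with
    | zero =>
      intro t ht _
      refine le_trans ?_ (h t ht)
      gcongr
      simp
    | succ n ih =>
      intro t ht hτt
      refine le_trans ?_ (h t ht)
      gcongr
      refine le_trans ?_ (le_add_of_nonneg_left zero_le)
      have hsub : Ioo (τ n) (τ (n + 1)) ⊆ Ioo 0 t :=
        fun s hs => ⟨(hτ0 n).trans_lt hs.1, hs.2.trans hτt⟩
      have h1 : ∫⁻ _ in Ioo (τ n) (τ (n + 1)), ENNReal.ofReal (2 ^ n * A) ^ p ≤
          ∫⁻ s in Ioo 0 t, I s := by
        refine le_trans ?_ (lintegral_mono_set hsub)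
        refine setLIntegral_mono' measurableSet_Ioo fun s hs => ?_
        exact ih s ⟨(hsub hs).1, (hsub hs).2.le.trans ht.2⟩ hs.1
      rw [setLIntegral_const, Real.volume_Ioo, hτs, add_sub_cancel_left,
        ENNReal.ofReal_rpow_of_nonneg (by positivity) hp0.le,
        ← ENNReal.ofReal_mul (by positivity)] at h1
      calc ENNReal.ofReal (2 ^ (n + 1) * A)
          = ENNReal.ofReal b * ENNReal.ofReal ((2 ^ n * A) ^ p * (d * r ^ n)) := by
            rw [← ENNReal.ofReal_mul hb.le]
            congr 1
            have e1 : A ^ p * A ^ (1 - p) = A := by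
              rw [← Real.rpow_add hA]; simp
            have e2 : ((2 : ℝ) ^ n) ^ p * r ^ n = 2 ^ n := by
              rw [hr, ← Real.rpow_natCast, ← Real.rpow_natCast, ← Real.rpow_mul (by norm_num),
                ← Real.rpow_mul (by norm_num), ← Real.rpow_add (by norm_num)]
              ring_nf
            rw [Real.mul_rpow (by positivity) hA.le, hd]
            calc _ = 2 * (((2 : ℝ) ^ n) ^ p * r ^ n) * (A ^ p * A ^ (1 - p)) := by
                  rw [e1, e2]; ring
              _ = _ := by field_simp
        _ ≤ _ := by gcongr
  intro t ht
  have ht' : t ∈ Ioc 0 T := ⟨lt_of_le_of_lt ((hτ0 0).trans (hτT 0)) ht.1, ht.2⟩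
  refine ENNReal.eq_top_of_forall_nnreal_le fun R => ?_
  have hlim : Tendsto (fun n : ℕ => ((2 : ℝ) ^ n * A) ^ p) atTop atTop :=
    (tendsto_rpow_atTop hp0).comp ((tendsto_pow_atTop_atTop_of_one_lt (by norm_num)).atTop_mul_const hA)
  obtain ⟨n, hn⟩ := (hlim.eventually_ge_atTop (R : ℝ)).exists
  refine le_trans ?_ (key n t ht' ((hτT n).trans_lt ht.1))
  rw [ENNReal.ofReal_rpow_of_nonneg (by positivity) hp0.le]
  exact ENNReal.le_ofReal_iff_toReal_le (by simp) (by positivity) |>.2 (by simpa using hn)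

variable {N : ℕ} {α p : ℝ}

lemma lintegral_mul_mixture {X : Type*} [MeasurableSpace X] {μ : Measure X} [SFinite μ]
    {ν : Measure ℝ} [SFinite ν] {f : X → ℝ≥0∞} (hf : Measurable f) {w : ℝ → ℝ≥0∞}
    (hw : Measurable w) {k : ℝ → X → ℝ≥0∞} (hk : Measurable fun z : ℝ × X => k z.1 z.2) :
    ∫⁻ x, f x * ∫⁻ θ, w θ * k θ x ∂ν ∂μ = ∫⁻ θ, w θ * ∫⁻ x, f x * k θ x ∂μ ∂ν := by
  have hk' : Measurable fun z : X × ℝ => k z.2 z.1 := hk.comp measurable_swap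
  have h1 : ∀ x, f x * ∫⁻ θ, w θ * k θ x ∂ν = ∫⁻ θ, f x * (w θ * k θ x) ∂ν := by
    intro x
    have hkx := hk.comp (measurable_prodMk_right (y := x))
    simp only [Function.comp_def] at hkx
    rw [lintegral_const_mul _ (by fun_prop)]
  have h2 : ∀ θ, w θ * ∫⁻ x, f x * k θ x ∂μ = ∫⁻ x, w θ * (f x * k θ x) ∂μ := by
    intro θ
    have hkx := hk.comp (measurable_prodMk_left (x := θ))
    simp only [Function.comp_def] at hkx
    rw [lintegral_const_mul _ (by fun_prop)]
  simp only [h1, h2]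
  rw [lintegral_lintegral_swap]
  · exact lintegral_congr fun θ => lintegral_congr fun x => by ring
  · have : Measurable fun z : X × ℝ => f z.1 * (w z.2 * k z.2 z.1) := by fun_prop
    exact this.aemeasurable

/-- Jensen's inequality: the heat kernel is a probability density. -/
lemma lintegral_heatKernel_mul_rpow_le (hp : 1 < p) {ρ : ℝ} (hρ : 0 < ρ) {f : Space N → ℝ≥0∞}
    (hf : Measurable f) :
    (∫⁻ x, ENNReal.ofReal (heatKernel N ρ x) * f x) ^ p ≤
      ∫⁻ x, f x ^ p * ENNReal.ofReal (heatKernel N ρ x) := by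
  have hp0 : 0 < p := by linarith
  have hpq : p.HolderConjugate p.conjExponent := Real.HolderConjugate.conjExponent hp
  have hG : Measurable fun x : Space N => ENNReal.ofReal (heatKernel N ρ x) := by fun_prop
  have h := ENNReal.lintegral_mul_le_Lp_mul_Lq
    (volume.withDensity fun x : Space N => ENNReal.ofReal (heatKernel N ρ x)) hpq
    hf.aemeasurable (g := fun _ => 1) aemeasurable_const
  simp only [ENNReal.one_rpow, lintegral_one, Pi.mul_apply, mul_one] at h
  rw [lintegral_withDensity_eq_lintegral_mul _ hG hf,
    lintegral_withDensity_eq_lintegral_mul _ hG (by fun_prop),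
    withDensity_apply _ MeasurableSet.univ, Measure.restrict_univ, lintegral_heatKernel hρ,
    ENNReal.one_rpow, mul_one, one_div, ENNReal.le_rpow_inv_iff hp0] at h
  simp only [Pi.mul_apply] at h
  simpa only [mul_comm] using h

/-- The width of the Gaussian weight used on `[0, T]`. -/
noncomputable def testTime (α T : ℝ) : ℝ := T ^ α / 2048

lemma testTime_pos {T : ℝ} (hT : 0 < T) : 0 < testTime α T := by
  unfold testTime
  positivity

/-- By the semigroup property the tested free evolution averages κ G(ρ + t^α θ, 0) over θ. For θ ≤
64 the kernel time is at most 65 T^α, and the interval [1/256, 64] has weight at least 1/64. -/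
lemma lintegral_heatKernel_mul_solutionOpP (h0 : 0 < α) (h1 : α < 1) {T t κ : ℝ} (hκ : 0 < κ)
    (ht : t ∈ Ioc 0 T) :
    ENNReal.ofReal (κ * (1 / 64 * (1 / (4 * Real.pi * (65 * T ^ α)) ^ ((N : ℝ) / 2)))) ≤
      ∫⁻ x, ENNReal.ofReal (heatKernel N (testTime α T) x) *
        solutionOpP α t (diracMass N κ) x := by
  have hpi := Real.pi_pos
  have ht0 : 0 < t := ht.1
  have hT : 0 < T := ht.1.trans_le ht.2
  have hρ := testTime_pos (α := α) hT
  have hfin : SFinite (diracMass N κ) := by unfold diracMass; infer_instance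
  have hwm := measurable_wrightDensity h0 h1
  have htT : t ^ α ≤ T ^ α := Real.rpow_le_rpow ht0.le ht.2 h0.le
  unfold solutionOpP
  rw [lintegral_mul_mixture (by fun_prop) (by fun_prop)
    (measurable_heatFlow _ (by fun_prop) (by fun_prop))]
  have hsub : Icc (1 / 256 : ℝ) 64 ⊆ Ioi 0 := fun θ hθ => mem_Ioi.2 (by linarith [hθ.1])
  refine le_trans ?_ (lintegral_mono_set hsub)
  set c : ℝ := 1 / (4 * Real.pi * (65 * T ^ α)) ^ ((N : ℝ) / 2) with hc
  have hpt : ∀ θ ∈ Icc (1 / 256 : ℝ) 64, ENNReal.ofReal (wrightDensity α θ) * ENNReal.ofReal (κ * c) ≤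
      ENNReal.ofReal (wrightDensity α θ) * ∫⁻ x, ENNReal.ofReal (heatKernel N (testTime α T) x) *
        heatFlow (t ^ α * θ) (diracMass N κ) x := by
    intro θ hθ
    have hθ0 : 0 < θ := hsub hθ
    gcongr
    rw [lintegral_heatFlow_mul_heatKernel hρ (by positivity), diracMass, lintegral_smul_measure,
      lintegral_dirac, smul_eq_mul, ← ENNReal.ofReal_mul hκ.le]
    refine ENNReal.ofReal_le_ofReal ?_
    gcongr
    rw [hc, heatKernel]
    simp only [norm_zero, ne_eq, OfNat.ofNat_ne_zero, not_false_eq_true, zero_pow, neg_zero, zero_div,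
      Real.exp_zero, mul_one]
    have hle : testTime α T + t ^ α * θ ≤ 65 * T ^ α := by
      have h2 : t ^ α * θ ≤ T ^ α * 64 := by
        have := hθ.2
        gcongr
      have h3 : 0 < T ^ α := by positivity
      unfold testTime
      linarith
    have : 0 < testTime α T + t ^ α * θ := by positivity
    gcongr
  refine le_trans ?_ (setLIntegral_mono' measurableSet_Icc hpt)
  rw [lintegral_mul_const _ (by fun_prop)]
  calc ENNReal.ofReal (κ * (1 / 64 * c)) = ENNReal.ofReal (1 / 64) * ENNReal.ofReal (κ * c) := by
        rw [← ENNReal.ofReal_mul (by norm_num)]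
        ring_nf
    _ ≤ _ := by
        gcongr
        exact le_lintegral_wrightDensity_Icc h0 h1

lemma le_lintegral_id_mul_wrightDensity_Icc (h0 : 0 < α) (h1 : α < 1) :
    ENNReal.ofReal (1 / 16384) ≤
      ∫⁻ θ in Icc (1 / 256 : ℝ) 64, ENNReal.ofReal (θ * wrightDensity α θ) := by
  have hwm := measurable_wrightDensity h0 h1
  calc ENNReal.ofReal (1 / 16384) = ENNReal.ofReal (1 / 256) * ENNReal.ofReal (1 / 64) := by
        rw [← ENNReal.ofReal_mul (by norm_num)]
        norm_num
    _ ≤ ENNReal.ofReal (1 / 256) *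
        ∫⁻ θ in Icc (1 / 256 : ℝ) 64, ENNReal.ofReal (wrightDensity α θ) := by
        gcongr
        exact le_lintegral_wrightDensity_Icc h0 h1
    _ = ∫⁻ θ in Icc (1 / 256 : ℝ) 64, ENNReal.ofReal (1 / 256) * ENNReal.ofReal (wrightDensity α θ) :=
        (lintegral_const_mul _ (by fun_prop)).symm
    _ ≤ _ := by
        refine setLIntegral_mono' measurableSet_Icc fun θ hθ => ?_
        have hθ0 : 0 < θ := by linarith [hθ.1]
        rw [← ENNReal.ofReal_mul (by norm_num)]
        have := wrightDensity_nonneg h0 h1 hθ0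
        have := hθ.1
        gcongr

/-- The semigroup property moves the evolution onto the Gaussian weight, whose time grows at most
from T^α/2048 to 65 T^α; by `mul_heatKernel_le_heatKernel_add` this costs only a constant factor. -/
lemma lintegral_heatKernel_mul_solutionOpS (h0 : 0 < α) (h1 : α < 1) {T t : ℝ}
    (ht : t ∈ Ioc 0 T) (μ : Measure (Space N)) [SFinite μ] :
    ENNReal.ofReal (1 / 16384 * (1 / (2048 * 65)) ^ ((N : ℝ) / 2)) *
      ∫⁻ x, ENNReal.ofReal (heatKernel N (testTime α T) x) ∂μ ≤
      ∫⁻ x, ENNReal.ofReal (heatKernel N (testTime α T) x) * solutionOpS α t μ x := by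
  have ht0 : 0 < t := ht.1
  have hT : 0 < T := ht.1.trans_le ht.2
  have hρ := testTime_pos (α := α) hT
  have hwm := measurable_wrightDensity h0 h1
  have htT : t ^ α ≤ T ^ α := Real.rpow_le_rpow ht0.le ht.2 h0.le
  unfold solutionOpS
  rw [lintegral_mul_mixture (by fun_prop) (by fun_prop)
    (measurable_heatFlow _ (by fun_prop) (by fun_prop))]
  have hsub : Icc (1 / 256 : ℝ) 64 ⊆ Ioi 0 := fun θ hθ => mem_Ioi.2 (by linarith [hθ.1])
  refine le_trans ?_ (lintegral_mono_set hsub)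
  set J := ∫⁻ x, ENNReal.ofReal (heatKernel N (testTime α T) x) ∂μ with hJ
  set c : ℝ := (1 / (2048 * 65)) ^ ((N : ℝ) / 2) with hc
  have hc0 : 0 ≤ c := by positivity
  have hpt : ∀ θ ∈ Icc (1 / 256 : ℝ) 64,
      ENNReal.ofReal (θ * wrightDensity α θ) * (ENNReal.ofReal c * J) ≤
      ENNReal.ofReal (θ * wrightDensity α θ) *
        ∫⁻ x, ENNReal.ofReal (heatKernel N (testTime α T) x) * heatFlow (t ^ α * θ) μ x := by
    intro θ hθ
    have hθ0 : 0 < θ := hsub hθ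
    gcongr
    rw [lintegral_heatFlow_mul_heatKernel hρ (by positivity), hJ,
      ← lintegral_const_mul _ (by fun_prop)]
    refine lintegral_mono fun y => ?_
    rw [← ENNReal.ofReal_mul hc0]
    refine ENNReal.ofReal_le_ofReal (le_trans ?_ (mul_heatKernel_le_heatKernel_add hρ (by positivity) y))
    have hle : testTime α T + t ^ α * θ ≤ 65 * T ^ α := by
      have h2 : t ^ α * θ ≤ T ^ α * 64 := by
        have := hθ.2
        gcongr
      have h3 : 0 < T ^ α := by positivity
      unfold testTime
      linarith
    have hpos : 0 < testTime α T + t ^ α * θ := by positivity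
    have hG := (heatKernel_pos hρ y).le
    have hq : 1 / (2048 * 65) ≤ testTime α T / (testTime α T + t ^ α * θ) := by
      rw [div_le_div_iff₀ (by norm_num) hpos]
      unfold testTime at hle ⊢
      linarith
    exact mul_le_mul_of_nonneg_right (Real.rpow_le_rpow (by positivity) hq (by positivity)) hG
  refine le_trans ?_ (setLIntegral_mono' measurableSet_Icc hpt)
  rw [lintegral_mul_const _ (by fun_prop), ENNReal.ofReal_mul (by norm_num), mul_assoc]
  gcongr
  exact le_lintegral_id_mul_wrightDensity_Icc h0 h1

lemma solutionOpS_eq_top (h0 : 0 < α) (h1 : α < 1) {T t : ℝ} (hT : 0 < T) (ht : T / 4 ≤ t)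
    (μ : Measure (Space N)) (hμ : ∫⁻ x, ENNReal.ofReal (heatKernel N (testTime α T) x) ∂μ = ∞)
    (x : Space N) : solutionOpS α t μ x = ∞ := by
  have ht0 : 0 < t := by linarith
  have hρ := testTime_pos (α := α) hT
  have hwm := measurable_wrightDensity h0 h1
  have hsub : Icc (1 / 256 : ℝ) 64 ⊆ Ioi 0 := fun θ hθ => mem_Ioi.2 (by linarith [hθ.1])
  have htop : ∀ θ ∈ Icc (1 / 256 : ℝ) 64, heatFlow (t ^ α * θ) μ x = ∞ := by
    intro θ hθ
    have hθ0 : 0 < θ := hsub hθ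
    -- This fixes the divisor 2048 of `testTime`: t ≥ T/4 and θ ≥ 1/256 give t^α θ ≥ T^α/1024.
    have hσ : 2 * testTime α T ≤ t ^ α * θ := by
      have h2 : T ^ α / 4 ≤ t ^ α := by
        calc T ^ α / 4 ≤ T ^ α / 4 ^ α := by
              gcongr
              conv_rhs => rw [← Real.rpow_one 4]
              exact Real.rpow_le_rpow_of_exponent_le (by norm_num) h1.le
          _ = (T / 4) ^ α := (Real.div_rpow hT.le (by norm_num) α).symm
          _ ≤ t ^ α := Real.rpow_le_rpow (by positivity) ht h0.le
      have h3 : T ^ α / 4 * (1 / 256) ≤ t ^ α * θ := by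
        have := hθ.1
        gcongr
      unfold testTime
      linarith
    set C : ℝ := (t ^ α * θ / testTime α T) ^ ((N : ℝ) / 2) *
      Real.exp (‖x‖ ^ 2 / (2 * (t ^ α * θ))) with hC
    have hC0 : 0 ≤ C := by positivity
    have hle : ∫⁻ y, ENNReal.ofReal (heatKernel N (testTime α T) y) ∂μ ≤
        ENNReal.ofReal C * heatFlow (t ^ α * θ) μ x := by
      rw [heatFlow, ← lintegral_const_mul _ (by fun_prop)]
      refine lintegral_mono fun y => ?_
      rw [← ENNReal.ofReal_mul hC0]
      exact ENNReal.ofReal_le_ofReal (heatKernel_le_mul_heatKernel_sub hρ hσ x y)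
    rw [hμ, top_le_iff] at hle
    by_contra hne
    exact ENNReal.mul_ne_top (by simp) hne hle
  unfold solutionOpS
  rw [eq_top_iff]
  refine le_trans ?_ (lintegral_mono_set hsub)
  have e : ∫⁻ θ in Icc (1 / 256 : ℝ) 64, ENNReal.ofReal (θ * wrightDensity α θ) *
      heatFlow (t ^ α * θ) μ x = ∫⁻ θ in Icc (1 / 256 : ℝ) 64,
        ENNReal.ofReal (θ * wrightDensity α θ) * ∞ :=
    setLIntegral_congr_fun measurableSet_Icc fun θ hθ => by rw [htop θ hθ]
  rw [e, lintegral_mul_const _ (by fun_prop), ENNReal.mul_top]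
  refine ((ENNReal.ofReal_pos.2 (by norm_num)).trans_le
    (le_lintegral_id_mul_wrightDensity_Icc h0 h1)).ne'

end TimeFractionalFujita

/-! ### A necessary condition for existence -/

namespace TimeFractionalFujita

variable {N : ℕ} {α p : ℝ}

/-- The tested equation, with the time kernel bounded below by T^(α-1) because α < 1; this is the
input for `ae_eq_top_of_superlinear`. -/
lemma lintegral_heatKernel_mul_duhamel (h0 : 0 < α) (h1 : α < 1) {T t κ : ℝ} (hκ : 0 < κ)
    (ht : t ∈ Ioc 0 T) {u : ℝ → Space N → ℝ≥0∞}
    (hu : Measurable fun z : ℝ × Space N => u z.1 z.2) :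
    ENNReal.ofReal (κ * (1 / 64 * (1 / (4 * Real.pi * (65 * T ^ α)) ^ ((N : ℝ) / 2)))) +
      ENNReal.ofReal (α * T ^ (α - 1) * (1 / 16384 * (1 / (2048 * 65)) ^ ((N : ℝ) / 2))) *
        ∫⁻ s in Ioo 0 t, ∫⁻ x, u s x ^ p * ENNReal.ofReal (heatKernel N (testTime α T) x) ≤
      ∫⁻ x, ENNReal.ofReal (heatKernel N (testTime α T) x) *
        duhamel α p (diracMass N κ) u t x := by
  have ht0 : 0 < t := ht.1
  have hT : 0 < T := ht.1.trans_le ht.2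
  have hfin : SFinite (diracMass N κ) := by unfold diracMass; infer_instance
  have hPm := (measurable_solutionOpP h0 h1 (diracMass N κ)).comp (measurable_prodMk_left (x := t))
  simp only [Function.comp_def] at hPm
  have hSm := measurable_solutionOpS_withDensity (p := p) h0 h1 hu t
  have hDm : Measurable fun x => ∫⁻ s in Ioo 0 t, ENNReal.ofReal ((t - s) ^ (α - 1)) *
      solutionOpS α (t - s) (volume.withDensity fun y => u s y ^ p) x := by
    apply Measurable.lintegral_prod_left' (f := fun z : ℝ × Space N =>
      ENNReal.ofReal ((t - z.1) ^ (α - 1)) * solutionOpS α (t - z.1)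
        (volume.withDensity fun y => u z.1 y ^ p) z.2)
    fun_prop
  unfold duhamel
  simp only [mul_add]
  rw [lintegral_add_left (by fun_prop)]
  refine add_le_add (lintegral_heatKernel_mul_solutionOpP h0 h1 hκ ht) ?_
  simp only [mul_left_comm _ (ENNReal.ofReal α)]
  rw [lintegral_const_mul _ (by fun_prop), lintegral_mul_mixture (by fun_prop) (by fun_prop) hSm]
  set c : ℝ := 1 / 16384 * (1 / (2048 * 65)) ^ ((N : ℝ) / 2) with hc
  have hc0 : 0 ≤ c := by positivity
  set J : ℝ → ℝ≥0∞ :=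
    fun s => ∫⁻ x, u s x ^ p * ENNReal.ofReal (heatKernel N (testTime α T) x) with hJ
  have hJm : Measurable J := by
    apply Measurable.lintegral_prod_right' (f := fun z : ℝ × Space N =>
      u z.1 z.2 ^ p * ENNReal.ofReal (heatKernel N (testTime α T) z.2))
    fun_prop
  have hpt : ∀ s ∈ Ioo 0 t, ENNReal.ofReal (T ^ (α - 1) * c) * J s ≤
      ENNReal.ofReal ((t - s) ^ (α - 1)) * ∫⁻ x, ENNReal.ofReal (heatKernel N (testTime α T) x) *
        solutionOpS α (t - s) (volume.withDensity fun y => u s y ^ p) x := by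
    intro s hs
    have hus : Measurable (u s) := hu.comp measurable_prodMk_left
    have hts : 0 < t - s := sub_pos.2 hs.2
    rw [ENNReal.ofReal_mul (by positivity), mul_assoc]
    refine mul_le_mul' (ENNReal.ofReal_le_ofReal ?_) ?_
    · exact Real.rpow_le_rpow_of_nonpos hts (by linarith [hs.1, ht.2]) (by linarith)
    · refine le_trans (le_of_eq ?_) (lintegral_heatKernel_mul_solutionOpS h0 h1
        (⟨hts, by linarith [hs.1, ht.2]⟩ : t - s ∈ Ioc 0 T) _)
      rw [lintegral_withDensity_eq_lintegral_mul _ (by fun_prop) (by fun_prop)]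
      simp only [Pi.mul_apply, hJ, hc]
  calc _ = ENNReal.ofReal α * ∫⁻ s in Ioo 0 t, ENNReal.ofReal (T ^ (α - 1) * c) * J s := by
        rw [lintegral_const_mul _ hJm, mul_assoc α, ENNReal.ofReal_mul h0.le, mul_assoc]
    _ ≤ _ := by
        gcongr ENNReal.ofReal α * ?_
        exact setLIntegral_mono' measurableSet_Ioo hpt

/-- Existence on `[0, T]` forces an upper bound for the initial mass. -/
lemma mass_lt_of_picardLimit_lt_top (h0 : 0 < α) (h1 : α < 1) (hp : 1 < p) {κ T : ℝ} (hκ : 0 < κ)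
    (hT : 0 < T)
    (hfin : ∀ᵐ z : ℝ × Space N ∂(volume.restrict (Ioc 0 T ×ˢ univ)),
      picardLimit α p (diracMass N κ) z.1 z.2 < ∞) :
    T / 2 < 2 * (κ * (1 / 64 * (1 / (4 * Real.pi * (65 * T ^ α)) ^ ((N : ℝ) / 2)))) ^ (1 - p) /
      (α * T ^ (α - 1) * (1 / 16384 * (1 / (2048 * 65)) ^ ((N : ℝ) / 2))) *
        (1 - 2 ^ (1 - p))⁻¹ := by
  have hpi := Real.pi_pos
  have hp0 : 0 < p := by linarith
  have hsf : SFinite (diracMass N κ) := by unfold diracMass; infer_instance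
  by_contra hcon
  push Not at hcon
  set w := picardLimit α p (diracMass N κ) with hw
  have hwm : Measurable fun z : ℝ × Space N => w z.1 z.2 := measurable_picardLimit h0 h1 _
  have htop := ae_eq_top_of_superlinear hp (by positivity) (by positivity)
    (I := fun s => ∫⁻ x, w s x ^ p * ENNReal.ofReal (heatKernel N (testTime α T) x)) (fun t ht => by
      have hwt : Measurable (w t) := hwm.comp measurable_prodMk_left
      refine le_trans ?_ (lintegral_heatKernel_mul_rpow_le hp (testTime_pos hT) hwt)
      gcongr
      refine (lintegral_heatKernel_mul_duhamel h0 h1 hκ ht hwm).trans_eq ?_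
      refine lintegral_congr fun x => ?_
      rw [hw, ← picardLimit_eq_duhamel h0 h1 hp0]) hcon
  -- The weighted mass is infinite for s in (T/2, 5T/8), and t - s ≥ T/4 then spreads the infinity
  -- to every x.
  have hblow : ∀ t ∈ Ioc (7 * T / 8) T, ∀ x, w t x = ∞ := by
    intro t ht x
    rw [hw, picardLimit_eq_duhamel h0 h1 hp0, ← hw, duhamel, ENNReal.add_eq_top]
    right
    have hS : ∀ s ∈ Ioo (T / 2) (5 * T / 8), ENNReal.ofReal ((t - s) ^ (α - 1)) *
        solutionOpS α (t - s) (volume.withDensity fun y => w s y ^ p) x = ∞ := by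
      intro s hs
      have hts : T / 4 ≤ t - s := by linarith [ht.1, hs.2]
      have hts0 : 0 < t - s := by linarith
      have hws : Measurable (w s) := hwm.comp measurable_prodMk_left
      rw [solutionOpS_eq_top h0 h1 hT hts, ENNReal.mul_top]
      · exact (ENNReal.ofReal_pos.2 (by positivity)).ne'
      · rw [lintegral_withDensity_eq_lintegral_mul _ (by fun_prop) (by fun_prop)]
        exact htop s ⟨hs.1, by linarith [hs.2]⟩
    have hsub : Ioo (T / 2) (5 * T / 8) ⊆ Ioo 0 t :=
      fun s hs => ⟨by linarith [hs.1], by linarith [hs.2, ht.1]⟩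
    have hint : ∫⁻ s in Ioo 0 t, ENNReal.ofReal ((t - s) ^ (α - 1)) *
        solutionOpS α (t - s) (volume.withDensity fun y => w s y ^ p) x = ∞ := by
      rw [eq_top_iff]
      refine le_trans ?_ (lintegral_mono_set hsub)
      rw [setLIntegral_congr_fun measurableSet_Ioo hS, setLIntegral_const, Real.volume_Ioo,
        ENNReal.top_mul (ENNReal.ofReal_pos.2 (by linarith)).ne']
    rw [hint, ENNReal.mul_top (ENNReal.ofReal_pos.2 h0).ne']
  rw [restrict_Ioc_prod_univ] at hfin
  have h2 : ∀ᵐ t ∂(volume.restrict (Ioc (7 * T / 8) T)), ∀ᵐ x : Space N, w t x < ∞ :=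
    ae_restrict_of_ae_restrict_of_subset (Ioc_subset_Ioc_left (by linarith))
      (Measure.ae_ae_of_ae_prod hfin)
  have hne : volume.restrict (Ioc (7 * T / 8) T) ≠ 0 := by
    rw [Ne, Measure.restrict_eq_zero, Real.volume_Ioc]
    exact (ENNReal.ofReal_pos.2 (by linarith)).ne'
  have : (ae (volume.restrict (Ioc (7 * T / 8) T))).NeBot := ae_neBot.2 hne
  obtain ⟨t, ht1, ht2⟩ := (h2.and (ae_restrict_mem measurableSet_Ioc)).exists
  obtain ⟨x, hx⟩ := ht1.exists
  exact hx.ne (hblow t ht2 x)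

/-- The constant in the necessary condition for local existence. -/
noncomputable def massConst (N : ℕ) (p : ℝ) : ℝ :=
  4 / ((1 / 64 * (1 / (4 * Real.pi * 65) ^ ((N : ℝ) / 2))) ^ (p - 1) *
    (1 / 16384 * (1 / (2048 * 65)) ^ ((N : ℝ) / 2)) * (1 - 2 ^ (1 - p)))

lemma massConst_pos (N : ℕ) (hp : 1 < p) : 0 < massConst N p := by
  have hpi := Real.pi_pos
  have : (2 : ℝ) ^ (1 - p) < 1 := Real.rpow_lt_one_of_one_lt_of_neg (by norm_num) (by linarith)
  have : 0 < 1 - (2 : ℝ) ^ (1 - p) := by linarith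
  unfold massConst
  positivity

lemma mass_rpow_lt_of_picardLimit_lt_top (h0 : 0 < α) (h1 : α < 1) (hp : 1 < p) {κ T : ℝ}
    (hκ : 0 < κ) (hT : 0 < T)
    (hfin : ∀ᵐ z : ℝ × Space N ∂(volume.restrict (Ioc 0 T ×ˢ univ)),
      picardLimit α p (diracMass N κ) z.1 z.2 < ∞) :
    κ ^ (p - 1) * T ^ (α * (1 - decayExponent N p * p)) < massConst N p / α := by
  have hpi := Real.pi_pos
  have hr : (2 : ℝ) ^ (1 - p) < 1 := Real.rpow_lt_one_of_one_lt_of_neg (by norm_num) (by linarith)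
  have hr' : 0 < 1 - (2 : ℝ) ^ (1 - p) := by linarith
  have h := mass_lt_of_picardLimit_lt_top h0 h1 hp hκ hT hfin
  unfold massConst
  set c₂ : ℝ := 1 / 16384 * (1 / (2048 * 65)) ^ ((N : ℝ) / 2) with hc₂
  have hc₂0 : 0 < c₂ := by positivity
  set q : ℝ := 1 - 2 ^ (1 - p) with hq
  set c₁ : ℝ := 1 / 64 * (1 / (4 * Real.pi * 65) ^ ((N : ℝ) / 2)) with hc₁
  have hc₁0 : 0 < c₁ := by positivity
  have eA : κ * (1 / 64 * (1 / (4 * Real.pi * (65 * T ^ α)) ^ ((N : ℝ) / 2))) =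
      κ * c₁ * T ^ (-(α * (N / 2))) := by
    rw [← mul_assoc (4 * Real.pi), Real.mul_rpow (by positivity) (by positivity),
      ← Real.rpow_mul hT.le, hc₁, Real.rpow_neg hT.le]
    field_simp
  have hA0 : 0 < κ * c₁ * T ^ (-(α * (N / 2))) := by positivity
  have eA2 : (κ * c₁ * T ^ (-(α * (N / 2)))) ^ (p - 1) =
      κ ^ (p - 1) * c₁ ^ (p - 1) * T ^ (-(α * (decayExponent N p * p))) := by
    rw [Real.mul_rpow (by positivity) (by positivity), Real.mul_rpow hκ.le hc₁0.le,
      ← Real.rpow_mul hT.le, decayExponent_mul hp]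
    ring_nf
  rw [eA, show 1 - p = -(p - 1) by ring, Real.rpow_neg hA0.le, eA2] at h
  have eT : T ^ (α * (1 - decayExponent N p * p)) =
      T ^ (-(α * (decayExponent N p * p))) * T ^ (α - 1) * T := by
    rw [← Real.rpow_add hT, ← Real.rpow_add_one hT.ne']
    ring_nf
  rw [eT, lt_div_iff₀ h0, lt_div_iff₀ (by positivity)]
  have hX : 0 < T ^ (-(α * (decayExponent N p * p))) := by positivity
  have hY : 0 < T ^ (α - 1) := by positivity
  have hZ : 0 < κ ^ (p - 1) := by positivity
  have hW : 0 < c₁ ^ (p - 1) := by positivity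
  rw [← sub_pos] at h ⊢
  -- The desired difference is a positive multiple of the known one.
  have e : 4 - κ ^ (p - 1) * (T ^ (-(α * (decayExponent N p * p))) * T ^ (α - 1) * T) * α *
      (c₁ ^ (p - 1) * c₂ * q) = (2 * (κ ^ (p - 1) * c₁ ^ (p - 1) *
        T ^ (-(α * (decayExponent N p * p))) * (α * T ^ (α - 1) * c₂) * q)) *
      (2 * (κ ^ (p - 1) * c₁ ^ (p - 1) * T ^ (-(α * (decayExponent N p * p))))⁻¹ /
        (α * T ^ (α - 1) * c₂) * q⁻¹ - T / 2) := by
    field_simp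
    ring
  rw [e]
  exact mul_pos (by positivity) h

end TimeFractionalFujita

/-! ### Solvability and life span for a Dirac mass -/

namespace TimeFractionalFujita

/-- A value of `κ ^ (p - 1) * T ^ (α * (1 - N (p - 1) / 2))` up to which the iteration stays
bounded by twice the free evolution. -/
noncomputable def smallMassConst (N : ℕ) (p α : ℝ) : ℝ :=
  Real.Gamma (1 - decayExponent N p) / (2 * (2 * Real.Gamma (1 - decayExponent N p)) ^ p *
    (2 * (1 / (1 - α * (decayExponent N p * p)) + 1 / (α * (1 - decayExponent N p)))))

lemma smallMassConst_pos {N : ℕ} {p α : ℝ} (h0 : 0 < α) (h1 : α < 1) (hp : 1 < p)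
    (hγ : decayExponent N p * p ≤ 1) : 0 < smallMassConst N p α := by
  have h2 : decayExponent N p < 1 := decayExponent_lt_one hp hγ
  have h3 : 0 < Real.Gamma (1 - decayExponent N p) := Real.Gamma_pos_of_pos (by linarith)
  have h4 : 0 < 1 - α * (decayExponent N p * p) := by nlinarith
  have h5 : 0 < α * (1 - decayExponent N p) := mul_pos h0 (by linarith)
  unfold smallMassConst
  positivity

lemma diracMass_mono (N : ℕ) {κ κ' : ℝ} (h : κ ≤ κ') : diracMass N κ ≤ diracMass N κ' := by
  intro s
  simp only [diracMass, Measure.smul_apply, smul_eq_mul]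
  gcongr

instance (N : ℕ) (κ : ℝ) : SFinite (diracMass N κ) := by
  unfold diracMass
  infer_instance

lemma isMinimalSolution_of_small {N : ℕ} {p α κ T : ℝ} (h0 : 0 < α) (h1 : α < 1) (hN : 1 ≤ N)
    (hp : 1 < p) (hγ : decayExponent N p * p ≤ 1) (hκ : 0 < κ)
    (h : κ ^ (p - 1) * T ^ (α * (1 - decayExponent N p * p)) ≤ smallMassConst N p α) :
    IsMinimalSolution α p (diracMass N κ) T (picardLimit α p (diracMass N κ)) := by
  refine isMinimalSolution_picardLimit h0 h1 (by linarith) _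
    (picardLimit_lt_top_of_small h0 h1 hN hp hγ hκ rfl ?_)
  have h2 : decayExponent N p < 1 := decayExponent_lt_one hp hγ
  have h3 : 0 < Real.Gamma (1 - decayExponent N p) := Real.Gamma_pos_of_pos (by linarith)
  have h4 : 0 < 1 - α * (decayExponent N p * p) := by nlinarith
  have h5 : 0 < α * (1 - decayExponent N p) := mul_pos h0 (by linarith)
  have h6 : 0 < 2 * (1 / (1 - α * (decayExponent N p * p)) +
    1 / (α * (1 - decayExponent N p))) := by positivity
  rw [smallMassConst, le_div_iff₀ (by positivity)] at h
  rw [show 2 * κ * Real.Gamma (1 - decayExponent N p) =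
    κ * (2 * Real.Gamma (1 - decayExponent N p)) by ring, Real.mul_rpow hκ.le (by positivity),
    show κ ^ p = κ * κ ^ (p - 1) by rw [← Real.rpow_one_add' hκ.le (by linarith)]; ring_nf]
  calc _ = κ * (κ ^ (p - 1) * T ^ (α * (1 - decayExponent N p * p)) *
      (2 * (2 * Real.Gamma (1 - decayExponent N p)) ^ p *
    (2 * (1 / (1 - α * (decayExponent N p * p)) + 1 / (α * (1 - decayExponent N p)))))) := by ring
    _ ≤ _ := by gcongr

/-- A solution with mass κ' dominates the Picard iterates with mass κ, whose limit is therefore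
finite almost everywhere. -/
lemma LocallySolvable.mono {N : ℕ} {p α κ κ' : ℝ} (h0 : 0 < α) (h1 : α < 1) (hp : 1 < p)
    (h : κ ≤ κ') (hs : LocallySolvable α p (diracMass N κ')) :
    LocallySolvable α p (diracMass N κ) := by
  obtain ⟨T, hT, u, hu⟩ := hs
  exact ⟨T, hT, _, (isMinimalSolution_picardLimit h0 h1 (by linarith) _
    (IsSolution.picardLimit_lt_top (by linarith) (diracMass_mono N h) hu)).1⟩

/-- The shorter time T' is admitted because in the supercritical case the condition is strongest as
T' → 0. -/
lemma IsSolution.mass_rpow_lt {N : ℕ} {p α κ T T' : ℝ} (h0 : 0 < α) (h1 : α < 1)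
    (hp : 1 < p) (hκ : 0 < κ) (hT' : 0 < T') (hTT' : T' ≤ T) {u : ℝ → Space N → ℝ≥0∞}
    (hu : IsSolution α p (diracMass N κ) T u) :
    κ ^ (p - 1) * T' ^ (α * (1 - decayExponent N p * p)) < massConst N p / α := by
  have hle : volume.restrict (Ioc 0 T' ×ˢ (univ : Set (Space N))) ≤
      volume.restrict (Ioc 0 T ×ˢ univ) :=
    Measure.restrict_mono (prod_mono (Ioc_subset_Ioc_right hTT') le_rfl) le_rfl
  exact mass_rpow_lt_of_picardLimit_lt_top h0 h1 hp hκ hT'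
    (ae_mono hle (IsSolution.picardLimit_lt_top (by linarith) le_rfl hu))

lemma mass_rpow_mul_le_iff {κ T a q c : ℝ} (hκ : 0 < κ) (hT : 0 < T) (ha : 0 < a) (hc : 0 < c) :
    κ ^ q * T ^ a ≤ c ↔ T ≤ c ^ (1 / a) * κ ^ (-(q / a)) := by
  have hX : 0 < c ^ (1 / a) * κ ^ (-(q / a)) := by positivity
  rw [← Real.rpow_le_rpow_iff hT.le hX.le ha, Real.mul_rpow (by positivity) (by positivity),
    ← Real.rpow_mul hc.le, ← Real.rpow_mul hκ.le, one_div_mul_cancel ha.ne', Real.rpow_one,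
    show -(q / a) * a = -q by field_simp, Real.rpow_neg hκ.le, ← div_eq_mul_inv,
    le_div_iff₀ (by positivity), mul_comm]

lemma limsup_ofReal_mem_Ioo {f : ℝ → ℝ} (hf : ContinuousAt f 1) (h : 0 < f 1) :
    limsup (fun α => ENNReal.ofReal (f α)) (𝓝[<] 1) ∈ Ioo 0 ∞ := by
  have h2 : Tendsto (fun α => ENNReal.ofReal (f α)) (𝓝[<] 1) (𝓝 (ENNReal.ofReal (f 1))) :=
    (ENNReal.tendsto_ofReal hf.tendsto).mono_left nhdsWithin_le_nhds
  rw [h2.limsup_eq]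
  exact ⟨ENNReal.ofReal_pos.2 h, ENNReal.ofReal_lt_top⟩

lemma locallySolvable_of_subcritical {N : ℕ} {p α κ : ℝ} (h0 : 0 < α) (h1 : α < 1) (hN : 1 ≤ N)
    (hp : 1 < p) (hγ : decayExponent N p * p < 1) (hκ : 0 < κ) :
    LocallySolvable α p (diracMass N κ) := by
  have ha : 0 < α * (1 - decayExponent N p * p) := mul_pos h0 (by linarith)
  have hc := smallMassConst_pos h0 h1 hp hγ.le
  exact ⟨smallMassConst N p α ^ (1 / (α * (1 - decayExponent N p * p))) *
    κ ^ (-((p - 1) / (α * (1 - decayExponent N p * p)))), by positivity, _,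
    (isMinimalSolution_of_small h0 h1 hN hp hγ.le hκ
      ((mass_rpow_mul_le_iff hκ (by positivity) ha hc).2 le_rfl)).1⟩

/-- Both constants are explicit functions of α, continuous at α = 1: γp < 1 keeps the denominators
away from 0 there. -/
lemma equivalent_lifespan {N : ℕ} {p : ℝ} (hN : 1 ≤ N) (hp : 1 < p)
    (hγ : decayExponent N p * p < 1) :
    Equivalent (fun α κ => lifespan α p (diracMass N κ))
      (fun α κ => κ ^ (-((p - 1) / (α * (1 - decayExponent N p * p))))) := by
  have h2 : decayExponent N p < 1 := decayExponent_lt_one hp hγ.le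
  have h3 : 0 < Real.Gamma (1 - decayExponent N p) := Real.Gamma_pos_of_pos (by linarith)
  have hM : 0 < massConst N p := massConst_pos N hp
  set c : ℝ → ℝ := fun α => smallMassConst N p α ^ (1 / (α * (1 - decayExponent N p * p))) with hc
  set C : ℝ → ℝ := fun α => (massConst N p / α) ^ (1 / (α * (1 - decayExponent N p * p))) with hC
  have hs1 : 0 < smallMassConst N p 1 := by
    have h4 : 0 < 1 - decayExponent N p * p := by linarith
    have h5 : 0 < 1 - decayExponent N p := by linarith
    unfold smallMassConst
    simp only [one_mul]
    positivity
  have hexp : ContinuousAt (fun α : ℝ => 1 / (α * (1 - decayExponent N p * p))) 1 := by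
    refine ContinuousAt.div continuousAt_const (by fun_prop) ?_
    simp only [one_mul]
    linarith
  have hs : ContinuousAt (fun α => smallMassConst N p α) 1 := by
    have h4 : 0 < 1 - decayExponent N p * p := by linarith
    have h5 : 0 < 1 - decayExponent N p := by linarith
    unfold smallMassConst
    refine ContinuousAt.div continuousAt_const (continuousAt_const.mul (continuousAt_const.mul
      (ContinuousAt.add (ContinuousAt.div continuousAt_const (by fun_prop) ?_)
        (ContinuousAt.div continuousAt_const (by fun_prop) ?_)))) ?_
    · simp only [one_mul]; exact h4.ne'
    · simp only [one_mul]; exact h5.ne'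
    · simp only [one_mul]; positivity
  have hcc : ContinuousAt c 1 := hs.rpow hexp (.inl hs1.ne')
  have hCc : ContinuousAt C 1 :=
    ContinuousAt.rpow (continuousAt_const.div continuousAt_id one_ne_zero) hexp
      (.inl (by simpa using hM.ne'))
  have hcpos : 0 < c 1 := Real.rpow_pos_of_pos hs1 _
  have hCpos : 0 < C 1 := Real.rpow_pos_of_pos (by simpa using hM) _
  -- Adding c to the upper constant secures the strict inequality between the two.
  refine ⟨c, fun α => C α + c α, fun α hα => ?_, limsup_ofReal_mem_Ioo hcc hcpos,
    limsup_ofReal_mem_Ioo (hCc.add hcc) (add_pos hCpos hcpos)⟩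
  obtain ⟨h0, h1⟩ := hα
  have ha : 0 < α * (1 - decayExponent N p * p) := mul_pos h0 (by linarith)
  have hcα : 0 < smallMassConst N p α := smallMassConst_pos h0 h1 hp hγ.le
  have hcα' : 0 < c α := Real.rpow_pos_of_pos hcα _
  have hCα : 0 < C α := Real.rpow_pos_of_pos (div_pos hM h0) _
  refine ⟨hcα', by linarith, fun κ hκ => ⟨?_, ?_⟩⟩
  · have hT : 0 < c α * κ ^ (-((p - 1) / (α * (1 - decayExponent N p * p)))) := by positivity
    exact le_iSup₂_of_le _ ⟨hT, _, isMinimalSolution_of_small h0 h1 hN hp hγ.le hκ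
      ((mass_rpow_mul_le_iff hκ hT ha hcα).2 le_rfl)⟩ le_rfl
  · refine iSup₂_le fun T hT => ENNReal.ofReal_le_ofReal ?_
    obtain ⟨hT, u, hu, -⟩ := hT
    have h := (mass_rpow_mul_le_iff hκ hT ha (div_pos hM h0)).1
      (hu.mass_rpow_lt h0 h1 hp hκ hT le_rfl).le
    refine h.trans ?_
    gcongr
    linarith

/-- The exponent of T vanishes, so the sufficient and the necessary condition bound κ alone. The
solvable masses thus form a nonempty bounded set, downward closed among positive masses, and its
supremum is the threshold. -/
lemma exists_critical_mass {N : ℕ} {p α : ℝ} (h0 : 0 < α) (h1 : α < 1) (hN : 1 ≤ N)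
    (hp : 1 < p) (hγ : decayExponent N p * p = 1) : ∃ κ₀ : ℝ, 0 < κ₀ ∧
      (∀ κ : ℝ, 0 < κ → κ < κ₀ → LocallySolvable α p (diracMass N κ)) ∧
      (∀ κ : ℝ, κ₀ < κ → ¬ LocallySolvable α p (diracMass N κ)) := by
  have hc : 0 < smallMassConst N p α := smallMassConst_pos h0 h1 hp hγ.le
  have hM : 0 < massConst N p / α := div_pos (massConst_pos N hp) h0
  have hp1 : 0 < p - 1 := by linarith
  set S : Set ℝ := {κ | 0 < κ ∧ LocallySolvable α p (diracMass N κ)} with hS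
  have hmem : smallMassConst N p α ^ (1 / (p - 1)) ∈ S := by
    refine ⟨by positivity, 1, one_pos, _, (isMinimalSolution_of_small h0 h1 hN hp hγ.le
      (by positivity) ?_).1⟩
    rw [Real.one_rpow, mul_one, ← Real.rpow_mul hc.le, one_div_mul_cancel hp1.ne', Real.rpow_one]
  have hbdd : BddAbove S := by
    refine ⟨(massConst N p / α) ^ (1 / (p - 1)), ?_⟩
    rintro κ ⟨hκ, T, hT, u, hu⟩
    have h := hu.mass_rpow_lt h0 h1 hp hκ hT le_rfl
    rw [hγ, sub_self, mul_zero, Real.rpow_zero, mul_one] at h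
    rw [← Real.rpow_le_rpow_iff hκ.le (by positivity) hp1, ← Real.rpow_mul hM.le,
      one_div_mul_cancel hp1.ne', Real.rpow_one]
    exact h.le
  have hpos : 0 < sSup S := hmem.1.trans_le (le_csSup hbdd hmem)
  refine ⟨sSup S, hpos, fun κ _ hlt => ?_, fun κ hlt hs => ?_⟩
  · obtain ⟨κ', hκ', hlt'⟩ := exists_lt_of_lt_csSup ⟨_, hmem⟩ hlt
    exact hκ'.2.mono h0 h1 hp hlt'.le
  · exact hlt.not_ge (le_csSup hbdd ⟨hpos.trans hlt, hs⟩)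

/-- The exponent of T' is negative, so restricting a solution to short intervals sends the left side
of the necessary condition to infinity. -/
lemma not_locallySolvable_of_supercritical {N : ℕ} {p α κ : ℝ} (h0 : 0 < α) (h1 : α < 1)
    (hp : 1 < p) (hγ : 1 < decayExponent N p * p) (hκ : 0 < κ) :
    ¬ LocallySolvable α p (diracMass N κ) := by
  rintro ⟨T, hT, u, hu⟩
  have he : 0 < α * (decayExponent N p * p - 1) := mul_pos h0 (by linarith)
  have hZ : 0 < κ ^ (p - 1) := by positivity
  have hlim : Tendsto (fun T' : ℝ => κ ^ (p - 1) * T' ^ (α * (1 - decayExponent N p * p)))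
      (𝓝[>] 0) atTop := by
    refine Tendsto.const_mul_atTop hZ ?_
    rw [show α * (1 - decayExponent N p * p) = -(α * (decayExponent N p * p - 1)) by ring]
    exact tendsto_rpow_neg_nhdsGT_zero (by linarith)
  obtain ⟨T', h, h'⟩ := ((hlim.eventually_ge_atTop (massConst N p / α)).and
    (Ioc_mem_nhdsGT hT)).exists
  exact h.not_gt (hu.mass_rpow_lt h0 h1 hp hκ h'.1 h'.2)

end TimeFractionalFujita

open TimeFractionalFujita in
theorem corollary1p1 (N : ℕ) (hN : 1 ≤ N) (p : ℝ) (hp : 1 < p) :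
    (p < fujitaExponent N →
      (∀ α ∈ Set.Ioo (0 : ℝ) 1, ∀ κ : ℝ, 0 < κ → LocallySolvable α p (diracMass N κ)) ∧
      Equivalent (fun α κ => lifespan α p (diracMass N κ))
        (fun α κ => κ ^ (-(2 * (p - 1) / (α * (2 - (N : ℝ) * (p - 1))))))) ∧
    (p = fujitaExponent N → ∀ α ∈ Set.Ioo (0 : ℝ) 1, ∃ κ₀ : ℝ, 0 < κ₀ ∧
      (∀ κ : ℝ, 0 < κ → κ < κ₀ → LocallySolvable α p (diracMass N κ)) ∧
      (∀ κ : ℝ, κ₀ < κ → ¬ LocallySolvable α p (diracMass N κ))) ∧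
    (fujitaExponent N < p → ∀ α ∈ Set.Ioo (0 : ℝ) 1, ∀ κ : ℝ, 0 < κ →
      ¬ LocallySolvable α p (diracMass N κ)) := by
  have hN0 : (0 : ℝ) < N := by exact_mod_cast hN
  have hF : fujitaExponent N - 1 = 2 / (N : ℝ) := by simp [fujitaExponent]
  have hγ : decayExponent N p * p = N * (p - 1) / 2 := decayExponent_mul hp
  refine ⟨fun h => ?_, fun h α hα => ?_, fun h α hα κ hκ => ?_⟩
  · have h' : decayExponent N p * p < 1 := by
      have : p - 1 < 2 / (N : ℝ) := by linarith
      rw [lt_div_iff₀ hN0] at this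
      rw [hγ]
      linarith
    refine ⟨fun α hα κ hκ => locallySolvable_of_subcritical hα.1 hα.2 hN hp h' hκ, ?_⟩
    have e : ∀ α : ℝ, 2 * (p - 1) / (α * (2 - (N : ℝ) * (p - 1))) =
        (p - 1) / (α * (1 - decayExponent N p * p)) := fun α => by
      rw [hγ, show α * (2 - (N : ℝ) * (p - 1)) = 2 * (α * (1 - N * (p - 1) / 2)) by ring,
        mul_div_mul_left _ _ two_ne_zero]
    simp only [e]
    exact equivalent_lifespan hN hp h'
  · have h' : decayExponent N p * p = 1 := by
      have : p - 1 = 2 / (N : ℝ) := by linarith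
      rw [hγ, this]
      field_simp
    exact exists_critical_mass hα.1 hα.2 hN hp h'
  · have h' : 1 < decayExponent N p * p := by
      have : 2 / (N : ℝ) < p - 1 := by linarith
      rw [div_lt_iff₀ hN0] at this
      rw [hγ]
      linarith
    exact not_locallySolvable_of_supercritical hα.1 hα.2 hp h' hκ
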